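/- Let $\Bbbk$ be a field and $H$ a Hopf algebra over $\Bbbk$ with counit $\epsilon$ and antipode $S$ (not assumed invertible). For a $\Bbbk$-algebra $A$ put $A^e=A\otimes A^{\mathrm{op}}$; $A$-bimodules are left $A^e$-modules, and $\mathrm{Ext}^i_{A^e}(A,A^e)$ is an $A$-bimodule through the right $A^e$-module structure of $A^e$. For an algebra automorphism $\sigma$ of $A$, $A^\sigma$ is the space $A$ with bimodule structure $a\cdot x\cdot b=a\,x\,\sigma(b)$. For $n\in\mathbb N$, suppose that $A$ has a finite resolution by finitely generated projective $A$-bimodules and that $\mathrm{Ext}^i_{A^e}(A,A^e)=0$ for all $i\neq n$. Then $A$ has Van den Bergh duality of dimension $n$ if $\mathrm{Ext}^n_{A^e}(A,A^e)$ is an invertible $A$-bimodule; it is skew-Calabi–Yau of dimension $n$ with Nakayama automorphism $\sigma$ if $\mathrm{Ext}^n_{A^e}(A,A^e)\simeq A^\sigma$ as bimodules; it is Calabi–Yau of dimension $n$ if $\mathrm{Ext}^n_{A^e}(A,A^e)\simeq A$ as bimodules. Let $\Bbbk_H$ be the trivial right $H$-module, and let $\mathrm{per}(H^{\mathrm{op}})$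 be the smallest triangulated subcategory of the derived category of right $H$-modules that contains $H$ and is stable under direct summands. $H$ satisfies the right Artin–Schelter condition of dimension $d$ if $\mathrm{Ext}^i_{H^{\mathrm{op}}}(\Bbbk_H,H)$ has dimension $1$ over $\Bbbk$ for $i=d$ and $0$ for $i\ne d$; its right homological integral is then the algebra homomorphism $\int_r\colon H\to\Bbbk$ by which $H$ acts on the left on $\mathrm{Ext}^d_{H^{\mathrm{op}}}(\Bbbk_H,H)$, and it is trivial if $\int_r=\epsilon$. For a linear map $\pi\colon H\to\Bbbk$ put $\Xi^r_\pi(h)=h_1\pi(h_2)$. **Theorem.** The following conditions are equivalent: (i) $H$ has Van den Bergh duality (of some dimension); (ii) $\Bbbk_H\in\mathrm{per}(H^{\mathrm{op}})$, $S$ is invertible, and the graded space $\mathrm{Ext}^*_{H^{\mathrm{op}}}(\Bbbk_H,H)$ is finite-dimensional and concentrated in one degree; (iii) $H$ is skew-Calabi–Yau (of some dimension). When they hold, the dimensions in (i) and (iii) and the degree in (ii) coincide. If $d$ denotes this number, $H$ satisfies the right Artin–Schelter condition of dimension $d$, and $S^{-2}\circ\Xi^r_{\int_r\circ S}=(S^2\circ\Xi^r_{\int_r})^{-1}$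 is a Nakayama automorphism of $H$; moreover $\epsilon\circ\mu^{-1}=\int_r$ for every Nakayama automorphism $\mu$ of $H$. Consequently, for every $d\in\mathbb N$, $H$ is Calabi–Yau of dimension $d$ if and only if $\Bbbk_H\in\mathrm{per}(H^{\mathrm{op}})$, $S^2$ is an inner automorphism of $H$, and $H$ satisfies the right Artin–Schelter condition of dimension $d$ with trivial right homological integral. -/

import Mathlib

open CategoryTheory TensorProduct MulOpposite

universe u

namespace HopfDuality

noncomputable section

/-! ### Perfect modules and `Ext` -/

section General

variable {R : Type u} [Ring R]

/-- The left `R`-module `M`, as a complex concentrated in degree `0`, belongs to `per(R)`: the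
smallest triangulated subcategory of the derived category of `R`-modules that contains `R` and is
stable under direct summands (in a triangulated category every retract is a direct summand). -/
def IsPerfect (M : ModuleCat.{u} R) : Prop :=
  letI : HasDerivedCategory.{u + 1} (ModuleCat.{u} R) := HasDerivedCategory.standard _
  ∀ P : ObjectProperty (DerivedCategory (ModuleCat.{u} R)),
    P.IsTriangulated → P.IsStableUnderRetracts →
    P ((DerivedCategory.singleFunctor (ModuleCat.{u} R) 0).obj (ModuleCat.of R R)) →
    P ((DerivedCategory.singleFunctor (ModuleCat.{u} R) 0).obj M)

/-- `M` admits a finite resolution by finitely generated projective left `R`-modules. -/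
def HasFiniteResolution (M : ModuleCat.{u} R) : Prop :=
  ∃ P : ProjectiveResolution M, (∀ i, Module.Finite R (P.complex.X i)) ∧
    ∃ n : ℕ, ∀ i, n < i → Subsingleton (P.complex.X i)

/-- Endomorphisms of `N` act on `Ext^n_R(M, N)` by composition. -/
def extEnd (M N : ModuleCat.{u} R) (n : ℕ) :
    Module.End R N →+* AddMonoid.End (Abelian.Ext.{u} M N n) where
  toFun f :=
    { toFun := fun x => x.comp (Abelian.Ext.mk₀ (ModuleCat.ofHom f)) (add_zero n)
      map_zero' := by simp
      map_add' := fun x y => by simp }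
  map_zero' := AddMonoidHom.ext fun x => by
    change x.comp (Abelian.Ext.mk₀ (0 : N ⟶ N)) (add_zero n) = 0
    simp
  map_add' f g := AddMonoidHom.ext fun x => by
    change x.comp (Abelian.Ext.mk₀ (ModuleCat.ofHom f + ModuleCat.ofHom g)) (add_zero n) = _
    rw [Abelian.Ext.mk₀_add, Abelian.Ext.comp_add]
    rfl
  map_one' := AddMonoidHom.ext fun x => Abelian.Ext.comp_mk₀_id x
  map_mul' f g := AddMonoidHom.ext fun x => by
    change x.comp (Abelian.Ext.mk₀ (ModuleCat.ofHom g ≫ ModuleCat.ofHom f)) (add_zero n) =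
      (x.comp (Abelian.Ext.mk₀ (ModuleCat.ofHom g)) (add_zero n)).comp
        (Abelian.Ext.mk₀ (ModuleCat.ofHom f)) (add_zero n)
    rw [Abelian.Ext.comp_assoc_of_third_deg_zero, Abelian.Ext.mk₀_comp_mk₀]

end General

/-! ### Bimodules -/

section Bimodules

variable (k A : Type u) [Field k] [Ring A] [Algebra k A]

/-- The enveloping algebra `A ⊗ A^op`. -/
abbrev Env : Type u := A ⊗[k] Aᵐᵒᵖ

/-- `A`-bimodules (with central action of `k`) are left modules over the enveloping algebra:
`a m b = (a ⊗ op b) • m`. -/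
abbrev Bimod : Type (u + 1) := ModuleCat.{u} (Env k A)

section Twist

variable {k A}

/-- Underlying space of the bimodule `A^σ`. -/
def TwistSpace (_σ : A →ₐ[k] A) : Type u := A

instance (σ : A →ₐ[k] A) : AddCommGroup (TwistSpace σ) := inferInstanceAs (AddCommGroup A)

/-- The ring homomorphism `a ⊗ op b ↦ (x ↦ a * x * σ b)`. -/
def twistHom (σ : A →ₐ[k] A) : Env k A →ₐ[k] Module.End k A :=
  (AlgHom.mulLeftRight k A).comp (Algebra.TensorProduct.map (AlgHom.id k A) (AlgHom.op σ))

instance (σ : A →ₐ[k] A) : Module (Env k A) (TwistSpace σ) :=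
  Module.compHom A (twistHom σ).toRingHom

theorem twist_smul (σ : A →ₐ[k] A) (a b x : A) :
    (a ⊗ₜ[k] op b : Env k A) • (show TwistSpace σ from x) = (show A from a * x * σ b) := by
  change twistHom σ (a ⊗ₜ[k] op b) x = _
  simp [twistHom]

end Twist

variable {k A} in
/-- The bimodule `A^σ`: the space `A` with the bimodule structure `a • x • b = a * x * σ b`. -/
def twist (σ : A →ₐ[k] A) : Bimod k A := ModuleCat.of (Env k A) (TwistSpace σ)

/-- The algebra `A` as a bimodule over itself. -/
def regular : Bimod k A := twist (AlgHom.id k A)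

/-! #### Tensor product of bimodules over `A` -/

section Tensor

open scoped ModuleCat

variable {k A}

/-- Underlying space of the bimodule `M ⊗_k N`. -/
def OuterTensor (M N : Bimod k A) : Type u := M ⊗[k] N

instance (M N : Bimod k A) : AddCommGroup (OuterTensor M N) :=
  inferInstanceAs (AddCommGroup (M ⊗[k] N))

/-- The ring homomorphism `a ⊗ op b ↦ (m ⊗ n ↦ a m ⊗ n b)`. -/
def outerHom (M N : Bimod k A) : Env k A →ₐ[k] Module.End k (M ⊗[k] N) :=
  (Module.endTensorEndAlgHom (R := k) (A := k) (M := M) (N := N)).comp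
    (Algebra.TensorProduct.map
      ((Algebra.lsmul k k M).comp
        (Algebra.TensorProduct.includeLeft : A →ₐ[k] Env k A))
      ((Algebra.lsmul k k N).comp
        (Algebra.TensorProduct.includeRight : Aᵐᵒᵖ →ₐ[k] Env k A)))

instance (M N : Bimod k A) : Module (Env k A) (OuterTensor M N) :=
  Module.compHom (M ⊗[k] N) (outerHom M N).toRingHom

/-- The element `m ⊗ n` of `M ⊗_k N`. -/
def outerTmul (M N : Bimod k A) (m : M) (n : N) : OuterTensor M N := m ⊗ₜ[k] n

theorem smul_outerTmul (M N : Bimod k A) (m : M) (n : N) (a b : A) :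
    (a ⊗ₜ[k] op b : Env k A) • outerTmul M N m n =
      outerTmul M N ((a ⊗ₜ[k] (1 : Aᵐᵒᵖ) : Env k A) • m)
        (((1 : A) ⊗ₜ[k] op b : Env k A) • n) := by
  change outerHom M N (a ⊗ₜ[k] op b) (m ⊗ₜ[k] n) = _
  simp only [outerHom, outerTmul, AlgHom.comp_apply, Algebra.TensorProduct.map_tmul]
  rfl

/-- The sub-bimodule of `M ⊗_k N` generated by all `m a ⊗ n - m ⊗ a n`. -/
def balancing (M N : Bimod k A) : Submodule (Env k A) (OuterTensor M N) :=
  Submodule.span (Env k A) {x | ∃ (m : M) (a : A) (n : N),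
    x = outerTmul M N (((1 : A) ⊗ₜ[k] op a : Env k A) • m) n -
      outerTmul M N m ((a ⊗ₜ[k] (1 : Aᵐᵒᵖ) : Env k A) • n)}

/-- The bimodule `M ⊗_A N`. -/
def tensor (M N : Bimod k A) : Bimod k A :=
  ModuleCat.of (Env k A) (OuterTensor M N ⧸ balancing M N)

/-- `M` is invertible: there is a bimodule `N` with `M ⊗_A N ≅ A ≅ N ⊗_A M` as bimodules. -/
def IsInvertibleBimod (M : Bimod k A) : Prop :=
  ∃ N : Bimod k A, Nonempty (tensor M N ≅ regular k A) ∧ Nonempty (tensor N M ≅ regular k A)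

end Tensor

/-! #### The bimodules `Ext^n_{A^e}(A, A^e)` -/

/-- The ring homomorphism `a ⊗ op b ↦ op (b ⊗ op a)`, through which right modules over the
enveloping algebra become bimodules. -/
def envFlip : Env k A →ₐ[k] (Env k A)ᵐᵒᵖ :=
  ((Algebra.TensorProduct.opAlgEquiv k k A Aᵐᵒᵖ).toAlgHom.comp
    (Algebra.TensorProduct.map (AlgHom.id k Aᵐᵒᵖ) (AlgEquiv.opOp k A).toAlgHom)).comp
      (Algebra.TensorProduct.comm k A Aᵐᵒᵖ).toAlgHom

theorem envFlip_tmul (a b : A) :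
    envFlip k A (a ⊗ₜ[k] op b) = op (b ⊗ₜ[k] op a) := by
  simp [envFlip]

/-- The action of the enveloping algebra on itself commuting with the left regular one:
`a ⊗ op b` acts by right multiplication by `b ⊗ op a`. -/
def innerAction : Env k A →+* Module.End (Env k A) (Env k A) :=
  (Module.toModuleEnd (Env k A) (S := (Env k A)ᵐᵒᵖ) (Env k A)).comp (envFlip k A).toRingHom

theorem innerAction_tmul (a b : A) (x : Env k A) :
    innerAction k A (a ⊗ₜ[k] op b) x = x * (b ⊗ₜ[k] op a) := by
  change envFlip k A (a ⊗ₜ[k] op b) • x = _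
  rw [envFlip_tmul]
  rfl

/-- Underlying space of `Ext^n_{A^e}(A, A^e)`. -/
def DualSpace (n : ℕ) : Type u :=
  Abelian.Ext.{u} (regular k A) (ModuleCat.of (Env k A) (Env k A)) n

instance (n : ℕ) : AddCommGroup (DualSpace k A n) :=
  inferInstanceAs (AddCommGroup
    (Abelian.Ext.{u} (regular k A) (ModuleCat.of (Env k A) (Env k A)) n))

instance (n : ℕ) : Module (Env k A) (DualSpace k A n) :=
  Module.compHom (Abelian.Ext.{u} (regular k A) (ModuleCat.of (Env k A) (Env k A)) n)
    ((extEnd (regular k A) (ModuleCat.of (Env k A) (Env k A)) n).comp (innerAction k A))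

/-- The bimodule `Ext^n_{A^e}(A, A^e)`, its bimodule structure being induced by the right
multiplication of the enveloping algebra on itself. -/
def dual (n : ℕ) : Bimod k A := ModuleCat.of (Env k A) (DualSpace k A n)

/-! ### Duality conditions -/

/-- `A` has a finite resolution by finitely generated projective bimodules, and
`Ext^i_{A^e}(A, A^e)` vanishes for all `i ≠ n`. -/
structure IsSmoothConcentrated (n : ℕ) : Prop where
  smooth : HasFiniteResolution (regular k A)
  vanish : ∀ i, i ≠ n → Subsingleton (dual k A i)

/-- Van den Bergh duality with dimension `n`. -/
def HasVanDenBerghDuality (n : ℕ) : Prop :=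
  IsSmoothConcentrated k A n ∧ IsInvertibleBimod (dual k A n)

variable {k A} in
/-- `A` is skew-Calabi-Yau with dimension `n` and `σ` is a Nakayama automorphism of `A`. -/
def IsNakayamaAutomorphism (n : ℕ) (σ : A ≃ₐ[k] A) : Prop :=
  IsSmoothConcentrated k A n ∧ Nonempty (dual k A n ≅ twist (σ : A →ₐ[k] A))

/-- `A` is skew-Calabi-Yau with dimension `n`. -/
def IsSkewCalabiYau (n : ℕ) : Prop := ∃ σ : A ≃ₐ[k] A, IsNakayamaAutomorphism n σ

/-- `A` is Calabi-Yau with dimension `n`. -/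
def IsCalabiYau (n : ℕ) : Prop :=
  IsSmoothConcentrated k A n ∧ Nonempty (dual k A n ≅ regular k A)

end Bimodules

/-! ### Hopf algebras -/

section Hopf

variable (k H : Type u) [Field k] [Ring H] [HopfAlgebra k H]

/-- Underlying space of the trivial module. -/
def TrivialSpace (k _H : Type u) : Type u := k

instance : AddCommGroup (TrivialSpace k H) := inferInstanceAs (AddCommGroup k)

/-- The right action of `H` on `k` through the counit. -/
instance : Module Hᵐᵒᵖ (TrivialSpace k H) :=
  Module.compHom k
    ((Bialgebra.counitAlgHom k H).fromOpposite fun _ _ => Commute.all _ _).toRingHom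

theorem trivial_smul (h : H) (c : k) :
    op h • (show TrivialSpace k H from c) = (show k from Coalgebra.counit h * c) := rfl

/-- The trivial right `H`-module `k_H`. Right `H`-modules are left modules over `H^op`. -/
def trivialRight : ModuleCat.{u} Hᵐᵒᵖ := ModuleCat.of Hᵐᵒᵖ (TrivialSpace k H)

/-- `Ext^n_{H^op}(k_H, H)`. -/
def ExtRight (n : ℕ) : Type u :=
  Abelian.Ext.{u} (trivialRight k H) (ModuleCat.of Hᵐᵒᵖ H) n

instance (n : ℕ) : AddCommGroup (ExtRight k H n) :=
  inferInstanceAs (AddCommGroup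
    (Abelian.Ext.{u} (trivialRight k H) (ModuleCat.of Hᵐᵒᵖ H) n))

/-- The left `H`-module structure of `Ext^n_{H^op}(k_H, H)`, induced by left multiplication
on `H`. -/
instance (n : ℕ) : Module H (ExtRight k H n) :=
  Module.compHom (Abelian.Ext.{u} (trivialRight k H) (ModuleCat.of Hᵐᵒᵖ H) n)
    ((extEnd (trivialRight k H) (ModuleCat.of Hᵐᵒᵖ H) n).comp
      (Module.toModuleEnd Hᵐᵒᵖ (S := H) H))

instance (n : ℕ) : Module k (ExtRight k H n) :=
  Module.compHom (ExtRight k H n) (algebraMap k H)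

/-- `k_H` is perfect, the antipode is invertible, and the graded space `Ext^*_{H^op}(k_H, H)` is
finite-dimensional and concentrated in degree `d`. -/
structure HasFiniteRightExt (d : ℕ) : Prop where
  perfect : IsPerfect (trivialRight k H)
  bijective : Function.Bijective (HopfAlgebra.antipode k (A := H))
  finite : Module.Finite k (ExtRight k H d)
  vanish : ∀ i, i ≠ d → Subsingleton (ExtRight k H i)

/-- The right Artin-Schelter condition with dimension `d`. -/
def IsRightArtinSchelter (d : ℕ) : Prop :=
  ∀ i, Module.rank k (ExtRight k H i) = if i = d then 1 else 0

variable {k H}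

/-- `H` satisfies the right Artin-Schelter condition with dimension `d`, and its right homological
integral is given by the algebra homomorphism `π`. -/
def IsRightHomologicalIntegral (d : ℕ) (π : H →ₐ[k] k) : Prop :=
  IsRightArtinSchelter k H d ∧ ∀ (h : H) (α : ExtRight k H d), h • α = π h • α

/-- The right winding map `h ↦ h₁ π(h₂)`. -/
def rightWinding (π : H →ₗ[k] k) : H →ₗ[k] H :=
  (TensorProduct.rid k H).toLinearMap ∘ₗ π.lTensor H ∘ₗ Coalgebra.comul

variable (k H)

/-- The square of the antipode is an inner automorphism. -/
def IsAntipodeSqInner : Prop :=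
  ∃ u : Hˣ, ∀ h : H,
    HopfAlgebra.antipode k (HopfAlgebra.antipode k h) = (u : H) * h * (↑u⁻¹ : H)

end Hopf

end

end HopfDuality

open HopfDuality

/-!
Everything is deduced from the cohomology of the trivial module over the algebra `Hᵐᵒᵖ`.

*Reduction to the trivial module.* Bimodules become right modules through the homomorphism `op h ↦
∑ S(h₁) ⊗ op h₂` (`diag`). This restriction has an exact left adjoint `M ↦ M ⊗ H`, which sends the
trivial module `k` to the regular bimodule (`inducedTrivialIso`), and exact adjoint functors
transpose `Ext` (`extTranspose_bijective`). Perfection is characterised by finite projective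
dimension together with Brown's criterion, which tests `Ext` on directed systems of modules with
vanishing colimit (`isPerfect_iff`); this criterion visibly passes through transposition, whence
`H` has a finite resolution by finitely generated projective bimodules if and only if `k` is
perfect (`hasFiniteResolution_regular_iff`). When this is so, `Ext^d_{H^e}(H, H^e)` is `Ext^d(k,
H) ⊗ H` (`dualEquiv`), with `a (e ⊗ v) b = ∑ a₂ e ⊗ S²(a₁) v b` (`smul_dualEquiv`).

*The one-dimensional case.* If `Ext^d(k, H)` has dimension one, `H` acts on it by a character `π`,
and `Ext^d_{H^e}(H, H^e)` is `H` with left action twisted by `θ = S² ∘ Ξ_π` (`exists_dual_equiv`).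
As `Ξ_π` is bijective and commutes with `S²`, the homomorphism `θ` is bijective exactly when `S`
is, and then `θ⁻¹` is a Nakayama automorphism. All other Nakayama automorphisms differ from it by
conjugation by a unit, which no character notices, and the Calabi-Yau criterion is the case where
`θ` is inner.

*Dimension one.* It remains to see that `E = Ext^d(k, H)` has dimension one. In both cases this is
done by letting the endomorphism ring of `E` act on something that forces it to have a character,
which is impossible for a space of another dimension (`finrank_eq_one_of_end_hom`).
- If the bimodule `E ⊗ H` is invertible, with inverse `N`, then the endomorphisms of `E` act on
  `(E ⊗ H) ⊗_H N ≅ H` by right linear maps, that is, by left multiplications, and the counit of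
  `H` provides the character (`finrank_eq_one_of_tensor_iso`). Invertibility also forces `θ` to be
  bijective (`bijective_of_invertible`).
- If `S` is bijective, `k` is perfect and `Ext^*(k, H)` is finite-dimensional and concentrated in
  degree `d`, then there is a Serre duality between `Ext^a(k, N)` and `Ext^(d - a)(N ⊗ E, k)`
  (`serre_duality`). For `N = Hom(H, k)` and `a = 0` the first space is one-dimensional. On the
  other hand `N ⊗ E` is the coinduced module `Hom(H, E)` (`nonempty_coind_tensor_iso`), on which
  the endomorphism ring of `E` acts (`finrank_serreSpace`).
-/

universe w

namespace HopfDuality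

noncomputable section

/-! ### Perfect modules, Brown's criterion and finite resolutions -/

section Finiteness

open Abelian DerivedCategory Limits Pretriangulated

variable {R : Type u} [Ring R]

/-- A direct system of modules indexed by a directed preorder whose colimit is zero: every element
dies at some later stage. -/
def IsVanishingSystem {I : Type u} [Preorder I] (Y : I ⥤ ModuleCat.{u} R) : Prop :=
  ∀ (i : I) (y : Y.obj i), ∃ (j : I) (h : i ≤ j), (Y.map (homOfLE h)).hom y = 0

/-- Brown's finiteness condition: every functor `Ext^n(M, -)` annihilates the directed systems whose
colimit is zero. It amounts to the existence of a resolution of `M` by finitely generated projective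
modules. -/
def IsExtCompact (M : ModuleCat.{u} R) : Prop :=
  ∀ ⦃I : Type u⦄ [Preorder I] [IsDirectedOrder I] (Y : I ⥤ ModuleCat.{u} R),
    IsVanishingSystem Y → ∀ (n : ℕ) (i : I) (x : Ext.{u} M (Y.obj i) n),
      ∃ (j : I) (h : i ≤ j), x.comp (Ext.mk₀ (Y.map (homOfLE h))) (add_zero n) = 0

section Derived

variable [HasDerivedCategory.{w} (ModuleCat.{u} R)]

/-- The analogue of `IsExtCompact` for objects of the derived category. -/
def compactObjects (R : Type u) [Ring R] [HasDerivedCategory.{w} (ModuleCat.{u} R)] :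
    ObjectProperty (DerivedCategory (ModuleCat.{u} R)) := fun X =>
  ∀ ⦃I : Type u⦄ [Preorder I] [IsDirectedOrder I] (Y : I ⥤ ModuleCat.{u} R),
    IsVanishingSystem Y → ∀ (n : ℤ) (i : I)
      (x : X ⟶ ((singleFunctor (ModuleCat.{u} R) 0).obj (Y.obj i))⟦n⟧),
      ∃ (j : I) (h : i ≤ j),
        x ≫ ((singleFunctor (ModuleCat.{u} R) 0).map (Y.map (homOfLE h)))⟦n⟧' = 0

/-- The objects of the derived category with no morphisms to modules placed in large degrees. -/
def boundedObjects (R : Type u) [Ring R] [HasDerivedCategory.{w} (ModuleCat.{u} R)] :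
    ObjectProperty (DerivedCategory (ModuleCat.{u} R)) := fun X =>
  ∃ N : ℤ, ∀ (n : ℤ), N ≤ n → ∀ (Y : ModuleCat.{u} R)
    (x : X ⟶ ((singleFunctor (ModuleCat.{u} R) 0).obj Y)⟦n⟧), x = 0

instance : (compactObjects.{u, w} R).IsStableUnderRetracts where
  of_retract {X Z} h hZ I _ _ Y hY n i x := by
    obtain ⟨j, hj, e⟩ := hZ Y hY n i (h.r ≫ x)
    refine ⟨j, hj, ?_⟩
    have := h.i ≫= e
    simpa using this

instance : (boundedObjects.{u, w} R).IsStableUnderRetracts where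
  of_retract {X Z} h := by
    rintro ⟨N, hN⟩
    refine ⟨N, fun n hn Y x => ?_⟩
    have := h.i ≫= hN n hn Y (h.r ≫ x)
    simpa using this

instance : (compactObjects.{u, w} R).IsTriangulated where
  exists_zero := ⟨_, isZero_zero _, fun I _ _ Y _ n i x =>
    ⟨i, le_rfl, (isZero_zero _).eq_of_src _ _⟩⟩
  isStableUnderShiftBy a := ⟨fun X hX I _ _ Y hY n i x => by
    let e := (shiftFunctorAdd' (DerivedCategory (ModuleCat.{u} R)) n (-a) (n - a) (by lia))
    let e' := (shiftFunctorCompIsoId (DerivedCategory (ModuleCat.{u} R)) a (-a) (by lia))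
    obtain ⟨j, hj, h⟩ := hX Y hY (n - a) i (e'.inv.app _ ≫ x⟦-a⟧' ≫ e.inv.app _)
    refine ⟨j, hj, ?_⟩
    apply (shiftFunctor _ (-a)).map_injective
    rw [← cancel_epi (e'.inv.app X), ← cancel_mono (e.inv.app _)]
    have he := e.inv.naturality ((singleFunctor (ModuleCat.{u} R) 0).map (Y.map (homOfLE hj)))
    simp only [Functor.comp_map] at he
    simpa [e, he] using h⟩
  ext₂' T hT h₁ h₃ := ObjectProperty.le_isoClosure _ _ fun I _ _ Y hY n i x => by
    obtain ⟨j, hj, e⟩ := h₁ Y hY n i (T.mor₁ ≫ x)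
    rw [Category.assoc] at e
    obtain ⟨y, hy⟩ := Triangle.yoneda_exact₂ T hT _ e
    obtain ⟨l, hl, e'⟩ := h₃ Y hY n j y
    refine ⟨l, hj.trans hl, ?_⟩
    rw [← homOfLE_comp hj hl, Functor.map_comp, Functor.map_comp, Functor.map_comp,
      ← Category.assoc, hy, Category.assoc, e', comp_zero]

instance : (boundedObjects.{u, w} R).IsTriangulated where
  exists_zero := ⟨_, isZero_zero _, 0, fun n _ Y x => (isZero_zero _).eq_of_src _ _⟩
  isStableUnderShiftBy a := ⟨by
    rintro X ⟨N, hX⟩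
    refine ⟨N + a, fun n hn Y x => ?_⟩
    let e := (shiftFunctorAdd' (DerivedCategory (ModuleCat.{u} R)) n (-a) (n - a) (by lia))
    let e' := (shiftFunctorCompIsoId (DerivedCategory (ModuleCat.{u} R)) a (-a) (by lia))
    have h := hX (n - a) (by lia) Y (e'.inv.app _ ≫ x⟦-a⟧' ≫ e.inv.app _)
    apply (shiftFunctor _ (-a)).map_injective
    rw [← cancel_epi (e'.inv.app X), ← cancel_mono (e.inv.app _)]
    simpa [e] using h⟩
  ext₂' T hT := by
    rintro ⟨N₁, h₁⟩ ⟨N₃, h₃⟩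
    refine ObjectProperty.le_isoClosure _ _ ⟨max N₁ N₃, fun n hn Y x => ?_⟩
    obtain ⟨y, hy⟩ := Triangle.yoneda_exact₂ T hT x (h₁ n (by lia) Y _)
    rw [hy, h₃ n (by lia) Y y, comp_zero]

lemma single_hom_shift_eq_zero {n : ℤ} (hn : n ≠ 0) (Y P : ModuleCat.{u} R) [Projective P]
    (x : (singleFunctor (ModuleCat.{u} R) 0).obj P ⟶
      ((singleFunctor (ModuleCat.{u} R) 0).obj Y)⟦n⟧) : x = 0 := by
  obtain hn | hn := lt_or_gt_of_ne hn
  · have := DerivedCategory.TStructure.t.isGE_shift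
      ((singleFunctor (ModuleCat.{u} R) 0).obj Y) 0 n (-n) (by lia)
    exact DerivedCategory.TStructure.t.zero x 0 (-n) (by lia)
  · obtain ⟨m, rfl⟩ := Int.eq_ofNat_of_zero_le hn.le
    obtain ⟨m, rfl⟩ : ∃ l, m = l + 1 := ⟨m - 1, by lia⟩
    obtain ⟨y, rfl⟩ := Ext.homEquiv.{_, u}.surjective x
    rw [y.eq_zero_of_projective]
    exact Ext.zero_hom _ _ _

end Derived

lemma IsVanishingSystem.exists_map_eq_zero {I : Type u} [Preorder I] [IsDirectedOrder I]
    {Y : I ⥤ ModuleCat.{u} R} (hY : IsVanishingSystem Y) {P : ModuleCat.{u} R} [Module.Finite R P]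
    {i : I} (f : P ⟶ Y.obj i) : ∃ (j : I) (h : i ≤ j), f ≫ Y.map (homOfLE h) = 0 := by
  obtain ⟨s, hs⟩ := Module.Finite.fg_top (R := R) (M := P)
  have key : ∀ t : Finset P, ∃ (j : I) (h : i ≤ j),
      ∀ p ∈ t, (Y.map (homOfLE h)).hom (f.hom p) = 0 := by
    classical
    intro t
    induction t using Finset.induction_on with
    | empty => exact ⟨i, le_rfl, by simp⟩
    | insert a t _ ih =>
      obtain ⟨j, hj, h⟩ := ih
      obtain ⟨l, hl, h'⟩ := hY i (f.hom a)
      obtain ⟨m, hjm, hlm⟩ := exists_ge_ge j l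
      refine ⟨m, hj.trans hjm, fun p hp => ?_⟩
      rcases Finset.mem_insert.1 hp with rfl | hp
      · rw [← homOfLE_comp hl hlm, Functor.map_comp, ModuleCat.hom_comp, LinearMap.comp_apply, h',
          map_zero]
      · rw [← homOfLE_comp hj hjm, Functor.map_comp, ModuleCat.hom_comp, LinearMap.comp_apply,
          h p hp, map_zero]
  obtain ⟨j, hj, h⟩ := key s
  refine ⟨j, hj, ModuleCat.hom_ext (LinearMap.ext_on hs fun p hp => ?_)⟩
  exact h p hp

lemma isExtCompact_of_projective (P : ModuleCat.{u} R) [Projective P] [Module.Finite R P] :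
    IsExtCompact P := fun I _ _ Y hY n i x => by
  obtain _ | n := n
  · obtain ⟨f, rfl⟩ := (Ext.mk₀_bijective _ _).2 x
    obtain ⟨j, h, e⟩ := hY.exists_map_eq_zero f
    exact ⟨j, h, by rw [Ext.mk₀_comp_mk₀, e, Ext.mk₀_zero]⟩
  · exact ⟨i, le_rfl, by rw [x.eq_zero_of_projective, Ext.zero_comp]⟩

instance projective_regular : Projective (ModuleCat.of R R) :=
  ModuleCat.projective_of_categoryTheory_projective _

attribute [local instance] HasDerivedCategory.standard in
/-- The objects satisfying Brown's condition form a thick subcategory that contains `R`. -/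
lemma IsPerfect.isExtCompact {M : ModuleCat.{u} R} (hM : IsPerfect M) : IsExtCompact M := by
  have := hM (compactObjects R) inferInstance inferInstance ?_
  · intro I _ _ Y hY n i x
    obtain ⟨j, h, e⟩ := this Y hY n i x.hom
    refine ⟨j, h, Ext.ext ?_⟩
    rw [← Ext.hom_comp_singleFunctor_map_shift, e, Ext.zero_hom]
  · intro I _ _ Y hY n i x
    by_cases hn : n = 0
    · subst hn
      obtain ⟨y, rfl⟩ := (Ext.homEquiv.{_, u} (n := 0)).surjective x
      obtain ⟨j, h, e⟩ := isExtCompact_of_projective (ModuleCat.of R R) Y hY 0 i y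
      refine ⟨j, h, ?_⟩
      have := Ext.hom_comp_singleFunctor_map_shift y (Y.map (homOfLE h))
      rw [e, Ext.zero_hom] at this
      exact this
    · exact ⟨i, le_rfl, by rw [single_hom_shift_eq_zero hn _ _ x, zero_comp]⟩

attribute [local instance] HasDerivedCategory.standard in
/-- The objects of finite projective dimension form a thick subcategory that contains `R`. -/
lemma IsPerfect.exists_hasProjectiveDimensionLT {M : ModuleCat.{u} R} (hM : IsPerfect M) :
    ∃ n, HasProjectiveDimensionLT M n := by
  obtain ⟨N, hN⟩ := hM (boundedObjects R) inferInstance inferInstance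
    ⟨1, fun n hn Y x => single_hom_shift_eq_zero (by lia) _ _ x⟩
  refine ⟨N.toNat, HasProjectiveDimensionLT.mk.{_, u} fun i hi Y e => Ext.ext ?_⟩
  rw [Ext.zero_hom]
  exact hN i (by lia) Y e.hom

end Finiteness

section Resolutions

open Abelian DerivedCategory Limits Pretriangulated

variable {R : Type u} [Ring R]

/-- The direct system of the quotients of `W` by an increasing family of submodules. -/
def quotientSystem {I : Type u} [Preorder I] (W : ModuleCat.{u} R) (N : I →o Submodule R W) :
    I ⥤ ModuleCat.{u} R where
  obj i := ModuleCat.of R (W ⧸ N i)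
  map h := ModuleCat.ofHom (Submodule.factor (N.monotone (leOfHom h)))
  map_id i := by
    ext x
    rfl
  map_comp f g := by
    ext x
    rfl

/-- An `Ext` class with values in a directed union of submodules dies modulo one of them. -/
lemma IsExtCompact.exists_comp_mkQ_eq_zero {M : ModuleCat.{u} R} (hM : IsExtCompact M)
    {I : Type u} [Preorder I] [IsDirectedOrder I] [Nonempty I] {W : ModuleCat.{u} R}
    (N : I →o Submodule R W) (hN : ∀ w, ∃ i, w ∈ N i) {n : ℕ} (x : Ext.{u} M W n) :
    ∃ i, x.comp (Ext.mk₀ (ModuleCat.ofHom (N i).mkQ)) (add_zero n) = 0 := by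
  let i₀ : I := Classical.arbitrary I
  obtain ⟨j, h, e⟩ := hM (quotientSystem W N) (fun i y => by
    obtain ⟨y, rfl⟩ := Submodule.mkQ_surjective _ y
    obtain ⟨j, hj⟩ := hN y
    obtain ⟨l, hil, hjl⟩ := exists_ge_ge i j
    refine ⟨l, hil, ?_⟩
    change Submodule.factor (N.monotone hil) (Submodule.mkQ _ y) = 0
    simpa using N.monotone hjl hj) n i₀
      (x.comp (Ext.mk₀ (ModuleCat.ofHom (N i₀).mkQ)) (add_zero n))
  refine ⟨j, ?_⟩
  let q : W ⟶ (quotientSystem W N).obj i₀ := ModuleCat.ofHom (N i₀).mkQ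
  have e' : (x.comp (Ext.mk₀ q) (add_zero n)).comp
    (Ext.mk₀ ((quotientSystem W N).map (homOfLE h))) (add_zero n) = 0 := e
  rw [Ext.comp_assoc_of_third_deg_zero, Ext.mk₀_comp_mk₀] at e'
  exact e'

/-- The identity of `M` dies modulo some finitely generated submodule. -/
lemma IsExtCompact.finite {M : ModuleCat.{u} R} (hM : IsExtCompact M) : Module.Finite R M := by
  let I := {N : Submodule R M // N.FG}
  have : IsDirectedOrder I := ⟨fun a b => ⟨⟨a.1 ⊔ b.1, a.2.sup b.2⟩, le_sup_left (a := a.1),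
    le_sup_right (a := a.1)⟩⟩
  have : Nonempty I := ⟨⟨⊥, Submodule.fg_bot⟩⟩
  let N : I →o Submodule R M := ⟨fun i => i.1, fun _ _ h => h⟩
  obtain ⟨i, hi⟩ := hM.exists_comp_mkQ_eq_zero N
    (fun w => ⟨⟨_, Submodule.fg_span_singleton w⟩, Submodule.mem_span_singleton_self w⟩)
    (Ext.mk₀ (𝟙 M))
  rw [Ext.mk₀_comp_mk₀, Ext.mk₀_eq_zero_iff, Category.id_comp] at hi
  have h : (N i).mkQ = 0 := ModuleCat.hom_ext_iff.1 hi
  refine ⟨?_⟩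
  have : N i = ⊤ := by rw [← (N i).ker_mkQ, h, LinearMap.ker_zero]
  rw [← this]
  exact i.2

lemma IsExtCompact.of_shortExact {S : ShortComplex (ModuleCat.{u} R)} (hS : S.ShortExact)
    (h₂ : IsExtCompact S.X₂) (h₃ : IsExtCompact S.X₃) : IsExtCompact S.X₁ := by
  intro I _ _ Y hY n i x
  obtain ⟨j, hij, e⟩ := h₃ Y hY (1 + n) i (hS.extClass.comp x rfl)
  rw [Ext.comp_assoc_of_third_deg_zero] at e
  obtain ⟨y, hy⟩ := Ext.contravariant_sequence_exact₁ hS _ _ _ e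
  obtain ⟨l, hjl, e'⟩ := h₂ Y hY n j y
  refine ⟨l, hij.trans hjl, ?_⟩
  rw [← homOfLE_comp hij hjl, Functor.map_comp, ← Ext.mk₀_comp_mk₀,
    ← Ext.comp_assoc_of_third_deg_zero, ← hy, Ext.comp_assoc_of_third_deg_zero, e', Ext.comp_zero]

/-- Modules obtained in `n` steps from finitely generated projective modules: a finite resolution,
presented as an iterated splicing of short exact sequences. -/
inductive FinitelyResolved : ℕ → ModuleCat.{u} R → Prop
  | zero (M : ModuleCat.{u} R) : Module.Finite R M → Projective M → FinitelyResolved 0 M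
  | succ (n : ℕ) (S : ShortComplex (ModuleCat.{u} R)) : S.ShortExact → Module.Finite R S.X₂ →
      Projective S.X₂ → FinitelyResolved n S.X₁ → FinitelyResolved (n + 1) S.X₃

/-- Brown's condition passes to the kernel of a presentation by a finite free module, which is
therefore finitely generated again. -/
lemma IsExtCompact.finitelyResolved (n : ℕ) : ∀ {M : ModuleCat.{u} R}, IsExtCompact M →
    HasProjectiveDimensionLT M (n + 1) → FinitelyResolved n M := by
  induction n with
  | zero => exact fun hM h => .zero _ hM.finite (projective_iff_hasProjectiveDimensionLT_one.2 h)
  | succ n ih =>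
    intro M hM h
    have := hM.finite
    obtain ⟨m, f, hf⟩ := Module.Finite.exists_fin' R M
    have hS := LinearMap.shortExact_shortComplexKer hf
    have hP : Projective (ModuleCat.of R (Fin m → R)) :=
      ModuleCat.projective_of_categoryTheory_projective _
    refine .succ n _ hS (inferInstanceAs (Module.Finite R (Fin m → R))) hP (ih ?_ ?_)
    · have : Module.Finite R (ModuleCat.of R (Fin m → R)) :=
        inferInstanceAs (Module.Finite R (Fin m → R))
      exact .of_shortExact hS (isExtCompact_of_projective (ModuleCat.of R (Fin m → R))) hM
    · exact (hS.hasProjectiveDimensionLT_X₃_iff n hP).1 h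

/-- The augmentation of a projective resolution. -/
def augmentation {M : ModuleCat.{u} R} (Q : ProjectiveResolution M) : Q.complex.X 0 ⟶ M := Q.π.f 0

lemma d_comp_augmentation {M : ModuleCat.{u} R} (Q : ProjectiveResolution M) :
    Q.complex.d 1 0 ≫ augmentation Q = 0 := Q.complex_d_comp_π_f_zero

lemma exact_augmentation {M : ModuleCat.{u} R} (Q : ProjectiveResolution M) :
    (ShortComplex.mk _ _ (d_comp_augmentation Q)).Exact := Q.exact₀

instance {M : ModuleCat.{u} R} (Q : ProjectiveResolution M) : Epi (augmentation Q) :=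
  inferInstanceAs (Epi (Q.π.f 0))

/-- An exact augmented complex of projective modules, as a projective resolution. -/
def resolutionOfExact {Z : ModuleCat.{u} R} (C : ChainComplex (ModuleCat.{u} R) ℕ)
    (hC : ∀ n, Projective (C.X n)) (f : C.X 0 ⟶ Z) (hf : Epi f) (w : C.d 1 0 ≫ f = 0)
    (h₀ : (ShortComplex.mk _ _ w).Exact)
    (h : ∀ n, (ShortComplex.mk _ _ (C.d_comp_d (n + 2) (n + 1) n)).Exact) :
    ProjectiveResolution Z where
  complex := C
  projective := hC
  π := (ChainComplex.toSingle₀Equiv _ _).symm ⟨f, w⟩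
  quasiIso := ⟨fun n => by
    cases n
    · rw [ChainComplex.quasiIsoAt₀_iff, ShortComplex.quasiIso_iff_of_zeros']
      · refine (ShortComplex.exact_and_epi_g_iff_of_iso (S₂ := ShortComplex.mk _ _ w) ?_).2
          ⟨h₀, hf⟩
        exact ShortComplex.isoMk (Iso.refl _) (Iso.refl _) (Iso.refl _)
            ((Category.id_comp _).trans (Category.comp_id _).symm)
            ((Category.id_comp _).trans (Category.comp_id _).symm)
      · exact C.shape 0 0 (by simp)
      all_goals rfl
    · rename_i n
      rw [quasiIsoAt_iff_exactAt']
      · rw [HomologicalComplex.exactAt_iff' _ (n + 1 + 1) (n + 1) n (by simp) (by simp)]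
        exact h n
      · apply ChainComplex.exactAt_succ_single_obj⟩

/-- Splicing a projective resolution of the first term of a short exact sequence with the middle
term. -/
def spliceResolution {S : ShortComplex (ModuleCat.{u} R)} (hS : S.ShortExact)
    (hP : Projective S.X₂) (Q : ProjectiveResolution S.X₁) : ProjectiveResolution S.X₃ :=
  have := hS.mono_f
  have w : (augmentation Q ≫ S.f) ≫ S.g = 0 := by rw [Category.assoc, S.zero, comp_zero]
  have w' : Q.complex.d 1 0 ≫ augmentation Q ≫ S.f = 0 := by
    rw [← Category.assoc, d_comp_augmentation, zero_comp]
  resolutionOfExact (Q.complex.augment (augmentation Q ≫ S.f) w')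
    (fun n => match n with
      | 0 => hP
      | n + 1 => Q.projective n)
    S.g hS.epi_g w ((ShortComplex.exact_iff_of_epi_of_isIso_of_mono
      (S₁ := ShortComplex.mk _ _ w) (S₂ := S)
      ⟨augmentation Q, 𝟙 _, 𝟙 _, (Category.comp_id _).symm,
        (Category.id_comp _).trans (Category.comp_id _).symm⟩).2 hS.exact)
    (fun n => match n with
      | 0 => (ShortComplex.exact_iff_of_epi_of_isIso_of_mono
          (S₁ := ShortComplex.mk _ _ (d_comp_augmentation Q)) (S₂ := ShortComplex.mk _ _ w')
          ⟨𝟙 _, 𝟙 _, S.f, (Category.id_comp _).trans (Category.comp_id _).symm,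
            (Category.id_comp _)⟩).1 (exact_augmentation Q)
      | n + 1 => Q.exact_succ n)

lemma FinitelyResolved.exists_resolution {n : ℕ} {M : ModuleCat.{u} R}
    (h : FinitelyResolved n M) : ∃ P : ProjectiveResolution M,
      (∀ i, Module.Finite R (P.complex.X i)) ∧ ∀ i, n < i → Subsingleton (P.complex.X i) := by
  induction h with
  | zero M h₁ h₂ =>
    refine ⟨ProjectiveResolution.self M, fun i => ?_, fun i hi => ?_⟩
    · obtain _ | i := i
      · exact h₁
      · have := ModuleCat.subsingleton_of_isZero
          (HomologicalComplex.isZero_single_obj_X (ComplexShape.down ℕ) 0 M (i + 1) (by simp))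
        exact (inferInstance : Module.Finite R (((ChainComplex.single₀ _).obj M).X (i + 1)))
    · exact ModuleCat.subsingleton_of_isZero
          (HomologicalComplex.isZero_single_obj_X (ComplexShape.down ℕ) 0 M i (by lia))
  | succ n S hS h₁ h₂ _ ih =>
    obtain ⟨Q, hQ, hQ'⟩ := ih
    refine ⟨spliceResolution hS h₂ Q, fun i => ?_, fun i hi => ?_⟩
    · obtain _ | i := i
      · exact h₁
      · exact hQ i
    · obtain _ | i := i
      · lia
      · exact hQ' i (by lia)

lemma FinitelyResolved.hasFiniteResolution {n : ℕ} {M : ModuleCat.{u} R}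
    (h : FinitelyResolved n M) : HasFiniteResolution M := by
  obtain ⟨P, h₁, h₂⟩ := h.exists_resolution
  exact ⟨P, h₁, n, h₂⟩

lemma FinitelyResolved.of_iso {n : ℕ} {M N : ModuleCat.{u} R}
    (h : FinitelyResolved n M) (e : M ≅ N) : FinitelyResolved n N := by
  cases h with
  | zero M h₁ h₂ =>
    exact .zero N (Module.Finite.equiv e.toLinearEquiv) (Projective.of_iso e h₂)
  | succ n S hS h₁ h₂ h₃ =>
    exact .succ n (ShortComplex.mk S.f (S.g ≫ e.hom) (by rw [← Category.assoc, S.zero, zero_comp]))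
      (ShortComplex.shortExact_of_iso
        (ShortComplex.isoMk (S₁ := S) (Iso.refl S.X₁) (Iso.refl S.X₂) e) hS) h₁ h₂ h₃

lemma HasFiniteResolution.finitelyResolved {M : ModuleCat.{u} R} (h : HasFiniteResolution M) :
    ∃ n, FinitelyResolved n M := by
  obtain ⟨P, hP, n, hn⟩ := h
  have key : ∀ i ≤ n, ∃ m, FinitelyResolved m
      (ModuleCat.of R (LinearMap.range (P.complex.d (i + 1) i).hom)) := by
    intro i hi
    induction hi using Nat.decreasingInduction with
    | self =>
      have := hn (n + 1) (by lia)
      have : Subsingleton (LinearMap.range (P.complex.d (n + 1) n).hom) := by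
        rw [Submodule.subsingleton_iff_eq_bot, LinearMap.range_eq_bot]
        exact Subsingleton.elim _ _
      exact ⟨0, .zero _ (inferInstanceAs (Module.Finite R (LinearMap.range _)))
        (ModuleCat.projective_of_categoryTheory_projective _)⟩
    | of_succ i hi ih =>
      obtain ⟨m, hm⟩ := ih
      have hS := LinearMap.shortExact_shortComplexKer
        (LinearMap.surjective_rangeRestrict (P.complex.d (i + 1) i).hom)
      refine ⟨m + 1, .succ m _ hS (hP (i + 1)) (P.projective (i + 1)) (hm.of_iso ?_)⟩
      refine (LinearEquiv.ofEq _ _ ?_).toModuleIso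
      rw [LinearMap.ker_rangeRestrict]
      exact (P.exact_succ i).moduleCat_range_eq_ker
  obtain ⟨m, hm⟩ := key 0 (Nat.zero_le _)
  have hS := LinearMap.shortExact_shortComplexKer (f := (augmentation P).hom)
    ((ModuleCat.epi_iff_surjective _).1 inferInstance)
  refine ⟨m + 1, .succ m _ hS (hP 0) (P.projective 0) (hm.of_iso ?_)⟩
  exact (LinearEquiv.ofEq _ _ (exact_augmentation P).moduleCat_range_eq_ker).toModuleIso

/-- A thick subcategory containing `R` contains the finitely generated projective modules. -/
lemma prop_single_of_projective [HasDerivedCategory.{w} (ModuleCat.{u} R)]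
    (P : ObjectProperty (DerivedCategory (ModuleCat.{u} R))) [P.IsTriangulated]
    [P.IsStableUnderRetracts]
    (hP : P ((singleFunctor (ModuleCat.{u} R) 0).obj (ModuleCat.of R R))) (M : ModuleCat.{u} R)
    [Module.Finite R M] [Projective M] : P ((singleFunctor (ModuleCat.{u} R) 0).obj M) := by
  have free (n : ℕ) : P ((singleFunctor (ModuleCat.{u} R) 0).obj (ModuleCat.of R (Fin n → R))) := by
    induction n with
    | zero =>
      obtain ⟨Z, hZ, hPZ⟩ := P.exists_prop_of_containsZero
      exact P.prop_of_iso (hZ.iso (Functor.map_isZero _ (ModuleCat.isZero_of_subsingleton _))) hPZ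
    | succ n ih =>
      let f : (Fin (n + 1) → R) →ₗ[R] (Fin n → R) := LinearMap.funLeft R R Fin.succ
      have hf : Function.Surjective f := LinearMap.funLeft_surjective_of_injective _ _ _
        (Fin.succ_injective n)
      have hS := LinearMap.shortExact_shortComplexKer hf
      have e : LinearMap.ker f ≃ₗ[R] R :=
        { toFun := fun x => x.1 0
          map_add' := fun _ _ => rfl
          map_smul' := fun _ _ => rfl
          invFun := fun r => ⟨Fin.cons r 0, by ext i; simp [f, LinearMap.funLeft_apply]⟩
          left_inv := fun x => by
            have := x.2
            ext i
            cases i using Fin.cases with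
            | zero => rfl
            | succ i => exact (congrFun (LinearMap.mem_ker.1 x.2) i).symm
          right_inv := fun r => by simp }
      refine P.ext_of_isTriangulatedClosed₂ _ hS.singleTriangle_distinguished ?_ ih
      exact P.prop_of_iso ((singleFunctor (ModuleCat.{u} R) 0).mapIso
        (LinearEquiv.toModuleIso e.symm)) hP
  obtain ⟨m, f, hf⟩ := Module.Finite.exists_fin' R M
  have : Epi (ModuleCat.ofHom f) := (ModuleCat.epi_iff_surjective _).2 hf
  have r : Retract M (ModuleCat.of R (Fin m → R)) :=
    ⟨Projective.factorThru (𝟙 M) (ModuleCat.ofHom f), ModuleCat.ofHom f, by simp⟩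
  exact P.prop_of_retract (r.map (singleFunctor (ModuleCat.{u} R) 0)) (free m)

attribute [local instance] HasDerivedCategory.standard in
lemma FinitelyResolved.isPerfect {n : ℕ} {M : ModuleCat.{u} R}
    (h : FinitelyResolved n M) : IsPerfect M := by
  intro P _ _ hP
  induction h with
  | zero M _ _ => exact prop_single_of_projective P hP M
  | succ n S hS _ _ _ ih =>
    exact P.ext_of_isTriangulatedClosed₃ _ hS.singleTriangle_distinguished ih
      (prop_single_of_projective P hP S.X₂)

/-- A module is perfect exactly when it satisfies Brown's finiteness condition and has finite
projective dimension. -/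
theorem isPerfect_iff {M : ModuleCat.{u} R} :
    IsPerfect M ↔ IsExtCompact M ∧ ∃ n, HasProjectiveDimensionLT M n := by
  refine ⟨fun h => ⟨h.isExtCompact, h.exists_hasProjectiveDimensionLT⟩, ?_⟩
  rintro ⟨h, n, hn⟩
  exact (h.finitelyResolved n (hasProjectiveDimensionLT_of_ge M n (n + 1) (by lia))).isPerfect

theorem hasFiniteResolution_iff {M : ModuleCat.{u} R} :
    HasFiniteResolution M ↔ IsExtCompact M ∧ ∃ n, HasProjectiveDimensionLT M n := by
  constructor
  · intro h
    obtain ⟨n, hn⟩ := h.finitelyResolved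
    exact isPerfect_iff.1 hn.isPerfect
  · rintro ⟨h, n, hn⟩
    exact (h.finitelyResolved n
      (hasProjectiveDimensionLT_of_ge M n (n + 1) (by lia))).hasFiniteResolution

/-- If `W` is a direct sum of copies of `N`, given by injections `ι` and projections `π`, then an
`Ext` class with values in `W` is a finite sum of classes with values in these copies. -/
lemma IsExtCompact.exists_eq_sum {M : ModuleCat.{u} R} (hM : IsExtCompact M) {B : Type u}
    {N W : ModuleCat.{u} R} (ι : B → (N ⟶ W)) (π : B → (W ⟶ N))
    (h₁ : ∀ b, ι b ≫ π b = 𝟙 N) (h₂ : ∀ b c, b ≠ c → ι b ≫ π c = 0)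
    (h₃ : ∀ w : W, w ∈ ⨆ b, LinearMap.range (ι b).hom) {n : ℕ} (x : Ext.{u} M W n) :
    ∃ s : Finset B, x = ∑ b ∈ s,
      (x.comp (Ext.mk₀ (π b)) (add_zero n)).comp (Ext.mk₀ (ι b)) (add_zero n) := by
  classical
  let K : Finset B →o Submodule R W :=
    ⟨fun s => ⨆ b ∈ s, LinearMap.range (ι b).hom, fun s t hst => biSup_mono fun b hb => hst hb⟩
  obtain ⟨s, hs⟩ := hM.exists_comp_mkQ_eq_zero K (fun w => by
    obtain ⟨s, hs⟩ := Submodule.mem_iSup_iff_exists_finset.1 (h₃ w)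
    exact ⟨s, hs⟩) x
  let p : W ⟶ W := 𝟙 W - ∑ b ∈ s, π b ≫ ι b
  have hp : ∀ b ∈ s, ι b ≫ p = 0 := by
    intro b hb
    simp only [p, Preadditive.comp_sub, Category.comp_id, Preadditive.comp_sum]
    rw [Finset.sum_eq_single b]
    · rw [← Category.assoc, h₁, Category.id_comp, sub_self]
    · intro c _ hc
      rw [← Category.assoc, h₂ b c hc.symm, zero_comp]
    · exact fun h => (h hb).elim
  have hK : K s ≤ LinearMap.ker p.hom := by
    refine iSup₂_le fun b hb => ?_
    rintro _ ⟨y, rfl⟩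
    exact congr($(hp b hb).hom y)
  have fac : ModuleCat.ofHom (K s).mkQ ≫ ModuleCat.ofHom ((K s).liftQ p.hom hK) = p := by
    ext w
    rfl
  refine ⟨s, ?_⟩
  have : x.comp (Ext.mk₀ p) (add_zero n) = 0 := by
    rw [← fac, ← Ext.mk₀_comp_mk₀, ← Ext.comp_assoc_of_third_deg_zero]
    exact congr(Ext.comp $hs _ (add_zero n)).trans (Ext.zero_comp _ _ _ _ (add_zero n))
  have hsum : Ext.mk₀ (∑ b ∈ s, π b ≫ ι b) = ∑ b ∈ s, Ext.mk₀.{u} (π b ≫ ι b) :=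
    map_sum Ext.addEquiv₀.symm _ _
  have hx : x.comp (Ext.mk₀ (𝟙 W)) (add_zero n) =
      x.comp (Ext.mk₀ (∑ b ∈ s, π b ≫ ι b)) (add_zero n) := by
    rw [← sub_eq_zero, sub_eq_add_neg, ← Ext.comp_neg, ← Ext.comp_add, ← Ext.mk₀_neg,
      ← Ext.mk₀_add, ← sub_eq_add_neg]
    exact this
  rw [Ext.comp_mk₀_id, hsum] at hx
  have hx' : x = ∑ b ∈ s, x.comp (Ext.mk₀ (π b ≫ ι b)) (add_zero n) :=
    hx.trans (map_sum (Ext.precomp x W (add_zero n)) _ _)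
  refine hx'.trans (Finset.sum_congr rfl fun b _ => ?_)
  rw [Ext.comp_assoc_of_third_deg_zero, Ext.mk₀_comp_mk₀]

end Resolutions

/-! ### Transposition of `Ext` along exact adjoint functors -/

section Transpose

open Abelian Limits

universe v v' w' u'

variable {C : Type u} [Category.{v} C] {D : Type u'} [Category.{v'} D]
  (L : C ⥤ D) (G : D ⥤ C) (ε : G ⋙ L ⟶ 𝟭 D)

/-- `ε` exhibits `G` as right adjoint to `L`: it is the counit of an adjunction. -/
def IsCounit : Prop :=
  ∀ (X : C) (Y : D), Function.Bijective fun f : X ⟶ G.obj Y => L.map f ≫ ε.app Y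

variable {L G ε}

lemma IsCounit.projective_obj (hε : IsCounit L G ε) [G.PreservesEpimorphisms] (P : C)
    [Projective P] : Projective (L.obj P) where
  factors {A B} g p _ := by
    obtain ⟨f, rfl⟩ := (hε P B).2 g
    refine ⟨L.map (Projective.factorThru f (G.map p)) ≫ ε.app A, ?_⟩
    have := ε.naturality p
    simp only [Functor.comp_map, Functor.id_map] at this
    rw [Category.assoc, ← this, ← Category.assoc, ← L.map_comp, Projective.factorThru_comp]

variable [Abelian C] [HasExt.{w} C] [Abelian D] [HasExt.{w'} D]
  [L.Additive] [PreservesFiniteLimits L] [PreservesFiniteColimits L]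

variable (L ε) in
/-- The transposition `Ext^n(X, G Y) → Ext^n(L X, Y)`. -/
def extTranspose (X : C) (Y : D) (n : ℕ) : Ext X (G.obj Y) n →+ Ext (L.obj X) Y n where
  toFun x := (x.mapExactFunctor L).comp (Ext.mk₀ (ε.app Y)) (add_zero n)
  map_zero' := by simp
  map_add' := by simp

lemma extTranspose_comp_map {X : C} {Y Y' : D} {n : ℕ} (x : Ext X (G.obj Y) n) (g : Y ⟶ Y') :
    extTranspose L ε X Y' n (x.comp (Ext.mk₀ (G.map g)) (add_zero n)) =
      (extTranspose L ε X Y n x).comp (Ext.mk₀ g) (add_zero n) := by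
  have := ε.naturality g
  simp only [Functor.comp_map, Functor.id_map] at this
  dsimp [extTranspose]
  rw [Ext.mapExactFunctor_comp, Ext.mapExactFunctor_mk₀, Ext.comp_assoc_of_third_deg_zero,
    Ext.comp_assoc_of_third_deg_zero, Ext.mk₀_comp_mk₀, Ext.mk₀_comp_mk₀, this]

lemma extTranspose_comp {X X' : C} {Y : D} {m n p : ℕ} (y : Ext X' X m)
    (x : Ext X (G.obj Y) n) (h : m + n = p) :
    extTranspose L ε X' Y p (y.comp x h) =
      (y.mapExactFunctor L).comp (extTranspose L ε X Y n x) h := by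
  dsimp [extTranspose]
  rw [Ext.mapExactFunctor_comp, Ext.comp_assoc_of_third_deg_zero]

/-- Transposition along an exact functor that preserves projective objects is an isomorphism on
`Ext`: by dimension shifting, using `Ext^(n+1)(L P, Y) = 0` for `P` projective. -/
theorem extTranspose_bijective [EnoughProjectives C] [G.PreservesEpimorphisms]
    (hε : IsCounit L G ε) (X : C) (Y : D) (n : ℕ) :
    Function.Bijective (extTranspose L ε X Y n) := by
  induction n generalizing X with
  | zero =>
    have h : ∀ f, extTranspose L ε X Y 0 (Ext.mk₀ f) = Ext.mk₀ (L.map f ≫ ε.app Y) := by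
      intro f
      dsimp [extTranspose]
      rw [Ext.mapExactFunctor_mk₀, Ext.mk₀_comp_mk₀]
    constructor
    · intro a b hab
      obtain ⟨f, rfl⟩ := (Ext.mk₀_bijective _ _).2 a
      obtain ⟨g, rfl⟩ := (Ext.mk₀_bijective _ _).2 b
      rw [h, h] at hab
      rw [(hε X Y).1 ((Ext.mk₀_bijective _ _).1 hab)]
    · intro b
      obtain ⟨g, rfl⟩ := (Ext.mk₀_bijective _ _).2 b
      obtain ⟨f, rfl⟩ := (hε X Y).2 g
      exact ⟨_, h f⟩
  | succ n ih =>
    let S : ShortComplex C := ShortComplex.mk _ _ (kernel.condition (Projective.π X))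
    have hS : S.ShortExact :=
      { exact := ShortComplex.exact_kernel _ }
    have hP : Projective S.X₂ := inferInstanceAs (Projective (Projective.over X))
    have hLP := hε.projective_obj S.X₂
    have hLS := hS.map_of_exact L
    have hcomp : ∀ y : Ext S.X₁ (G.obj Y) n,
        extTranspose L ε X Y (n + 1) (hS.extClass.comp y (add_comm 1 n)) =
          hLS.extClass.comp (extTranspose L ε S.X₁ Y n y) (add_comm 1 n) := by
      intro y
      refine (extTranspose_comp _ y (add_comm 1 n)).trans ?_
      rw [Ext.mapExactFunctor_extClass]
      rfl
    constructor
    · rw [injective_iff_map_eq_zero]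
      intro x hx
      obtain ⟨y, rfl⟩ := Ext.contravariant_sequence_exact₃ hS (G.obj Y) x
        (Ext.eq_zero_of_projective _) (add_comm 1 n)
      have hx' := (hcomp y).symm.trans hx
      obtain ⟨z, hz⟩ := Ext.contravariant_sequence_exact₁ hLS Y _ (add_comm 1 n) hx'
      obtain ⟨z', rfl⟩ := (ih S.X₂).2 z
      have : y = (Ext.mk₀ S.f).comp z' (zero_add n) := by
        apply (ih S.X₁).1
        rw [extTranspose_comp, Ext.mapExactFunctor_mk₀]
        exact hz.symm
      rw [this, ← Ext.comp_assoc (a₁₂ := 1) _ _ _ (by lia) (by lia) (by lia),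
        hS.extClass_comp, Ext.zero_comp]
    · intro x
      obtain ⟨y, hy⟩ := Ext.contravariant_sequence_exact₃ hLS Y x
        (Ext.eq_zero_of_projective (P := L.obj S.X₂) _) (add_comm 1 n)
      obtain ⟨y', rfl⟩ := (ih S.X₁).2 y
      exact ⟨_, (hcomp y').trans hy⟩

end Transpose

/-! ### Convolution -/

section Convolution

open Coalgebra HopfAlgebra

variable {k H B B' : Type*} [Field k] [Ring H] [HopfAlgebra k H]
  [Ring B] [Algebra k B] [Ring B'] [Algebra k B']

/-- The convolution product `h ↦ f(h₁) g(h₂)`. -/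
def conv (f g : H →ₗ[k] B) : H →ₗ[k] B := (WithConv.toConv f * WithConv.toConv g).ofConv

/-- The unit for convolution. -/
def convUnit (k H B : Type*) [Field k] [Ring H] [HopfAlgebra k H] [Ring B] [Algebra k B] :
    H →ₗ[k] B := Algebra.linearMap k B ∘ₗ counit

@[simp] lemma convUnit_apply (h : H) : convUnit k H B h = algebraMap k B (counit h) := rfl

lemma conv_def (f g : H →ₗ[k] B) :
    conv f g = LinearMap.mul' k B ∘ₗ TensorProduct.map f g ∘ₗ comul := rfl

lemma conv_apply (f g : H →ₗ[k] B) (h : H) :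
    conv f g h = ∑ i ∈ (ℛ k h).index, f ((ℛ k h).left i) * g ((ℛ k h).right i) :=
  (ℛ k h).convMul_apply _ _

lemma conv_apply_repr (f g : H →ₗ[k] B) {h : H} {ι : Type*} (r : Repr k h ι) :
    conv f g h = ∑ i ∈ r.index, f (r.left i) * g (r.right i) :=
  r.convMul_apply _ _

lemma conv_assoc (f g l : H →ₗ[k] B) : conv (conv f g) l = conv f (conv g l) :=
  congrArg WithConv.ofConv (mul_assoc (WithConv.toConv f) (WithConv.toConv g) (WithConv.toConv l))

@[simp] lemma convUnit_conv (f : H →ₗ[k] B) : conv (convUnit k H B) f = f :=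
  congrArg WithConv.ofConv (one_mul (WithConv.toConv f))

@[simp] lemma conv_convUnit (f : H →ₗ[k] B) : conv f (convUnit k H B) = f :=
  congrArg WithConv.ofConv (mul_one (WithConv.toConv f))

lemma algHom_comp_conv (φ : B →ₐ[k] B') (f g : H →ₗ[k] B) :
    φ.toLinearMap ∘ₗ conv f g = conv (φ.toLinearMap ∘ₗ f) (φ.toLinearMap ∘ₗ g) :=
  LinearMap.algHom_comp_convMul_distrib φ (WithConv.toConv f) (WithConv.toConv g)

lemma conv_antipode_id (f : H →ₐ[k] B) :
    conv (f.toLinearMap ∘ₗ antipode k) f.toLinearMap = convUnit k H B := by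
  ext h
  rw [conv_apply, convUnit_apply, ← f.commutes, ← sum_antipode_mul_eq_algebraMap_counit (ℛ k h),
    map_sum]
  simp

lemma conv_id_antipode (f : H →ₐ[k] B) :
    conv f.toLinearMap (f.toLinearMap ∘ₗ antipode k) = convUnit k H B := by
  ext h
  rw [conv_apply, convUnit_apply, ← f.commutes, ← sum_mul_antipode_eq_algebraMap_counit (ℛ k h),
    map_sum]
  simp

lemma conv_comm_of_commute {f g : H →ₗ[k] B} {f' g' : H →ₗ[k] Bᵐᵒᵖ}
    (hf : ∀ h, f' h = op (f h)) (hg : ∀ h, g' h = op (g h)) (hc : ∀ a b, Commute (f a) (g b))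
    (h : H) : conv f' g' h = op (conv f g h) := by
  rw [conv_apply, conv_apply, Finset.op_sum]
  refine Finset.sum_congr rfl fun i _ => ?_
  rw [hf, hg, ← op_mul, (hc _ _).eq]

/-- The antipode as an algebra homomorphism from the opposite algebra. -/
def antipodeOp (k H : Type*) [Field k] [Ring H] [HopfAlgebra k H] : Hᵐᵒᵖ →ₐ[k] H :=
  AlgHom.ofLinearMap (antipode k ∘ₗ (opLinearEquiv k).symm.toLinearMap) (by simp)
    (fun x y => by simp [antipode_mul_antidistrib])

@[simp] lemma antipodeOp_op (h : H) : antipodeOp k H (op h) = antipode k h := rfl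

/-- The convolution product `op h ↦ f(op h₁) g(op h₂)` of two homomorphisms with commuting
images. -/
def convOp (f g : Hᵐᵒᵖ →ₐ[k] B) (hc : ∀ a b, Commute (f a) (g b)) : Hᵐᵒᵖ →ₐ[k] B :=
  AlgHom.ofLinearMap (conv (f.toLinearMap ∘ₗ (opLinearEquiv k).toLinearMap)
      (g.toLinearMap ∘ₗ (opLinearEquiv k).toLinearMap) ∘ₗ (opLinearEquiv k).symm.toLinearMap)
    (by
      have : (conv (f.toLinearMap ∘ₗ (opLinearEquiv k).toLinearMap)
        (g.toLinearMap ∘ₗ (opLinearEquiv k).toLinearMap)) (1 : H) = 1 := by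
        simp [conv_def, Bialgebra.comul_one, Algebra.TensorProduct.one_def]
      simpa using this)
    (fun x y => by
      obtain ⟨x, rfl⟩ := op_surjective x
      obtain ⟨y, rfl⟩ := op_surjective y
      let r := (ℛ k x)
      let s := (ℛ k y)
      have hr : ∑ i ∈ s.index ×ˢ r.index,
          (s.left i.1 * r.left i.2) ⊗ₜ[k] (s.right i.1 * r.right i.2) = comul (y * x) := by
        rw [Bialgebra.comul_mul, ← r.eq, ← s.eq, Finset.sum_product, Finset.sum_mul]
        refine Finset.sum_congr rfl fun i _ => ?_
        rw [Finset.mul_sum]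
        simp
      have e := conv_apply_repr (f.toLinearMap ∘ₗ (opLinearEquiv k).toLinearMap)
        (g.toLinearMap ∘ₗ (opLinearEquiv k).toLinearMap)
        (⟨s.index ×ˢ r.index, fun i => s.left i.1 * r.left i.2,
          fun i => s.right i.1 * r.right i.2, hr⟩ : Repr k (y * x) ((H × H) × (H × H)))
      have e₁ := conv_apply (f.toLinearMap ∘ₗ (opLinearEquiv k).toLinearMap)
        (g.toLinearMap ∘ₗ (opLinearEquiv k).toLinearMap) x
      have e₂ := conv_apply (f.toLinearMap ∘ₗ (opLinearEquiv k).toLinearMap)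
        (g.toLinearMap ∘ₗ (opLinearEquiv k).toLinearMap) y
      simp only [LinearMap.comp_apply, LinearEquiv.coe_coe, coe_opLinearEquiv_symm, unop_op,
        unop_mul, e, e₁, e₂]
      rw [Finset.sum_product_right, Finset.sum_mul]
      refine Finset.sum_congr rfl fun i _ => ?_
      rw [Finset.mul_sum]
      refine Finset.sum_congr rfl fun j _ => ?_
      simp only [coe_opLinearEquiv, op_mul, AlgHom.toLinearMap_apply, map_mul]
      simp only [mul_assoc, (hc (op (s.left j)) (op (r.right i))).left_comm]
      rfl)

lemma convOp_op (f g : Hᵐᵒᵖ →ₐ[k] B) (hc : ∀ a b, Commute (f a) (g b)) (h : H) :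
    convOp f g hc (op h) = ∑ i ∈ (ℛ k h).index,
      f (op ((ℛ k h).left i)) * g (op ((ℛ k h).right i)) :=
  conv_apply _ _ _

end Convolution

/-! ### Exact functors of the form `M ↦ M ⊗ V` -/

section TensorFunctor
open scoped ModuleCat
open Limits

variable {k R B V : Type u} [Field k] [Ring R] [Algebra k R] [Ring B] [Algebra k B]
  [AddCommGroup V] [Module k V]

/-- The functor `M ↦ M ⊗ V` attached to a natural action of `B` on the spaces `M ⊗ V`. -/
def TensorSpace (_ρ : ∀ M : ModuleCat.{u} R, B →ₐ[k] Module.End k (M ⊗[k] V))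
    (M : ModuleCat.{u} R) : Type u := M ⊗[k] V

variable (ρ : ∀ M : ModuleCat.{u} R, B →ₐ[k] Module.End k (M ⊗[k] V))

instance (M : ModuleCat.{u} R) : AddCommGroup (TensorSpace ρ M) :=
  inferInstanceAs (AddCommGroup (M ⊗[k] V))

instance (M : ModuleCat.{u} R) : Module B (TensorSpace ρ M) :=
  Module.compHom (M ⊗[k] V) (ρ M).toRingHom

/-- Naturality of an action of `B` on the spaces `M ⊗ V`. -/
def IsNaturalAction : Prop :=
  ∀ (M N : ModuleCat.{u} R) (f : M ⟶ N) (b : B) (x : M ⊗[k] V),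
    (f.hom.restrictScalars k).rTensor V (ρ M b x) = ρ N b ((f.hom.restrictScalars k).rTensor V x)

variable {ρ}

/-- The functor `M ↦ M ⊗ V` attached to a natural action of `B` on the spaces `M ⊗ V`. -/
def tensorFunctor (hρ : IsNaturalAction ρ) : ModuleCat.{u} R ⥤ ModuleCat.{u} B where
  obj M := ModuleCat.of B (TensorSpace ρ M)
  map {M N} f := ModuleCat.ofHom (X := TensorSpace ρ M) (Y := TensorSpace ρ N)
    { toFun := (f.hom.restrictScalars k).rTensor V
      map_add' := map_add ((f.hom.restrictScalars k).rTensor V)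
      map_smul' := fun b x => hρ M N f b x }
  map_id M := by
    ext x
    exact congrArg (fun g : M ⊗[k] V →ₗ[k] M ⊗[k] V => g x) (LinearMap.rTensor_id V M)
  map_comp {M N P} f g := by
    ext x
    exact congrArg (fun h : M ⊗[k] V →ₗ[k] P ⊗[k] V => h x)
      (LinearMap.rTensor_comp V (g.hom.restrictScalars k) (f.hom.restrictScalars k))

variable (hρ : IsNaturalAction ρ)

instance : (tensorFunctor hρ).Additive where
  map_add {M N f g} := by
    ext x
    exact congrArg (fun h : M ⊗[k] V →ₗ[k] N ⊗[k] V => h x)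
      (LinearMap.rTensor_add V (f.hom.restrictScalars k) (g.hom.restrictScalars k))

lemma tensorFunctor_shortExact (S : ShortComplex (ModuleCat.{u} R)) (hS : S.ShortExact) :
    (S.map (tensorFunctor hρ)).ShortExact := by
  have h₁ : Function.Injective (S.f.hom.restrictScalars k) := hS.moduleCat_injective_f
  have h₂ : Function.Surjective (S.g.hom.restrictScalars k) := hS.moduleCat_surjective_g
  have h₃ : Function.Exact (S.f.hom.restrictScalars k) (S.g.hom.restrictScalars k) :=
    (ShortComplex.ShortExact.moduleCat_exact_iff_function_exact S).1 hS.exact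
  have e := rTensor_exact V h₃ h₂
  refine @ShortComplex.ShortExact.mk _ _ _ _ ?_ ?_ ?_
  · exact (ShortComplex.ShortExact.moduleCat_exact_iff_function_exact _).2 e
  · exact (ModuleCat.mono_iff_injective _).2
      (Module.Flat.rTensor_preserves_injective_linearMap _ h₁)
  · exact (ModuleCat.epi_iff_surjective _).2 (LinearMap.rTensor_surjective V h₂)

lemma tensorFunctor_exact :
    PreservesFiniteLimits (tensorFunctor hρ) ∧ PreservesFiniteColimits (tensorFunctor hρ) :=
  ((tensorFunctor hρ).exact_tfae.out 0 3).1 (tensorFunctor_shortExact hρ)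

instance : PreservesFiniteLimits (tensorFunctor hρ) := (tensorFunctor_exact hρ).1

instance : PreservesFiniteColimits (tensorFunctor hρ) := (tensorFunctor_exact hρ).2

/-- Morphisms out of `M ⊗ V` as linear maps. -/
def homToLin {M : ModuleCat.{u} R} {Y : ModuleCat.{u} B} (g : (tensorFunctor hρ).obj M ⟶ Y) :
    M ⊗[k] V →ₗ[k] Y where
  toFun := g.hom
  map_add' := g.hom.map_add
  map_smul' c x := by
    have e : c • x = ρ M (algebraMap k B c) x := by
      rw [AlgHom.commutes]; rfl
    rw [e]
    exact (g.hom.map_smul (algebraMap k B c) x).trans (algebraMap_smul B c _)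

lemma homToLin_apply {M : ModuleCat.{u} R} {Y : ModuleCat.{u} B}
    (g : (tensorFunctor hρ).obj M ⟶ Y) (b : B) (x : M ⊗[k] V) :
    homToLin hρ g (ρ M b x) = b • homToLin hρ g x :=
  g.hom.map_smul b x

/-- Equivariant linear maps as morphisms out of `M ⊗ V`. -/
def linToHom {M : ModuleCat.{u} R} {Y : ModuleCat.{u} B} (g : M ⊗[k] V →ₗ[k] Y)
    (hg : ∀ b x, g (ρ M b x) = b • g x) : (tensorFunctor hρ).obj M ⟶ Y :=
  ModuleCat.ofHom (X := TensorSpace ρ M)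
    { toFun := g, map_add' := g.map_add, map_smul' := hg }

lemma homToLin_injective {M : ModuleCat.{u} R} {Y : ModuleCat.{u} B} :
    Function.Injective (homToLin hρ (M := M) (Y := Y)) := by
  intro f g h
  ext x
  exact LinearMap.congr_fun h x

end TensorFunctor
/-! ### Tensor products of right modules -/

section Twisted

open Coalgebra HopfAlgebra
open scoped ModuleCat

variable {k H : Type u} [Field k] [Ring H] [HopfAlgebra k H]

section Action

variable (k) (M V : Type u) [AddCommGroup M] [Module k M] [Module Hᵐᵒᵖ M] [IsScalarTower k Hᵐᵒᵖ M]
  [AddCommGroup V] [Module k V] [Module Hᵐᵒᵖ V] [IsScalarTower k Hᵐᵒᵖ V]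

/-- The action of `Hᵐᵒᵖ` on the first factor of `M ⊗ V`. -/
def actLeft : Hᵐᵒᵖ →ₐ[k] Module.End k (M ⊗[k] V) :=
  (Module.endTensorEndAlgHom (R := k) (A := k) (M := M) (N := V)).comp
    (Algebra.TensorProduct.includeLeft.comp (Algebra.lsmul k k M))

/-- The action of `Hᵐᵒᵖ` on the second factor of `M ⊗ V`. -/
def actRight : Hᵐᵒᵖ →ₐ[k] Module.End k (M ⊗[k] V) :=
  (Module.endTensorEndAlgHom (R := k) (A := k) (M := M) (N := V)).comp
    ((Algebra.TensorProduct.includeRight (R := k) (A := Module.End k M)).comp (Algebra.lsmul k k V))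

lemma actLeft_tmul (a : Hᵐᵒᵖ) (m : M) (v : V) :
    actLeft k M V a (m ⊗ₜ v) = (a • m) ⊗ₜ v := rfl

lemma actRight_tmul (a : Hᵐᵒᵖ) (m : M) (v : V) :
    actRight k M V a (m ⊗ₜ v) = m ⊗ₜ (a • v) := rfl

lemma commute_act (a b : Hᵐᵒᵖ) : Commute (actRight k M V a) (actLeft k M V b) :=
  TensorProduct.ext' fun _ _ => rfl

/-- The right action `(m ⊗ v) h = m h₂ ⊗ v h₁` of `H` on `M ⊗ V`. -/
def tensorAct : Hᵐᵒᵖ →ₐ[k] Module.End k (M ⊗[k] V) :=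
  convOp (actRight k M V) (actLeft k M V) (commute_act k M V)

lemma tensorAct_tmul (h : H) (m : M) (v : V) : tensorAct k M V (op h) (m ⊗ₜ v) =
    ∑ i ∈ (ℛ k h).index, (op ((ℛ k h).right i) • m) ⊗ₜ (op ((ℛ k h).left i) • v) := by
  rw [tensorAct, convOp_op, LinearMap.sum_apply]
  rfl

end Action

section Inverse

variable {B : Type u} [Ring B] [Algebra k B]

lemma conv_antipode_conv (f : H →ₐ[k] B) (g : H →ₗ[k] B) :
    conv (f.toLinearMap ∘ₗ antipode k) (conv f.toLinearMap g) = g := by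
  rw [← conv_assoc, conv_antipode_id, convUnit_conv]

lemma conv_conv_antipode (f : H →ₐ[k] B) (g : H →ₗ[k] B) :
    conv f.toLinearMap (conv (f.toLinearMap ∘ₗ antipode k) g) = g := by
  rw [← conv_assoc, conv_id_antipode, convUnit_conv]

lemma sum_convOp_mul_antipode (f g : Hᵐᵒᵖ →ₐ[k] B) (hc : ∀ a b, Commute (f a) (g b)) (h : H) :
    ∑ i ∈ (ℛ k h).index, convOp f g hc (op ((ℛ k h).right i)) *
      f (op (antipode k ((ℛ k h).left i))) = g (op h) := by
  let F : H →ₐ[k] Bᵐᵒᵖ := AlgHom.opComm.symm f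
  let G : H →ₐ[k] Bᵐᵒᵖ := AlgHom.opComm.symm g
  have e := LinearMap.congr_fun (conv_antipode_conv F G.toLinearMap) h
  have e' : ∀ x, conv F.toLinearMap G.toLinearMap x = op (convOp f g hc (op x)) :=
    conv_comm_of_commute (f := f.toLinearMap ∘ₗ (opLinearEquiv k).toLinearMap)
      (g := g.toLinearMap ∘ₗ (opLinearEquiv k).toLinearMap) (fun _ => rfl) (fun _ => rfl)
      (fun a b => hc _ _)
  apply op_injective
  rw [conv_apply] at e
  rw [Finset.op_sum]
  refine Eq.trans (Finset.sum_congr rfl fun i _ => ?_) e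
  rw [e', op_mul]
  rfl

end Inverse

section RTensor

variable (k) (V : Type u) [AddCommGroup V] [Module k V] [Module Hᵐᵒᵖ V]
  [IsScalarTower k Hᵐᵒᵖ V]

lemma isNaturalAction_tensorAct :
    IsNaturalAction (k := k) (R := Hᵐᵒᵖ) (B := Hᵐᵒᵖ) (V := V) fun M => tensorAct k M V := by
  intro M N f b x
  obtain ⟨h, rfl⟩ := op_surjective b
  induction x with
  | zero => simp
  | add x y hx hy => simp only [map_add, hx, hy]
  | tmul m v =>
    simp only [tensorAct_tmul, map_sum, LinearMap.rTensor_tmul]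
    refine Finset.sum_congr rfl fun i _ => ?_
    simp

/-- The functor `M ↦ M ⊗ V` on right `H`-modules, the action being
`(m ⊗ v) h = m h₂ ⊗ v h₁`. -/
abbrev rtensor : ModuleCat.{u} Hᵐᵒᵖ ⥤ ModuleCat.{u} Hᵐᵒᵖ :=
  tensorFunctor (isNaturalAction_tensorAct (H := H) k V)

/-- The action of `Hᵐᵒᵖ` on `Hom(V, Y)` through the second argument. -/
def actPost (Y : ModuleCat.{u} Hᵐᵒᵖ) : Hᵐᵒᵖ →ₐ[k] Module.End k (V →ₗ[k] Y) :=
  AlgHom.ofLinearMap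
    ((LinearMap.llcomp k V Y Y).comp (Algebra.lsmul k k Y).toLinearMap)
    (by ext; simp) (fun x y => by ext; simp [mul_smul])

/-- The action of `H` on `Hom(V, Y)` by precomposition. -/
def actPre (Y : ModuleCat.{u} Hᵐᵒᵖ) : H →ₐ[k] Module.End k (V →ₗ[k] Y) :=
  AlgHom.ofLinearMap
    ((LinearMap.llcomp k V V Y).flip.comp
      ((Algebra.lsmul k k V).toLinearMap.comp (opLinearEquiv k).toLinearMap))
    (by ext; simp) (fun x y => by ext; simp [mul_smul])

lemma commute_actPre_actPost (Y : ModuleCat.{u} Hᵐᵒᵖ) (a b : Hᵐᵒᵖ) :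
    Commute ((actPre k V Y).comp (antipodeOp k H) a) (actPost k V Y b) :=
  LinearMap.ext fun _ => LinearMap.ext fun _ => rfl

/-- The action `(φ h)(v) = φ(v S(h₁)) h₂` on `Hom(V, Y)`. -/
def homAct (Y : ModuleCat.{u} Hᵐᵒᵖ) : Hᵐᵒᵖ →ₐ[k] Module.End k (V →ₗ[k] Y) :=
  convOp ((actPre k V Y).comp (antipodeOp k H)) (actPost k V Y) (commute_actPre_actPost k V Y)

lemma homAct_apply (Y : ModuleCat.{u} Hᵐᵒᵖ) (h : H) (φ : V →ₗ[k] Y) (v : V) :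
    homAct k V Y (op h) φ v = ∑ i ∈ (ℛ k h).index,
      op ((ℛ k h).right i) • φ (op (antipode k ((ℛ k h).left i)) • v) := by
  rw [homAct, convOp_op, LinearMap.sum_apply, LinearMap.sum_apply]
  rfl

/-- The right `H`-module `Hom(V, Y)`, with action `(φ h)(v) = φ(v S(h₁)) h₂`. -/
def HomSpace (k : Type u) {H : Type u} [Field k] [Ring H] [HopfAlgebra k H] (V : Type u)
    [AddCommGroup V] [Module k V] (Y : ModuleCat.{u} Hᵐᵒᵖ) : Type u :=
  V →ₗ[k] Y

instance (Y : ModuleCat.{u} Hᵐᵒᵖ) : AddCommGroup (HomSpace k V Y) :=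
  inferInstanceAs (AddCommGroup (V →ₗ[k] Y))

instance (Y : ModuleCat.{u} Hᵐᵒᵖ) : Module Hᵐᵒᵖ (HomSpace k V Y) :=
  Module.compHom (V →ₗ[k] Y) (homAct k V Y).toRingHom

lemma sum_actPre_homAct (Y : ModuleCat.{u} Hᵐᵒᵖ) (h : H) :
    ∑ i ∈ (ℛ k h).index, actPre k V Y ((ℛ k h).left i) *
      homAct k V Y (op ((ℛ k h).right i)) = actPost k V Y (op h) := by
  have e := LinearMap.congr_fun (conv_conv_antipode (actPre k V Y)
    ((actPost k V Y).toLinearMap ∘ₗ (opLinearEquiv k).toLinearMap)) h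
  rw [conv_apply] at e
  exact e

lemma sum_homAct_apply (Y : ModuleCat.{u} Hᵐᵒᵖ) (h : H) (φ : V →ₗ[k] Y) (v : V) :
    ∑ i ∈ (ℛ k h).index, homAct k V Y (op ((ℛ k h).right i)) φ (op ((ℛ k h).left i) • v) =
      op h • φ v := by
  have e := LinearMap.congr_fun (LinearMap.congr_fun (sum_actPre_homAct k V Y h) φ) v
  rw [LinearMap.sum_apply, LinearMap.sum_apply] at e
  exact e

/-- A homomorphism `g : M ⊗ V → Y` as a homomorphism `M → Hom(V, Y)`. -/
def curryHom (M Y : ModuleCat.{u} Hᵐᵒᵖ) (g : (rtensor k V).obj M ⟶ Y) :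
    M →ₗ[Hᵐᵒᵖ] HomSpace k V Y where
  toFun := TensorProduct.curry (homToLin (isNaturalAction_tensorAct k V) g)
  map_add' := map_add _
  map_smul' a m := by
    obtain ⟨h, rfl⟩ := op_surjective a
    refine LinearMap.ext fun v => ?_
    have e := LinearMap.congr_fun
      (sum_convOp_mul_antipode (actRight k M V) (actLeft k M V) (commute_act k M V) h) (m ⊗ₜ v)
    change homToLin (isNaturalAction_tensorAct k V) g ((op h • m) ⊗ₜ v) = homAct k V Y (op h) _ v
    rw [← actLeft_tmul, ← e, LinearMap.sum_apply, map_sum]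
    refine Eq.trans ?_ (homAct_apply k V Y h _ v).symm
    refine Finset.sum_congr rfl fun i _ => ?_
    exact homToLin_apply (isNaturalAction_tensorAct k V) g _ _

/-- A homomorphism `M → Hom(V, Y)` as a homomorphism `M ⊗ V → Y`. -/
def uncurryHom (M Y : ModuleCat.{u} Hᵐᵒᵖ) (g : M →ₗ[Hᵐᵒᵖ] HomSpace k V Y) :
    (rtensor k V).obj M ⟶ Y :=
  let g' : M →ₗ[k] V →ₗ[k] Y :=
    { toFun := g
      map_add' := g.map_add
      map_smul' := fun c m => by
        rw [← algebraMap_smul Hᵐᵒᵖ c m, map_smul]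
        change homAct k V Y (algebraMap k Hᵐᵒᵖ c) _ = _
        rw [AlgHom.commutes]
        rfl }
  linToHom (isNaturalAction_tensorAct k V) (TensorProduct.lift g') (fun b x => by
    obtain ⟨h, rfl⟩ := op_surjective b
    induction x with
    | zero => simp
    | add x y hx hy => simp only [map_add, hx, hy, smul_add]
    | tmul m v =>
      have e := sum_homAct_apply k V Y h (g m) v
      rw [tensorAct_tmul, map_sum, lift.tmul]
      refine Eq.trans (Finset.sum_congr rfl fun i _ => ?_) e
      rw [lift.tmul]
      exact congrArg (fun φ : V →ₗ[k] Y => φ (op ((ℛ k h).left i) • v))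
        (g.map_smul (op ((ℛ k h).right i)) m))

/-- Tensoring with `V` preserves projective modules, since it has the exact right adjoint
`Hom(V, -)`. -/
lemma projective_rtensor (M : ModuleCat.{u} Hᵐᵒᵖ) [Projective M] :
    Projective ((rtensor k V).obj M) where
  factors {Y' Y} g p hp := by
    have hp' : Function.Surjective (p.hom.restrictScalars k) :=
      (ModuleCat.epi_iff_surjective p).1 hp
    let q : HomSpace k V Y' →ₗ[Hᵐᵒᵖ] HomSpace k V Y :=
      { toFun := fun φ => (p.hom.restrictScalars k) ∘ₗ (φ : V →ₗ[k] Y')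
        map_add' := fun φ ψ => LinearMap.comp_add _ _ _
        map_smul' := fun a φ => by
          obtain ⟨h, rfl⟩ := op_surjective a
          refine LinearMap.ext fun v => ?_
          change p.hom (homAct k V Y' (op h) (φ : V →ₗ[k] Y') v) =
            homAct k V Y (op h) ((p.hom.restrictScalars k) ∘ₗ (φ : V →ₗ[k] Y')) v
          refine ((congrArg p.hom (homAct_apply k V Y' h φ v)).trans (map_sum p.hom _ _)).trans
            (Eq.trans ?_ (homAct_apply k V Y h _ v).symm)
          refine Finset.sum_congr rfl fun i _ => ?_
          exact p.hom.map_smul _ _ }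
    have hq : Epi (ModuleCat.ofHom q) := by
      rw [ModuleCat.epi_iff_surjective]
      intro φ
      obtain ⟨s, hs⟩ := LinearMap.exists_rightInverse_of_surjective (p.hom.restrictScalars k)
        (LinearMap.range_eq_top.2 hp')
      refine ⟨s.comp (φ : V →ₗ[k] Y), ?_⟩
      refine LinearMap.ext fun v => ?_
      exact LinearMap.congr_fun hs _
    obtain ⟨l, hl⟩ := Projective.factors (ModuleCat.ofHom (curryHom k V M Y g)) (ModuleCat.ofHom q)
    refine ⟨uncurryHom k V M Y' l.hom, ?_⟩
    apply homToLin_injective (isNaturalAction_tensorAct k V)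
    refine TensorProduct.ext' fun m v => ?_
    have e : (show V →ₗ[k] Y from q (l.hom m)) = (show V →ₗ[k] Y from curryHom k V M Y g m) :=
      congrArg (fun f => f.hom m) hl
    exact LinearMap.congr_fun e v

end RTensor

end Twisted

/-! ### Twisted bimodules -/

section Twist

open scoped ModuleCat

variable {k A : Type u} [Field k] [Ring A] [Algebra k A]

/-- The identity of `A` as a linear equivalence from `A` to the bimodule `A^σ`. -/
def twistLin (σ : A →ₐ[k] A) : A ≃ₗ[k] twist σ where
  toFun x := (show TwistSpace σ from x)
  invFun x := (show TwistSpace σ from x)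
  map_add' _ _ := rfl
  map_smul' c x := by
    change _ = twistHom σ (algebraMap k _ c) x
    rw [AlgHom.commutes]
    rfl
  left_inv _ := rfl
  right_inv _ := rfl

lemma smul_twistLin (σ : A →ₐ[k] A) (a b x : A) :
    ((a ⊗ₜ[k] op b : Env k A) • twistLin σ x : twist σ) = twistLin σ (a * x * σ b) :=
  twist_smul σ a b x

/-- A homomorphism to `A^σ`, from an additive map to `A`. -/
def homToTwist (σ : A →ₐ[k] A) {X : Type u} [AddCommGroup X] [Module (Env k A) X] (g : X →+ A)
    (hg : ∀ (a b : A) x, g ((a ⊗ₜ[k] op b : Env k A) • x) = a * g x * σ b) :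
    X →ₗ[Env k A] twist σ where
  toFun x := twistLin σ (g x)
  map_add' x y := by rw [map_add, map_add]
  map_smul' z x := by
    induction z using TensorProduct.induction_on with
    | zero =>
      refine (congrArg (fun y => twistLin σ (g y)) (zero_smul (Env k A) x)).trans ?_
      rw [map_zero, map_zero]
      exact (zero_smul (Env k A) (twistLin σ (g x))).symm
    | add b c hb hc =>
      rw [add_smul, map_add, map_add, hb, hc]
      exact (add_smul b c (twistLin σ (g x))).symm
    | tmul a b =>
      obtain ⟨b, rfl⟩ := op_surjective b
      rw [hg]
      exact (smul_twistLin σ a b (g x)).symm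

end Twist

/-! ### Bimodules induced from right modules -/

section Induced

open Coalgebra HopfAlgebra Abelian
open scoped ModuleCat

variable {k H : Type u} [Field k] [Ring H] [HopfAlgebra k H]

lemma sum_smul_counit {h : H} {ι : Type*} (r : Repr k h ι) :
    ∑ i ∈ r.index, counit (R := k) (r.right i) • r.left i = h := by
  simpa only [map_sum, lift.tmul, LinearMap.flip_apply, LinearMap.lsmul_apply, one_smul] using
    congrArg (TensorProduct.lift (LinearMap.lsmul k H).flip)
    (sum_tmul_counit_eq (R := k) r)

section Diagonal

variable (k H)

lemma commute_antipodeOp (a b : Hᵐᵒᵖ) :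
    Commute ((Algebra.TensorProduct.includeLeft : H →ₐ[k] Env k H).comp (antipodeOp k H) a)
      ((Algebra.TensorProduct.includeRight : Hᵐᵒᵖ →ₐ[k] Env k H) b) := by
  simp [Commute, SemiconjBy]

/-- The homomorphism `op h ↦ S(h₁) ⊗ op h₂` through which bimodules become right modules. -/
def diag : Hᵐᵒᵖ →ₐ[k] Env k H :=
  convOp ((Algebra.TensorProduct.includeLeft : H →ₐ[k] Env k H).comp (antipodeOp k H))
    (Algebra.TensorProduct.includeRight : Hᵐᵒᵖ →ₐ[k] Env k H)
    (commute_antipodeOp k H)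

lemma diag_op (h : H) : diag k H (op h) = ∑ i ∈ (ℛ k h).index,
    antipode k ((ℛ k h).left i) ⊗ₜ[k] op ((ℛ k h).right i) := by
  rw [diag, convOp_op]
  simp

lemma diag_eq_conv : (diag k H).toLinearMap ∘ₗ (opLinearEquiv k).toLinearMap =
    conv ((Algebra.TensorProduct.includeLeft : H →ₐ[k] Env k H).toLinearMap ∘ₗ antipode k)
      ((Algebra.TensorProduct.includeRight : Hᵐᵒᵖ →ₐ[k] Env k H).toLinearMap ∘ₗ
        (opLinearEquiv k).toLinearMap) := rfl

/-- The right action of `H` is recovered from the left action and from `diag`, as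
`h₁ (S(h₂) ⊗ op h₃) = 1 ⊗ op h`. -/
lemma sum_tmul_mul_diag (h : H) :
    ∑ i ∈ (ℛ k h).index, ((ℛ k h).left i ⊗ₜ[k] (1 : Hᵐᵒᵖ)) * diag k H (op ((ℛ k h).right i)) =
      (1 : H) ⊗ₜ[k] op h := by
  have e := LinearMap.congr_fun (conv_conv_antipode
    (Algebra.TensorProduct.includeLeft : H →ₐ[k] Env k H)
    ((Algebra.TensorProduct.includeRight : Hᵐᵒᵖ →ₐ[k] Env k H).toLinearMap ∘ₗ
        (opLinearEquiv k).toLinearMap)) h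
  rw [← diag_eq_conv, conv_apply] at e
  exact e

lemma commute_ofId (x : H) (y : Hᵐᵒᵖ) :
    Commute ((Algebra.ofId k Hᵐᵒᵖ).comp (Bialgebra.counitAlgHom k H) x)
      (AlgHom.id k Hᵐᵒᵖ y) :=
  Algebra.commutes (A := Hᵐᵒᵖ) (counit (R := k) x) y

/-- The left inverse `a ⊗ op b ↦ ε(a) op b` of `diag`. -/
def counitLeft : Env k H →ₐ[k] Hᵐᵒᵖ :=
  Algebra.TensorProduct.lift ((Algebra.ofId k Hᵐᵒᵖ).comp (Bialgebra.counitAlgHom k H))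
    (AlgHom.id k Hᵐᵒᵖ) (commute_ofId k H)

lemma counitLeft_comp_diag : (counitLeft k H).comp (diag k H) = AlgHom.id k Hᵐᵒᵖ := by
  ext a
  obtain ⟨h, rfl⟩ := op_surjective a
  rw [AlgHom.comp_apply, diag_op, map_sum]
  conv_rhs => rw [← sum_counit_smul (ℛ k h)]
  rw [AlgHom.id_apply, Finset.op_sum]
  refine Finset.sum_congr rfl fun i _ => ?_
  rw [counitLeft, Algebra.TensorProduct.lift_tmul]
  simp [Algebra.ofId_apply, Algebra.algebraMap_eq_smul_one]

end Diagonal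

section Action

variable (k H) (M : ModuleCat.{u} Hᵐᵒᵖ)

/-- The action of `H` on `M ⊗ H` by left multiplication on the second factor. -/
def actMul : H →ₐ[k] Module.End k (M ⊗[k] H) :=
  (Module.endTensorEndAlgHom (R := k) (A := k) (M := M) (N := H)).comp
    ((Algebra.TensorProduct.includeRight (R := k) (A := Module.End k M)).comp (Algebra.lmul k H))

lemma actMul_tmul (x : H) (m : M) (v : H) : actMul k H M x (m ⊗ₜ v) = m ⊗ₜ (x * v) := rfl

lemma commute_actMul (x : H) (a : Hᵐᵒᵖ) : Commute (actMul k H M x) (tensorAct k M H a) := by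
  obtain ⟨y, rfl⟩ := op_surjective a
  refine TensorProduct.ext' fun m v => ?_
  simp only [Module.End.mul_apply, tensorAct_tmul, map_sum, actMul_tmul, op_smul_eq_mul, mul_assoc]

/-- The bimodule structure `x (m ⊗ v) y = m y₂ ⊗ x v y₁` on `M ⊗ H`. -/
def inducedAct : Env k H →ₐ[k] Module.End k (M ⊗[k] H) :=
  Algebra.TensorProduct.lift (actMul k H M) (tensorAct k M H) (commute_actMul k H M)

lemma inducedAct_tmul (x : H) (a : Hᵐᵒᵖ) :
    inducedAct k H M (x ⊗ₜ a) = actMul k H M x * tensorAct k M H a := rfl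

lemma inducedAct_diag (h : H) (m : M) :
    inducedAct k H M (diag k H (op h)) (m ⊗ₜ 1) = (op h • m) ⊗ₜ 1 := by
  have e := LinearMap.congr_fun (LinearMap.congr_fun (conv_antipode_conv (actMul k H M)
    ((actLeft k M H).toLinearMap ∘ₗ (opLinearEquiv k).toLinearMap)) h) (m ⊗ₜ 1)
  rw [conv_apply, LinearMap.sum_apply] at e
  rw [diag_op, map_sum, LinearMap.sum_apply]
  refine Eq.trans (Finset.sum_congr rfl fun i _ => ?_) e
  rw [inducedAct_tmul, Module.End.mul_apply, Module.End.mul_apply, tensorAct_tmul, conv_apply,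
    LinearMap.sum_apply]
  refine congrArg (actMul k H M (antipode k ((ℛ k h).left i))) (Finset.sum_congr rfl fun j _ => ?_)
  simp [actMul_tmul, actLeft_tmul]

lemma isNaturalAction_inducedAct :
    IsNaturalAction (k := k) (R := Hᵐᵒᵖ) (B := Env k H) (V := H) (inducedAct k H) := by
  intro M N f b x
  induction b using TensorProduct.induction_on with
  | zero => simp
  | add b c hb hc => simp only [map_add, LinearMap.add_apply, hb, hc]
  | tmul y a =>
    rw [inducedAct_tmul, inducedAct_tmul, Module.End.mul_apply, Module.End.mul_apply,
      ← isNaturalAction_tensorAct k H M N f a x]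
    generalize tensorAct k M H a x = z
    induction z with
    | zero => simp
    | add x y hx hy => simp only [map_add, hx, hy]
    | tmul m v => rfl

/-- The induction functor `M ↦ M ⊗ H` from right modules to bimodules. -/
abbrev induced : ModuleCat.{u} Hᵐᵒᵖ ⥤ Bimod k H :=
  tensorFunctor (isNaturalAction_inducedAct k H)

/-- The restriction functor from bimodules to right modules along `diag`: the action is
`m · h = S(h₁) m h₂`. -/
abbrev restr : Bimod k H ⥤ ModuleCat.{u} Hᵐᵒᵖ :=
  ModuleCat.restrictScalars (diag k H).toRingHom

/-- The linear map `n ⊗ v ↦ v n`. -/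
def evalMap (N : Bimod k H) : (restr k H).obj N ⊗[k] H →ₗ[k] N :=
  TensorProduct.lift (LinearMap.mk₂ k
    (fun (n : (restr k H).obj N) (v : H) => ((v ⊗ₜ[k] (1 : Hᵐᵒᵖ) : Env k H) • (show N from n) : N))
    (fun _ _ _ => smul_add _ _ _)
    (fun c n v => by
      have e : c • n = (algebraMap k (Env k H) c • (show N from n) : N) := by
        rw [← (diag k H).commutes]; rfl
      change _ • (show N from c • n) = _
      rw [e, ← mul_smul, ← Algebra.commutes, mul_smul, algebraMap_smul])
    (fun n v w => by rw [TensorProduct.add_tmul, add_smul])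
    (fun c n v => by rw [← TensorProduct.smul_tmul', smul_assoc]))

lemma sum_smul_diag_smul (N : Bimod k H) (y h v : H) (n : N) :
    ((y ⊗ₜ[k] op h : Env k H) • ((v ⊗ₜ[k] (1 : Hᵐᵒᵖ) : Env k H) • n) : N) =
      ∑ i ∈ (ℛ k h).index, ((y * (v * (ℛ k h).left i)) ⊗ₜ[k] (1 : Hᵐᵒᵖ) : Env k H) •
        (diag k H (op ((ℛ k h).right i)) • n) := by
  have e : (y ⊗ₜ[k] op h : Env k H) * (v ⊗ₜ[k] (1 : Hᵐᵒᵖ)) =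
      ((y * v) ⊗ₜ[k] (1 : Hᵐᵒᵖ)) * ((1 : H) ⊗ₜ[k] op h) := by simp
  rw [← mul_smul, e, ← sum_tmul_mul_diag k H h, Finset.mul_sum, Finset.sum_smul]
  refine Finset.sum_congr rfl fun i _ => ?_
  rw [← mul_assoc, Algebra.TensorProduct.tmul_mul_tmul, mul_one, mul_smul, mul_assoc]

lemma evalMap_inducedAct (N : Bimod k H) (b : Env k H) (x : (restr k H).obj N ⊗[k] H) :
    evalMap k H N (inducedAct k H _ b x) = b • evalMap k H N x := by
  induction b using TensorProduct.induction_on with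
  | zero =>
    rw [map_zero]
    exact (zero_smul (Env k H) (evalMap k H N x)).symm
  | add b c hb hc => simp only [map_add, LinearMap.add_apply, hb, hc, add_smul]
  | tmul y a =>
    obtain ⟨h, rfl⟩ := op_surjective a
    induction x with
    | zero => simp
    | add x y hx hy => simp only [map_add, hx, hy, smul_add]
    | tmul n v =>
      rw [inducedAct_tmul, Module.End.mul_apply, tensorAct_tmul, map_sum, map_sum]
      exact (sum_smul_diag_smul k H N y h v n).symm

/-- The counit `n ⊗ v ↦ v n` of the adjunction between `induced` and `restr`. -/
def inducedCounit : restr k H ⋙ induced k H ⟶ 𝟭 (Bimod k H) where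
  app N := linToHom (isNaturalAction_inducedAct k H) (evalMap k H N) (evalMap_inducedAct k H N)
  naturality N N' g := by
    apply homToLin_injective (isNaturalAction_inducedAct k H)
    refine TensorProduct.ext' fun n v => ?_
    exact (g.hom.map_smul (v ⊗ₜ[k] (1 : Hᵐᵒᵖ) : Env k H) (show N from n)).symm

lemma isCounit_induced : IsCounit (induced k H) (restr k H) (inducedCounit k H) := by
  intro M N
  constructor
  · intro f g hfg
    ext m
    have e := congrArg (fun φ => homToLin (isNaturalAction_inducedAct k H) φ (m ⊗ₜ 1)) hfg
    have e' : ((1 : Env k H) • (show N from f.hom m) : N) =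
      (1 : Env k H) • (show N from g.hom m) := e
    rwa [one_smul, one_smul] at e'
  · intro φ
    let f : M →ₗ[Hᵐᵒᵖ] (restr k H).obj N :=
      { toFun := fun m => (show (restr k H).obj N from
          homToLin (isNaturalAction_inducedAct k H) φ (m ⊗ₜ 1))
        map_add' := fun m m' => by rw [TensorProduct.add_tmul, map_add]; rfl
        map_smul' := fun a m => by
          obtain ⟨h, rfl⟩ := op_surjective a
          rw [← inducedAct_diag, homToLin_apply]
          rfl }
    refine ⟨ModuleCat.ofHom (Y := (restr k H).obj N) f, ?_⟩
    apply homToLin_injective (isNaturalAction_inducedAct k H)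
    refine TensorProduct.ext' fun m v => ?_
    refine (homToLin_apply (isNaturalAction_inducedAct k H) φ (v ⊗ₜ[k] (1 : Hᵐᵒᵖ)) (m ⊗ₜ 1)).symm.trans ?_
    rw [inducedAct_tmul, map_one, mul_one, actMul_tmul, mul_one]

end Action

variable (k H) in
/-- The identity of `k` as a linear equivalence from `k` to the trivial module. -/
def trivialLin : k ≃ₗ[k] trivialRight k H where
  toFun x := (show TrivialSpace k H from x)
  invFun x := (show TrivialSpace k H from x)
  map_add' _ _ := rfl
  map_smul' c x := by
    change c * x = counit (R := k) (algebraMap k H c) * x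
    rw [Bialgebra.counit_algebraMap]
  left_inv _ := rfl
  right_inv _ := rfl

lemma smul_trivialLin (h : H) (c : k) :
    (op h • trivialLin k H c : trivialRight k H) = trivialLin k H (counit (R := k) h * c) := rfl

variable (k H) in
/-- The linear map `c ⊗ v ↦ c v` from the bimodule induced from the trivial right module to the
regular bimodule. -/
def inducedTrivialLin : (trivialRight k H : Type u) ⊗[k] H ≃ₗ[k] regular k H :=
  (TensorProduct.congr (trivialLin k H).symm (LinearEquiv.refl k H)).trans
    ((TensorProduct.lid k H).trans (twistLin (AlgHom.id k H)))

lemma inducedTrivialLin_tmul (c : k) (v : H) :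
    inducedTrivialLin k H (trivialLin k H c ⊗ₜ v) = twistLin (AlgHom.id k H) (c • v) := rfl

lemma inducedTrivialLin_smul (b : Env k H) (x : (trivialRight k H : Type u) ⊗[k] H) :
    inducedTrivialLin k H (inducedAct k H _ b x) = b • inducedTrivialLin k H x := by
  induction b using TensorProduct.induction_on with
  | zero =>
    rw [map_zero]
    exact (map_zero _).trans (zero_smul (Env k H) (inducedTrivialLin k H x)).symm
  | add b c hb hc =>
    rw [map_add, LinearMap.add_apply, map_add, hb, hc]
    exact (add_smul b c _).symm
  | tmul y a =>
    obtain ⟨h, rfl⟩ := op_surjective a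
    induction x with
    | zero => simp
    | add x y hx hy => simp only [map_add, hx, hy, smul_add]
    | tmul c v =>
      obtain ⟨c, rfl⟩ := (trivialLin k H).surjective c
      rw [inducedAct_tmul, Module.End.mul_apply, tensorAct_tmul, map_sum, map_sum,
        inducedTrivialLin_tmul]
      refine Eq.trans ?_ (smul_twistLin (AlgHom.id k H) y h (c • v)).symm
      rw [AlgHom.id_apply]
      conv_rhs => rw [← sum_smul_counit (ℛ k h), Finset.mul_sum, map_sum]
      refine Finset.sum_congr rfl fun i _ => ?_
      rw [smul_trivialLin, actMul_tmul, inducedTrivialLin_tmul, op_smul_eq_mul]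
      congr 1
      simp only [mul_smul_comm, smul_mul_assoc, mul_smul, mul_assoc]

variable (k H) in
/-- The bimodule induced from the trivial right module is the regular bimodule. -/
def inducedTrivialIso : (induced k H).obj (trivialRight k H) ≅ regular k H :=
  letI f := linToHom (isNaturalAction_inducedAct k H) (inducedTrivialLin k H).toLinearMap
    inducedTrivialLin_smul
  haveI : IsIso f := (ConcreteCategory.isIso_iff_bijective f).2 (inducedTrivialLin k H).bijective
  asIso f

variable (k H) in
/-- The transposition isomorphism `Ext_{H^op}(k, N) ≅ Ext_{H^e}(H, N)`. -/
def bimodTranspose (N : Bimod k H) (n : ℕ) :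
    Ext.{u} (trivialRight k H) ((restr k H).obj N) n →+ Ext.{u} (regular k H) N n :=
  ((Ext.mk₀ (inducedTrivialIso k H).inv).precomp N (zero_add n)).comp
    (extTranspose (induced k H) (inducedCounit k H) (trivialRight k H) N n)

lemma bimodTranspose_bijective (N : Bimod k H) (n : ℕ) :
    Function.Bijective (bimodTranspose k H N n) := by
  refine Function.Bijective.comp (g := fun x : Ext.{u} _ N n =>
    (Ext.mk₀ (inducedTrivialIso k H).inv).comp x (zero_add n)) ?_
    (extTranspose_bijective (isCounit_induced k H) _ _ _)
  refine Function.bijective_iff_has_inverse.2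
    ⟨fun x => (Ext.mk₀ (inducedTrivialIso k H).hom).comp x (zero_add n), fun x => ?_, fun x => ?_⟩
  · simp
  · simp

lemma bimodTranspose_comp {N N' : Bimod k H} {n : ℕ}
    (x : Ext.{u} (trivialRight k H) ((restr k H).obj N) n) (g : N ⟶ N') :
    bimodTranspose k H N' n (x.comp (Ext.mk₀ ((restr k H).map g)) (add_zero n)) =
      (bimodTranspose k H N n x).comp (Ext.mk₀ g) (add_zero n) := by
  refine (congrArg (fun x : Ext.{u} _ N' n =>
    (Ext.mk₀ (inducedTrivialIso k H).inv).comp x (zero_add n)) (extTranspose_comp_map x g)).trans ?_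
  exact (Ext.comp_assoc_of_third_deg_zero _ _ _ _).symm

lemma isExtCompact_regular (h : IsExtCompact (trivialRight k H)) :
    IsExtCompact (regular k H) := by
  intro I _ _ Y hY n i x
  obtain ⟨x, rfl⟩ := (bimodTranspose_bijective _ _).2 x
  obtain ⟨j, hj, e⟩ := h (Y ⋙ restr k H) hY n i x
  refine ⟨j, hj, ?_⟩
  rw [← bimodTranspose_comp]
  exact (congrArg (bimodTranspose k H (Y.obj j) n) e).trans (map_zero _)

variable (k H) in
/-- The functor from right modules to bimodules given by the trivial left action of `H`. -/
abbrev inflate : ModuleCat.{u} Hᵐᵒᵖ ⥤ Bimod k H :=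
  ModuleCat.restrictScalars (counitLeft k H).toRingHom

variable (k H) in
lemma counitLeft_comp_diag' :
    (counitLeft k H).toRingHom.comp (diag k H).toRingHom = RingHom.id Hᵐᵒᵖ :=
  congrArg AlgHom.toRingHom (counitLeft_comp_diag k H)

variable (k H) in
/-- Restriction is left inverse to inflation. -/
def inflateRestr : inflate k H ⋙ restr k H ≅ 𝟭 (ModuleCat.{u} Hᵐᵒᵖ) :=
  (ModuleCat.restrictScalarsComp' _ _ _ rfl).symm ≪≫
    ModuleCat.restrictScalarsId' _ (counitLeft_comp_diag' k H)

/-- A vanishing system of right modules is tested on `H` after inflation to bimodules. -/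
lemma isExtCompact_trivialRight (h : IsExtCompact (regular k H)) :
    IsExtCompact (trivialRight k H) := by
  intro I _ _ Y hY n i x
  obtain ⟨j, hj, e⟩ := h (Y ⋙ inflate k H) hY n i (bimodTranspose k H _ n
    (x.comp (Ext.mk₀ ((inflateRestr k H).inv.app (Y.obj i))) (add_zero n)))
  refine ⟨j, hj, ?_⟩
  rw [← bimodTranspose_comp] at e
  have e' := (bimodTranspose_bijective _ _).1 (e.trans (map_zero _).symm)
  have e'' := congrArg (fun z => z.comp (Ext.mk₀ ((inflateRestr k H).hom.app (Y.obj j)))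
    (add_zero n)) e'
  have hn := (inflateRestr k H).hom.naturality (Y.map (homOfLE hj))
  simp only [Functor.comp_map, Functor.id_map] at hn
  simpa [Ext.comp_assoc_of_third_deg_zero, hn] using e''

theorem hasFiniteResolution_regular_iff :
    HasFiniteResolution (regular k H) ↔ IsPerfect (trivialRight k H) := by
  rw [hasFiniteResolution_iff, isPerfect_iff]
  refine and_congr ⟨isExtCompact_trivialRight, isExtCompact_regular⟩ (exists_congr fun n => ?_)
  rw [hasProjectiveDimensionLT_iff, hasProjectiveDimensionLT_iff]
  constructor
  · intro h i hi Y x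
    have e := h i hi (bimodTranspose k H _ i
      (x.comp (Ext.mk₀ ((inflateRestr k H).inv.app Y)) (add_zero i)))
    have e' := (bimodTranspose_bijective _ _).1 (e.trans (map_zero _).symm)
    have e'' := congrArg (fun z => z.comp (Ext.mk₀ ((inflateRestr k H).hom.app Y))
      (add_zero i)) e'
    simpa using e''
  · intro h i hi N x
    obtain ⟨x, rfl⟩ := (bimodTranspose_bijective _ _).2 x
    rw [h i hi x, map_zero]

end Induced

/-! ### The bimodule `Ext_{H^e}(H, H^e)` -/

section Dual

open Coalgebra HopfAlgebra Abelian
open scoped ModuleCat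

lemma comp_mk₀_sum {R : Type u} [Ring R] {M N N' : ModuleCat.{u} R} {n : ℕ} {ι : Type*}
    (s : Finset ι) (f : ι → (N ⟶ N')) (x : Ext.{u} M N n) :
    x.comp (Ext.mk₀ (∑ i ∈ s, f i)) (add_zero n) =
      ∑ i ∈ s, x.comp (Ext.mk₀ (f i)) (add_zero n) := by
  classical
  induction s using Finset.induction_on with
  | empty => simp
  | insert i s hi ih => rw [Finset.sum_insert hi, Finset.sum_insert hi, Ext.mk₀_add,
      Ext.comp_add, ih]

lemma sum_comp_mk₀ {R : Type u} [Ring R] {M N N' : ModuleCat.{u} R} {n : ℕ} {ι : Type*}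
    (s : Finset ι) (x : ι → Ext.{u} M N n) (f : N ⟶ N') :
    (∑ i ∈ s, x i).comp (Ext.mk₀ f) (add_zero n) =
      ∑ i ∈ s, (x i).comp (Ext.mk₀ f) (add_zero n) :=
  map_sum ((Ext.mk₀ f).postcomp M (add_zero n)) x s

variable (k H : Type u) [Field k] [Ring H] [HopfAlgebra k H]

/-- Another expression of the right action: `(S(h₂) ⊗ op h₃) (S²(h₁) ⊗ 1) = 1 ⊗ op h`. This is where
the square of the antipode comes from. -/
lemma sum_diag_mul_tmul (h : H) :
    ∑ i ∈ (ℛ k h).index, diag k H (op ((ℛ k h).right i)) *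
      (antipode k (antipode k ((ℛ k h).left i)) ⊗ₜ[k] (1 : Hᵐᵒᵖ)) = (1 : H) ⊗ₜ[k] op h := by
  have e := sum_convOp_mul_antipode _ _ (commute_antipodeOp k H) h
  exact e

/-- The linear map `v ⊗ x ↦ S(x₁) v ⊗ op x₂`. -/
def envMap : H ⊗[k] H →ₗ[k] Env k H :=
  TensorProduct.lift (LinearMap.mk₂ k
    (fun v x => diag k H (op x) * (v ⊗ₜ[k] (1 : Hᵐᵒᵖ)))
    (fun v w x => by rw [TensorProduct.add_tmul, mul_add])
    (fun c v x => by rw [← TensorProduct.smul_tmul', mul_smul_comm])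
    (fun v x y => by rw [MulOpposite.op_add, map_add, add_mul])
    (fun c v x => by rw [MulOpposite.op_smul, map_smul, smul_mul_assoc]))

lemma envMap_tmul (v x : H) : envMap k H (v ⊗ₜ x) = diag k H (op x) * (v ⊗ₜ[k] (1 : Hᵐᵒᵖ)) := rfl

/-- The linear map `x ↦ S²(x₁) ⊗ x₂`. -/
def antipodeSqComul : H →ₗ[k] H ⊗[k] H :=
  (antipode k ∘ₗ antipode k).rTensor H ∘ₗ comul

lemma antipodeSqComul_apply (x : H) : antipodeSqComul k H x = ∑ i ∈ (ℛ k x).index,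
    antipode k (antipode k ((ℛ k x).left i)) ⊗ₜ (ℛ k x).right i := by
  rw [antipodeSqComul, LinearMap.comp_apply]
  conv_lhs => rw [← (ℛ k x).eq]
  simp

/-- The linear map `a ⊗ op x ↦ S²(x₁) a ⊗ x₂`. -/
def envInv : Env k H →ₗ[k] H ⊗[k] H :=
  TensorProduct.lift (LinearMap.mk₂ k
    (fun a y => antipodeSqComul k H (unop y) * (a ⊗ₜ[k] (1 : H)))
    (fun v w x => by rw [TensorProduct.add_tmul, mul_add])
    (fun c v x => by rw [← TensorProduct.smul_tmul', mul_smul_comm])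
    (fun v x y => by rw [MulOpposite.unop_add, map_add, add_mul])
    (fun c v x => by rw [MulOpposite.unop_smul, map_smul, smul_mul_assoc]))

lemma envInv_tmul (a x : H) :
    envInv k H (a ⊗ₜ op x) = antipodeSqComul k H x * (a ⊗ₜ[k] (1 : H)) := rfl

lemma sum_antipodeSqComul_mul (x : H) : ∑ i ∈ (ℛ k x).index,
    antipodeSqComul k H ((ℛ k x).right i) * (antipode k ((ℛ k x).left i) ⊗ₜ[k] (1 : H)) =
      (1 : H) ⊗ₜ[k] x := by
  let F : H →ₐ[k] (H ⊗[k] H)ᵐᵒᵖ := AlgHom.opComm.symm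
    ((Algebra.TensorProduct.includeLeft : H →ₐ[k] H ⊗[k] H).comp (antipodeOp k H))
  let G : H →ₗ[k] (H ⊗[k] H)ᵐᵒᵖ := (opLinearEquiv k).toLinearMap ∘ₗ
    (Algebra.TensorProduct.includeRight : H →ₐ[k] H ⊗[k] H).toLinearMap
  have e := LinearMap.congr_fun (conv_conv_antipode F G) x
  have e' : ∀ y, conv (F.toLinearMap ∘ₗ antipode k) G y = op (antipodeSqComul k H y) := by
    intro y
    rw [conv_comm_of_commute
      (f := (Algebra.TensorProduct.includeLeft : H →ₐ[k] H ⊗[k] H).toLinearMap ∘ₗ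
        (antipode k ∘ₗ antipode k))
      (g := (Algebra.TensorProduct.includeRight : H →ₐ[k] H ⊗[k] H).toLinearMap)
      (fun _ => rfl) (fun _ => rfl) (fun a b => by simp [Commute, SemiconjBy]),
      conv_apply, antipodeSqComul_apply]
    simp
  apply op_injective
  rw [conv_apply] at e
  rw [Finset.op_sum]
  refine Eq.trans (Finset.sum_congr rfl fun i _ => ?_) e
  rw [e', op_mul]
  rfl

/-- The linear isomorphism `v ⊗ x ↦ S(x₁) v ⊗ op x₂`. -/
def envEquiv : H ⊗[k] H ≃ₗ[k] Env k H :=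
  LinearEquiv.ofLinearMap (envMap k H) (envInv k H)
    (TensorProduct.ext' fun a y => by
      obtain ⟨x, rfl⟩ := op_surjective y
      rw [LinearMap.comp_apply, envInv_tmul, antipodeSqComul_apply, Finset.sum_mul, map_sum]
      have e := congrArg (· * (a ⊗ₜ[k] (1 : Hᵐᵒᵖ))) (sum_diag_mul_tmul k H x)
      simp only [Finset.sum_mul, mul_assoc, Algebra.TensorProduct.tmul_mul_tmul, one_mul,
        mul_one] at e
      simpa [envMap_tmul] using e)
    (TensorProduct.ext' fun v x => by
      rw [LinearMap.comp_apply, envMap_tmul, diag_op, Finset.sum_mul, map_sum]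
      have e := congrArg (· * (v ⊗ₜ[k] (1 : H))) (sum_antipodeSqComul_mul k H x)
      simp only [Finset.sum_mul, mul_assoc, Algebra.TensorProduct.tmul_mul_tmul, one_mul,
        mul_one] at e
      simpa [envInv_tmul] using e)

/-- The enveloping algebra as a right `H`-module through `diag`. -/
abbrev envRight : ModuleCat.{u} Hᵐᵒᵖ := (restr k H).obj (ModuleCat.of (Env k H) (Env k H))

lemma envEquiv_symm_smul (h : H) (w : Env k H) :
    (envEquiv k H).symm (diag k H (op h) * w) =
      (LinearMap.mulRight k h).lTensor H ((envEquiv k H).symm w) := by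
  obtain ⟨t, rfl⟩ := (envEquiv k H).surjective w
  rw [LinearEquiv.symm_apply_eq, LinearEquiv.symm_apply_apply]
  induction t with
  | zero => simp
  | add x y hx hy => simp only [map_add, hx, hy, mul_add]
  | tmul v x =>
    change diag k H (op h) * (diag k H (op x) * (v ⊗ₜ[k] (1 : Hᵐᵒᵖ))) =
      diag k H (op (x * h)) * (v ⊗ₜ[k] (1 : Hᵐᵒᵖ))
    rw [op_mul, map_mul, mul_assoc]

variable {H}

/-- The homomorphism of right modules `x ↦ S(x₁) v ⊗ op x₂`. -/
def envIncl (v : H) : ModuleCat.of Hᵐᵒᵖ H ⟶ envRight k H :=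
  ModuleCat.ofHom (Y := envRight k H)
    { toFun := fun x => diag k H (op x) * (v ⊗ₜ[k] (1 : Hᵐᵒᵖ))
      map_add' := fun x y => by rw [MulOpposite.op_add, map_add, add_mul]; rfl
      map_smul' := fun a x => by
        obtain ⟨h, rfl⟩ := op_surjective a
        rw [op_smul_eq_mul, op_mul, map_mul, mul_assoc]
        rfl }

/-- The projection of the enveloping algebra onto `H` attached to a linear form on `H`. -/
def envProj (f : H →ₗ[k] k) : envRight k H ⟶ ModuleCat.of Hᵐᵒᵖ H :=
  ModuleCat.ofHom (X := envRight k H)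
    { toFun := fun w => TensorProduct.lid k H (f.rTensor H ((envEquiv k H).symm w))
      map_add' := fun x y => by
        refine (congrArg (fun z => TensorProduct.lid k H (f.rTensor H z))
          (map_add (envEquiv k H).symm _ _)).trans ?_
        rw [map_add, map_add]
      map_smul' := fun a w => by
        obtain ⟨h, rfl⟩ := op_surjective a
        refine (congrArg (fun z => TensorProduct.lid k H (f.rTensor H z))
          (envEquiv_symm_smul k H h w)).trans ?_
        rw [RingHom.id_apply, op_smul_eq_mul]
        generalize (envEquiv k H).symm w = t
        induction t with
        | zero => simp
        | add x y hx hy => simp only [map_add, hx, hy, add_mul]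
        | tmul v x => simp }

lemma envIncl_comp_envProj (v : H) (f : H →ₗ[k] k) :
    envIncl k v ≫ envProj k f = ModuleCat.ofHom (Module.toModuleEnd Hᵐᵒᵖ (S := H) H
      (algebraMap k H (f v))) := by
  refine ModuleCat.hom_ext (LinearMap.ext fun x => ?_)
  change TensorProduct.lid k H (f.rTensor H ((envEquiv k H).symm (envEquiv k H (v ⊗ₜ x)))) =
    algebraMap k H (f v) * x
  simp [Algebra.smul_def]

lemma mem_iSup_range_envIncl {B : Type u} (b : Module.Basis B k H) (w : envRight k H) :
    w ∈ ⨆ i, LinearMap.range (envIncl k (b i)).hom := by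
  obtain ⟨t, rfl⟩ := (envEquiv k H).surjective w
  induction t with
  | zero =>
    rw [map_zero]; exact Submodule.zero_mem _
  | add x y hx hy =>
    rw [map_add]; exact Submodule.add_mem _ hx hy
  | tmul v x =>
    have hv := b.mem_span v
    induction hv using Submodule.span_induction generalizing x with
    | mem v hv =>
      obtain ⟨i, rfl⟩ := hv
      exact Submodule.mem_iSup_of_mem i ⟨x, rfl⟩
    | zero =>
      rw [zero_tmul, map_zero]; exact Submodule.zero_mem _
    | add v w _ _ hv hw =>
      rw [TensorProduct.add_tmul, map_add]; exact Submodule.add_mem _ (hv x) (hw x)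
    | smul c v _ hv =>
      rw [TensorProduct.smul_tmul]; exact hv (c • x)

/-- Left multiplication by `h` as an endomorphism of the right module `H`. -/
def leftMul (h : H) : ModuleCat.of Hᵐᵒᵖ H ⟶ ModuleCat.of Hᵐᵒᵖ H :=
  ModuleCat.ofHom (Module.toModuleEnd Hᵐᵒᵖ (S := H) H h)

lemma extRight_smul_eq (d : ℕ) (h : H) (e : ExtRight k H d) :
    h • e = Ext.comp (show Ext.{u} (trivialRight k H) (ModuleCat.of Hᵐᵒᵖ H) d from e)
      (Ext.mk₀ (leftMul h)) (add_zero d) := rfl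

lemma extRight_algebraMap_smul (d : ℕ) (c : k) (e : ExtRight k H d) :
    c • e = algebraMap k H c • e := rfl

instance (d : ℕ) : IsScalarTower k H (ExtRight k H d) where
  smul_assoc c h e := by
    rw [extRight_algebraMap_smul, ← mul_smul, Algebra.smul_def]

/-- The class with values in the enveloping algebra obtained from a class with values in `H` along
`envIncl`. -/
def extIncl (d : ℕ) (e : ExtRight k H d) (v : H) : Ext.{u} (trivialRight k H) (envRight k H) d :=
  Ext.comp (show Ext.{u} (trivialRight k H) (ModuleCat.of Hᵐᵒᵖ H) d from e)
    (Ext.mk₀ (envIncl k v)) (add_zero d)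

lemma extIncl_comp_envProj (d : ℕ) (e : ExtRight k H d) (v : H) (f : H →ₗ[k] k) :
    (extIncl k d e v).comp (Ext.mk₀ (envProj k f)) (add_zero d) =
      (show Ext.{u} (trivialRight k H) (ModuleCat.of Hᵐᵒᵖ H) d from f v • e) := by
  refine (Ext.comp_assoc_of_third_deg_zero _ _ _ _).trans ?_
  rw [Ext.mk₀_comp_mk₀, envIncl_comp_envProj]
  rfl

/-- The element of `Ext(H, H^e)` attached to a class with values in `H`, pushed along
`x ↦ S(x₁) v ⊗ op x₂` and transposed. -/
def dualFun (d : ℕ) (e : ExtRight k H d) (v : H) : dual k H d :=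
  bimodTranspose k H (ModuleCat.of (Env k H) (Env k H)) d (extIncl k d e v)

lemma dualFun_add (d : ℕ) (e e' : ExtRight k H d) (v : H) :
    dualFun k d (e + e') v = dualFun k d e v + dualFun k d e' v := by
  refine (congrArg (bimodTranspose k H _ d) (Ext.add_comp _ _ _ _)).trans ?_
  exact map_add (bimodTranspose k H (ModuleCat.of (Env k H) (Env k H)) d) _ _

lemma envIncl_add (v w : H) : envIncl k (v + w) = envIncl k v + envIncl k w := by
  refine ModuleCat.hom_ext (LinearMap.ext fun x => ?_)
  change diag k H (op x) * _ = diag k H (op x) * _ + diag k H (op x) * _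
  rw [TensorProduct.add_tmul, mul_add]

lemma dualFun_add_right (d : ℕ) (e : ExtRight k H d) (v w : H) :
    dualFun k d e (v + w) = dualFun k d e v + dualFun k d e w := by
  rw [dualFun, extIncl, envIncl_add, Ext.mk₀_add, Ext.comp_add]
  exact map_add (bimodTranspose k H (ModuleCat.of (Env k H) (Env k H)) d) _ _

lemma dualFun_sum_right {ι : Type*} (s : Finset ι) (d : ℕ) (e : ι → ExtRight k H d) (v : ι → H)
    (x : Ext.{u} (trivialRight k H) (envRight k H) d)
    (hx : x = ∑ i ∈ s, extIncl k d (e i) (v i)) :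
    bimodTranspose k H (ModuleCat.of (Env k H) (Env k H)) d x = ∑ i ∈ s, dualFun k d (e i) (v i) := by
  rw [hx, map_sum]
  rfl

lemma leftMul_comp_envIncl (c : k) (v : H) :
    leftMul (algebraMap k H c) ≫ envIncl k v = envIncl k (c • v) := by
  refine ModuleCat.hom_ext (LinearMap.ext fun x => ?_)
  change diag k H (op (algebraMap k H c * x)) * _ = diag k H (op x) * _
  rw [← Algebra.smul_def, MulOpposite.op_smul, map_smul, ← TensorProduct.smul_tmul', smul_mul_assoc,
    mul_smul_comm]

lemma dualFun_smul_left (d : ℕ) (c : k) (e : ExtRight k H d) (v : H) :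
    dualFun k d (c • e) v = dualFun k d e (c • v) := by
  rw [dualFun, dualFun, extIncl, extIncl, extRight_algebraMap_smul, extRight_smul_eq]
  refine congrArg (bimodTranspose k H _ d) ?_
  refine (Ext.comp_assoc_of_third_deg_zero _ _ _ _).trans ?_
  rw [Ext.mk₀_comp_mk₀, leftMul_comp_envIncl]

variable (H) in
/-- Right multiplication by `b ⊗ op a` as an endomorphism of the enveloping algebra. -/
def innerHom (z : Env k H) : ModuleCat.of (Env k H) (Env k H) ⟶ ModuleCat.of (Env k H) (Env k H) :=
  ModuleCat.ofHom (innerAction k H z)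

lemma envIncl_comp_innerHom (v a b : H) :
    envIncl k v ≫ (restr k H).map (innerHom k H (a ⊗ₜ op b)) =
      ∑ i ∈ (ℛ k a).index, leftMul ((ℛ k a).right i) ≫
        envIncl k (antipode k (antipode k ((ℛ k a).left i)) * v * b) := by
  refine ModuleCat.hom_ext (LinearMap.ext fun x => ?_)
  rw [ModuleCat.hom_sum, LinearMap.sum_apply]
  refine (innerAction_tmul k H a b (diag k H (op x) * (v ⊗ₜ[k] (1 : Hᵐᵒᵖ)))).trans ?_
  have e : (v ⊗ₜ[k] (1 : Hᵐᵒᵖ) : Env k H) * (b ⊗ₜ op a) =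
    ((1 : H) ⊗ₜ op a) * ((v * b) ⊗ₜ[k] (1 : Hᵐᵒᵖ)) := by simp
  rw [mul_assoc, e, ← sum_diag_mul_tmul, Finset.sum_mul, Finset.mul_sum]
  refine Finset.sum_congr rfl fun i _ => ?_
  change _ = diag k H (op ((ℛ k a).right i * x)) * _
  rw [op_mul, map_mul]
  simp only [mul_assoc, Algebra.TensorProduct.tmul_mul_tmul, mul_one]

lemma smul_dualFun (d : ℕ) (e : ExtRight k H d) (v a b : H) :
    ((a ⊗ₜ op b : Env k H) • dualFun k d e v : dual k H d) =
      ∑ i ∈ (ℛ k a).index, dualFun k d ((ℛ k a).right i • e)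
        (antipode k (antipode k ((ℛ k a).left i)) * v * b) := by
  rw [← dualFun_sum_right k _ _ _ _ _ rfl]
  refine (bimodTranspose_comp _ (innerHom k H (a ⊗ₜ op b))).symm.trans ?_
  refine congrArg (bimodTranspose k H _ d) ?_
  rw [extIncl, Ext.comp_assoc_of_third_deg_zero, Ext.mk₀_comp_mk₀, envIncl_comp_innerHom]
  refine (comp_mk₀_sum _ _ _).trans ?_
  refine Finset.sum_congr rfl fun i _ => ?_
  rw [← Ext.mk₀_comp_mk₀, ← Ext.comp_assoc_of_third_deg_zero]
  rfl

lemma op_smul_dualFun (d : ℕ) (e : ExtRight k H d) (v b : H) :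
    (((1 : H) ⊗ₜ op b : Env k H) • dualFun k d e v : dual k H d) = dualFun k d e (v * b) := by
  refine (bimodTranspose_comp _ (innerHom k H (1 ⊗ₜ op b))).symm.trans ?_
  refine congrArg (bimodTranspose k H _ d) ?_
  rw [extIncl, extIncl, Ext.comp_assoc_of_third_deg_zero, Ext.mk₀_comp_mk₀]
  congr 2
  refine ModuleCat.hom_ext (LinearMap.ext fun x => ?_)
  refine (innerAction_tmul k H 1 b (diag k H (op x) * (v ⊗ₜ[k] (1 : Hᵐᵒᵖ)))).trans ?_
  change _ = diag k H (op x) * _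
  rw [mul_assoc, Algebra.TensorProduct.tmul_mul_tmul, op_one, mul_one]

lemma dualFun_smul (d : ℕ) (e : ExtRight k H d) (c : k) (v : H) :
    dualFun k d e (c • v) = c • dualFun k d e v := by
  have h := op_smul_dualFun k d e v (algebraMap k H c)
  rw [← Algebra.commutes, ← Algebra.smul_def] at h
  rw [← h, ← algebraMap_smul (Env k H) c (dualFun k d e v)]
  congr 1
  rw [Algebra.TensorProduct.algebraMap_apply']
  rfl

/-- The linear map sending `e ⊗ v` to the transpose of the image of `e` under
`x ↦ S(x₁) v ⊗ op x₂`. -/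
def dualMap (d : ℕ) : ExtRight k H d ⊗[k] H →ₗ[k] dual k H d :=
  TensorProduct.lift (LinearMap.mk₂ k (dualFun k d) (dualFun_add k d)
    (fun c e v => by rw [dualFun_smul_left, dualFun_smul]) (dualFun_add_right k d)
    (fun c e v => dualFun_smul k d e c v))

/-- The summands of an element of `Ext ⊗ H`, written in a basis of `H`, are recovered with the
projections of `H^e` attached to the coordinate forms. -/
lemma dualMap_injective (d : ℕ) : Function.Injective (dualMap k (H := H) d) := by
  classical
  rw [injective_iff_map_eq_zero]
  intro t ht
  let b := Module.Basis.ofVectorSpace k H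
  obtain ⟨f, rfl⟩ := (TensorProduct.equivFinsuppOfBasisRight b).symm.surjective t
  rw [TensorProduct.equivFinsuppOfBasisRight_symm_apply, Finsupp.sum, map_sum] at ht
  let y : Ext.{u} (trivialRight k H) (envRight k H) d :=
    ∑ i ∈ f.support, extIncl k d (f i) (b i)
  have hy : y = 0 := by
    apply (bimodTranspose_bijective (ModuleCat.of (Env k H) (Env k H)) d).1
    rw [dualFun_sum_right k _ _ _ _ y rfl, map_zero]
    exact ht
  suffices f = 0 by rw [this, map_zero]
  ext j
  have hj : ∑ i ∈ f.support, b.coord j (b i) • f i = 0 := by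
    have := congrArg (fun y => y.comp (Ext.mk₀ (envProj k (b.coord j))) (add_zero d)) hy
    simp only [y, sum_comp_mk₀, Ext.zero_comp, extIncl_comp_envProj] at this
    exact this
  by_cases hs : j ∈ f.support
  · rw [Finset.sum_eq_single j (fun i _ hi => by simp [Finsupp.single_eq_of_ne, hi.symm])
      (fun h => absurd hs h)] at hj
    simpa using hj
  · simpa using hs

/-- The enveloping algebra is a direct sum of copies of `H`, and classes with values in it are
finite sums of classes with values in the summands, by Brown's condition. -/
lemma dualMap_surjective (h : IsExtCompact (trivialRight k H)) (d : ℕ) :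
    Function.Surjective (dualMap k (H := H) d) := by
  classical
  intro x
  obtain ⟨x, rfl⟩ := (bimodTranspose_bijective (ModuleCat.of (Env k H) (Env k H)) d).2 x
  let b := Module.Basis.ofVectorSpace k H
  obtain ⟨s, hs⟩ := h.exists_eq_sum (fun i => envIncl k (b i)) (fun i => envProj k (b.coord i))
    (fun i => by
      rw [envIncl_comp_envProj, b.coord_apply, b.repr_self, Finsupp.single_eq_same, map_one, map_one]
      rfl)
    (fun i j hij => by
      rw [envIncl_comp_envProj, b.coord_apply, b.repr_self, Finsupp.single_eq_of_ne hij.symm,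
        map_zero, map_zero]
      rfl) (mem_iSup_range_envIncl k b) x
  refine ⟨∑ i ∈ s, (show ExtRight k H d from
    x.comp (Ext.mk₀ (envProj k (b.coord i))) (add_zero d)) ⊗ₜ b i, ?_⟩
  rw [map_sum]
  exact (dualFun_sum_right k s d _ _ x hs).symm

variable (H) in
/-- The decomposition `Ext_{H^e}(H, H^e) ≅ Ext_{H^op}(k, H) ⊗ H`. -/
def dualEquiv (h : IsExtCompact (trivialRight k H)) (d : ℕ) :
    ExtRight k H d ⊗[k] H ≃ₗ[k] dual k H d :=
  LinearEquiv.ofBijective (dualMap k d) ⟨dualMap_injective k d, dualMap_surjective k h d⟩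

lemma smul_dualEquiv (h : IsExtCompact (trivialRight k H)) (d : ℕ) (e : ExtRight k H d)
    (v a b : H) :
    ((a ⊗ₜ op b : Env k H) • dualEquiv k H h d (e ⊗ₜ v) : dual k H d) =
      ∑ i ∈ (ℛ k a).index, dualEquiv k H h d (((ℛ k a).right i • e) ⊗ₜ
        (antipode k (antipode k ((ℛ k a).left i)) * v * b)) :=
  smul_dualFun k d e v a b

/-- The counit of `H` splits `Ext(k, H)` off `Ext(k, H) ⊗ H`. -/
lemma subsingleton_dual_iff (h : IsExtCompact (trivialRight k H)) (d : ℕ) :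
    Subsingleton (dual k H d) ↔ Subsingleton (ExtRight k H d) := by
  rw [← (dualEquiv k H h d).toEquiv.subsingleton_congr]
  constructor
  · refine fun hs => subsingleton_of_forall_eq 0 fun e => ?_
    have := congrArg (fun t => TensorProduct.rid k _ ((counit (R := k) (A := H)).lTensor _ t))
      (hs.elim (e ⊗ₜ (1 : H)) 0)
    simpa using this
  · intro hs
    infer_instance

end Dual

/-! ### Characters of endomorphism rings -/

section EndomorphismRing

variable {k V K : Type*} [Field k] [AddCommGroup V] [Module k V] [CommRing K] [IsDomain K]

/-- If the endomorphism ring of a vector space has a homomorphism to an integral domain, then the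
space has dimension one: in dimension at least two, the identity is a sum of products of elements
with square zero. -/
theorem finrank_eq_one_of_end_hom (ψ : Module.End k V →+* K) : Module.finrank k V = 1 := by
  classical
  have hsq : ∀ a : Module.End k V, a * a = 0 → ψ a = 0 := fun a ha => by
    have := congrArg ψ ha
    rw [map_mul, map_zero] at this
    exact mul_self_eq_zero.1 this
  let b := Module.Basis.ofVectorSpace k V
  set B := Module.Basis.ofVectorSpaceIndex k V
  rcases finite_or_infinite B with hB | hB
  · have := Fintype.ofFinite B
    rw [Module.finrank_eq_card_basis b]
    by_contra hne
    let E : B → B → Module.End k V := fun i j => (b.coord j).smulRight (b i)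
    have hE : ∀ i, ψ (E i i) = 0 := by
      intro i
      have : ∃ j, j ≠ i := by
        by_contra! h
        exact hne (Fintype.card_eq_one_iff.2 ⟨i, h⟩)
      obtain ⟨j, hj⟩ := this
      have e : E i i = E i j * E j i := by
        ext v
        simp [E]
      rw [e, map_mul, hsq (E i j), zero_mul]
      ext v
      simp [E, hj.symm]
    have h1 : (1 : Module.End k V) = ∑ i, E i i := by
      refine b.ext fun j => ?_
      rw [LinearMap.sum_apply]
      simp [E, Finsupp.single_apply, ite_smul]
    have := congrArg ψ h1
    rw [map_one, map_sum] at this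
    simp [hE] at this
  · have e₀ : Nonempty (B ≃ B ⊕ B) := by
      rw [← Cardinal.eq, Cardinal.mk_sum, Cardinal.lift_id,
        Cardinal.add_eq_self (Cardinal.aleph0_le_mk B)]
    obtain ⟨e₀⟩ := e₀
    let e : V ≃ₗ[k] V × V := b.repr.trans ((Finsupp.domLCongr e₀).trans
      ((Finsupp.sumFinsuppLEquivProdFinsupp k).trans (b.repr.symm.prodCongr b.repr.symm)))
    let p : Module.End k V := e.symm.toLinearMap ∘ₗ LinearMap.inl k V V ∘ₗ LinearMap.snd k V V ∘ₗ
      e.toLinearMap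
    let q : Module.End k V := e.symm.toLinearMap ∘ₗ LinearMap.inr k V V ∘ₗ LinearMap.fst k V V ∘ₗ
      e.toLinearMap
    have h1 : (1 : Module.End k V) = p * q + q * p := by
      ext v
      apply e.injective
      simp [p, q]
    have := congrArg ψ h1
    rw [map_one, map_add, map_mul, map_mul, hsq p (by ext v; simp [p]),
      hsq q (by ext v; simp [q])] at this
    simp at this

end EndomorphismRing

/-! ### Tensor products of bimodules -/

section TensorBimodules

open scoped ModuleCat

variable {k A : Type u} [Field k] [Ring A] [Algebra k A] (M N : Bimod k A)

/-- The quotient map `M ⊗_k N → M ⊗_A N`. -/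
def toTensor : OuterTensor M N →ₗ[Env k A] tensor M N := (balancing M N).mkQ

variable {M N}

lemma toTensor_surjective : Function.Surjective (toTensor M N) := (balancing M N).mkQ_surjective

lemma toTensor_eq_zero {x : OuterTensor M N} : toTensor M N x = 0 ↔ x ∈ balancing M N :=
  Submodule.Quotient.mk_eq_zero _

lemma OuterTensor.induction_on {motive : OuterTensor M N → Prop} (x : OuterTensor M N)
    (zero : motive 0) (tmul : ∀ m n, motive (outerTmul M N m n))
    (add : ∀ x y, motive x → motive y → motive (x + y)) : motive x :=
  TensorProduct.induction_on (motive := motive) x zero tmul add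

lemma toTensor_balanced (m : M) (a : A) (n : N) :
    toTensor M N (outerTmul M N (((1 : A) ⊗ₜ[k] op a : Env k A) • m) n) =
      toTensor M N (outerTmul M N m ((a ⊗ₜ[k] (1 : Aᵐᵒᵖ) : Env k A) • n)) := by
  rw [← sub_eq_zero, ← map_sub, toTensor_eq_zero]
  exact Submodule.subset_span ⟨m, a, n, rfl⟩

/-- A linear map out of `M ⊗_k N` kills the kernel of `M ⊗_k N → M ⊗_A N` as soon as it is
balanced. -/
lemma eq_zero_of_mem_balancing {X : Type*} [AddCommGroup X] (f : OuterTensor M N →+ X)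
    (hf : ∀ (m : M) (a : A) (n : N), f (outerTmul M N (((1 : A) ⊗ₜ[k] op a : Env k A) • m) n) =
      f (outerTmul M N m ((a ⊗ₜ[k] (1 : Aᵐᵒᵖ) : Env k A) • n)))
    {x : OuterTensor M N} (hx : x ∈ balancing M N) : f x = 0 := by
  suffices ∀ b : Env k A, f (b • x) = 0 by simpa using this 1
  induction hx using Submodule.span_induction with
  | mem x hx =>
    obtain ⟨m, a, n, rfl⟩ := hx
    intro b
    induction b using TensorProduct.induction_on with
    | zero => exact (congrArg f (zero_smul (Env k A) _)).trans (map_zero f)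
    | add b c hb hc => rw [add_smul, map_add, hb, hc, add_zero]
    | tmul c d =>
      obtain ⟨d, rfl⟩ := op_surjective d
      rw [smul_sub, smul_outerTmul, smul_outerTmul, map_sub, ← mul_smul, ← mul_smul]
      simp only [Algebra.TensorProduct.tmul_mul_tmul, mul_one, one_mul]
      have := hf ((c ⊗ₜ[k] (1 : Aᵐᵒᵖ) : Env k A) • m) a (((1 : A) ⊗ₜ[k] op d : Env k A) • n)
      rw [← mul_smul, ← mul_smul] at this
      simp only [Algebra.TensorProduct.tmul_mul_tmul, mul_one, one_mul] at this
      rw [this, sub_self]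
  | zero => intro b; rw [smul_zero, map_zero]
  | add x y _ _ hx hy => intro b; rw [smul_add, map_add, hx, hy, add_zero]
  | smul c x _ hx => intro b; rw [← mul_smul]; exact hx _

/-- The endomorphism of `M ⊗_k N` induced by an endomorphism of `M`. -/
def outerMap (N : Bimod k A) (ρ : M →ₗ[k] M) : OuterTensor M N →+ OuterTensor M N :=
  (ρ.rTensor N).toAddMonoidHom

lemma outerMap_tmul (ρ : M →ₗ[k] M) (m : M) (n : N) :
    outerMap N ρ (outerTmul M N m n) = outerTmul M N (ρ m) n := rfl

lemma outerMap_op_smul (ρ : M →ₗ[k] M) (y : A) (x : OuterTensor M N) :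
    outerMap N ρ (((1 : A) ⊗ₜ[k] op y : Env k A) • x) =
      ((1 : A) ⊗ₜ[k] op y : Env k A) • outerMap N ρ x := by
  induction x using OuterTensor.induction_on with
  | zero => simp
  | add x z hx hz => simp only [smul_add, map_add, hx, hz]
  | tmul m n =>
    rw [smul_outerTmul, outerMap_tmul, outerMap_tmul, smul_outerTmul]
    have e : ∀ m : M, ((1 : A) ⊗ₜ[k] (1 : Aᵐᵒᵖ) : Env k A) • m = m := fun m => one_smul _ m
    rw [e, e]

variable (θ : tensor M N ≅ regular k A)

/-- The map `M ⊗_k N → A` attached to an isomorphism of `M ⊗_A N` with `A`. -/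
def pairing : OuterTensor M N →+ A :=
  (twistLin (AlgHom.id k A)).symm.toLinearMap.toAddMonoidHom.comp
    (θ.hom.hom.comp (toTensor M N)).toAddMonoidHom

lemma pairing_eq (x : OuterTensor M N) :
    twistLin (AlgHom.id k A) (pairing θ x) = θ.hom.hom (toTensor M N x) := rfl

lemma pairing_surjective : Function.Surjective (pairing θ) :=
  (twistLin (AlgHom.id k A)).symm.surjective.comp
    (((ConcreteCategory.isIso_iff_bijective θ.hom).1 inferInstance).2.comp toTensor_surjective)

lemma pairing_eq_zero {x : OuterTensor M N} : pairing θ x = 0 ↔ x ∈ balancing M N := by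
  rw [← toTensor_eq_zero, ← (twistLin (AlgHom.id k A)).map_eq_zero_iff, pairing_eq]
  exact ⟨fun h => ((ConcreteCategory.isIso_iff_bijective θ.hom).1 inferInstance).1
    (h.trans (map_zero θ.hom.hom).symm), fun h => (congrArg θ.hom.hom h).trans (map_zero θ.hom.hom)⟩

lemma pairing_smul (a b : A) (x : OuterTensor M N) :
    pairing θ ((a ⊗ₜ[k] op b : Env k A) • x) = a * pairing θ x * b := by
  apply (twistLin (AlgHom.id k A)).injective
  rw [pairing_eq, map_smul]
  exact (θ.hom.hom.map_smul (a ⊗ₜ[k] op b : Env k A) _).trans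
    (smul_twistLin (AlgHom.id k A) a b (pairing θ x))

lemma pairing_balanced (m : M) (a : A) (n : N) :
    pairing θ (outerTmul M N (((1 : A) ⊗ₜ[k] op a : Env k A) • m) n) =
      pairing θ (outerTmul M N m ((a ⊗ₜ[k] (1 : Aᵐᵒᵖ) : Env k A) • n)) :=
  (twistLin (AlgHom.id k A)).injective (congrArg θ.hom.hom (toTensor_balanced m a n))

/-- A right linear endomorphism of `M` acts on `M ⊗_A N ≅ A` by left multiplication. -/
lemma pairing_outerMap {ρ : M →ₗ[k] M}
    (hρ : ∀ (a : A) (m : M), ρ (((1 : A) ⊗ₜ[k] op a : Env k A) • m) =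
      ((1 : A) ⊗ₜ[k] op a : Env k A) • ρ m) {u : OuterTensor M N} (hu : pairing θ u = 1)
    (x : OuterTensor M N) :
    pairing θ (outerMap N ρ x) = pairing θ (outerMap N ρ u) * pairing θ x := by
  have hx : x - ((1 : A) ⊗ₜ[k] op (pairing θ x) : Env k A) • u ∈ balancing M N := by
    rw [← pairing_eq_zero θ, map_sub, pairing_smul, hu, one_mul, one_mul, sub_self]
  have h := eq_zero_of_mem_balancing ((pairing θ).comp (outerMap N ρ)) (fun m a n => by
    simp only [AddMonoidHom.comp_apply, outerMap_tmul, hρ, pairing_balanced]) hx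
  rw [AddMonoidHom.comp_apply, map_sub, map_sub, outerMap_op_smul, pairing_smul, one_mul,
    sub_eq_zero] at h
  exact h

/-- If `M ≅ E ⊗ A` as a right module and `M ⊗_A N ≅ A`, then `End(E)` acts on `A` by right linear
endomorphisms, that is, it maps to `A`. -/
theorem finrank_eq_one_of_tensor_iso (θ : tensor M N ≅ regular k A) {E : Type*}
    [AddCommGroup E] [Module k E]
    (g : E ⊗[k] A ≃ₗ[k] M) (hg : ∀ (e : E) (v b : A),
      ((1 : A) ⊗ₜ[k] op b : Env k A) • g (e ⊗ₜ v) = g (e ⊗ₜ (v * b))) (χ : A →+* k) :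
    Module.finrank k E = 1 := by
  obtain ⟨u, hu⟩ := pairing_surjective θ 1
  let ρ : Module.End k E → (M →ₗ[k] M) := fun f =>
    g.toLinearMap ∘ₗ f.rTensor A ∘ₗ g.symm.toLinearMap
  have hρ : ∀ (f : Module.End k E) (a : A) (m : M), ρ f (((1 : A) ⊗ₜ[k] op a : Env k A) • m) =
      ((1 : A) ⊗ₜ[k] op a : Env k A) • ρ f m := by
    intro f a m
    obtain ⟨t, rfl⟩ := g.surjective m
    induction t with
    | zero => simp
    | add x y hx hy => simp only [map_add, smul_add, hx, hy]
    | tmul e v => simp [ρ, hg]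
  let ψ : Module.End k E →+* A :=
    { toFun := fun f => pairing θ (outerMap N (ρ f) u)
      map_one' := by
        have : ρ 1 = LinearMap.id := by ext m; simp [ρ, Module.End.one_eq_id]
        rw [this]
        exact (congrArg (pairing θ) (LinearMap.congr_fun (LinearMap.rTensor_id N M) u)).trans hu
      map_zero' := by
        have : ρ 0 = 0 := by ext m; simp [ρ]
        rw [this]
        exact (congrArg (pairing θ) (LinearMap.congr_fun
          (LinearMap.rTensor_zero (P := M) N) u)).trans (map_zero _)
      map_add' := fun f f' => by
        have : ρ (f + f') = ρ f + ρ f' := by ext m; simp [ρ, LinearMap.rTensor_add]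
        rw [this, ← map_add]
        exact congrArg (pairing θ) (LinearMap.congr_fun (LinearMap.rTensor_add N (ρ f) (ρ f')) u)
      map_mul' := fun f f' => by
        have : ρ (f * f') = ρ f ∘ₗ ρ f' := by
          ext m; simp [ρ, Module.End.mul_eq_comp, LinearMap.rTensor_comp]
        rw [this, ← pairing_outerMap θ (hρ f) hu]
        exact congrArg (pairing θ) (LinearMap.congr_fun (LinearMap.rTensor_comp N (ρ f) (ρ f')) u) }
  exact finrank_eq_one_of_end_hom (χ.comp ψ)

/-- If `M` is the bimodule `A` with left action twisted by `τ`, and `M` is invertible, then `τ` is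
bijective. -/
theorem bijective_of_invertible (θ : tensor M N ≅ regular k A) {τ : A →+* A} (g : A ≃ₗ[k] M)
    (hg : ∀ a b v : A, (a ⊗ₜ[k] op b : Env k A) • g v = g (τ a * v * b))
    (θ' : tensor N M ≅ regular k A) : Function.Bijective τ := by
  -- the right linear bijection `n ↦ [g 1 ⊗ n]` from `N` to `A`
  let l : N →+ A := (pairing θ).comp (TensorProduct.mk k M N (g 1)).toAddMonoidHom
  have hl : ∀ n, l n = pairing θ (outerTmul M N (g 1) n) := fun _ => rfl
  have hgv : ∀ v, ((1 : A) ⊗ₜ[k] op v : Env k A) • g 1 = g v := fun v => by simp [hg]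
  have hga : ∀ a, (a ⊗ₜ[k] (1 : Aᵐᵒᵖ) : Env k A) • g 1 = g (τ a) := fun a => by
    rw [← op_one, hg]; simp
  have hl₁ : ∀ m n, pairing θ (outerTmul M N m n) =
      l (((g.symm m) ⊗ₜ[k] (1 : Aᵐᵒᵖ) : Env k A) • n) := by
    intro m n
    rw [hl, ← pairing_balanced, hgv, g.apply_symm_apply]
  have hl₂ : ∀ n (a b : A), l ((τ a ⊗ₜ[k] op b : Env k A) • n) = a * l n * b := by
    intro n a b
    have e : (τ a ⊗ₜ[k] op b : Env k A) = (τ a ⊗ₜ[k] (1 : Aᵐᵒᵖ)) * ((1 : A) ⊗ₜ[k] op b) := by simp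
    rw [e, mul_smul, hl, ← pairing_balanced, hgv, hl, ← pairing_smul, smul_outerTmul, hga]
  have hlb : ∀ n (b : A), l (((1 : A) ⊗ₜ[k] op b : Env k A) • n) = l n * b := fun n b => by
    simpa using hl₂ n 1 b
  have hls : Function.Surjective l := by
    intro a
    obtain ⟨x, rfl⟩ := pairing_surjective θ a
    induction x using OuterTensor.induction_on with
    | zero => exact ⟨0, by simp⟩
    | add x y hx hy =>
      obtain ⟨n, hn⟩ := hx
      obtain ⟨n', hn'⟩ := hy
      exact ⟨n + n', by rw [map_add, map_add, hn, hn']⟩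
    | tmul m n => exact ⟨_, (hl₁ m n).symm⟩
  have hli : ∀ n, l n = 0 → n = 0 := by
    intro n hn
    let f : OuterTensor M N →+ N := (TensorProduct.lift
      ((Algebra.lsmul k k N).toLinearMap ∘ₗ
        (Algebra.TensorProduct.includeLeft : A →ₐ[k] Env k A).toLinearMap ∘ₗ
          g.symm.toLinearMap)).toAddMonoidHom
    have hf : ∀ m n, f (outerTmul M N m n) = ((g.symm m) ⊗ₜ[k] (1 : Aᵐᵒᵖ) : Env k A) • n :=
      fun _ _ => rfl
    have := eq_zero_of_mem_balancing f (fun m a n => by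
      rw [hf, hf, ← mul_smul]
      congr 1
      rw [Algebra.TensorProduct.tmul_mul_tmul, mul_one]
      congr 1
      rw [LinearEquiv.symm_apply_eq, ← g.apply_symm_apply m, hg]
      simp) ((pairing_eq_zero θ).1 ((hl n).symm.trans hn))
    rw [hf, g.symm_apply_apply] at this
    exact (one_smul (Env k A) n).symm.trans this
  obtain ⟨n₁, hn₁⟩ := hls 1
  -- the left action on `N` is twisted by `κ`, which is a left inverse of `τ`
  let κ : A → A := fun a => l ((a ⊗ₜ[k] (1 : Aᵐᵒᵖ) : Env k A) • n₁)
  have hκ : ∀ a, (a ⊗ₜ[k] (1 : Aᵐᵒᵖ) : Env k A) • n₁ = ((1 : A) ⊗ₜ[k] op (κ a) : Env k A) • n₁ := by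
    intro a
    rw [← sub_eq_zero]
    apply hli
    rw [map_sub, hlb, hn₁, one_mul, sub_self]
  have hκτ : ∀ a, κ (τ a) = a := by
    intro a
    have := hl₂ n₁ a 1
    simpa [hn₁] using this
  -- the elements `n ⊗ g v` are determined by `c = [n₁ ⊗ g 1]`
  set c := pairing θ' (outerTmul N M n₁ (g 1)) with hc
  have hcv : ∀ v, pairing θ' (outerTmul N M n₁ (g v)) = c * v := by
    intro v
    have := pairing_smul θ' 1 v (outerTmul N M n₁ (g 1))
    rw [smul_outerTmul, hgv, one_mul] at this
    rw [← this]
    congr 2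
    exact (one_smul (Env k A) n₁).symm
  have hcs : ∃ v, c * v = 1 := by
    obtain ⟨x, hx⟩ := pairing_surjective θ' 1
    rw [← hx]
    clear hx
    induction x using OuterTensor.induction_on with
    | zero => exact ⟨0, by simp⟩
    | add x y hx hy =>
      obtain ⟨v, hv⟩ := hx
      obtain ⟨w, hw⟩ := hy
      exact ⟨v + w, by rw [mul_add, map_add, hv, hw]⟩
    | tmul n m =>
      refine ⟨τ (l n) * g.symm m, ?_⟩
      have e : n = ((1 : A) ⊗ₜ[k] op (l n) : Env k A) • n₁ := by
        rw [← sub_eq_zero]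
        apply hli
        rw [map_sub, hlb, hn₁, one_mul, sub_self]
      conv_rhs => rw [e, pairing_balanced, ← g.apply_symm_apply m, ← op_one, hg]
      rw [hcv, mul_one]
  obtain ⟨v, hv⟩ := hcs
  -- since `a c` depends only on `κ a`, and `c` has a right inverse, `κ` is injective
  have hκ0 : ∀ a b, κ a = κ b → a = b := by
    intro a b hab
    have key : ∀ a, a * c = pairing θ' (outerTmul N M
        (((1 : A) ⊗ₜ[k] op (κ a) : Env k A) • n₁) (g 1)) := by
      intro a
      have := pairing_smul θ' a 1 (outerTmul N M n₁ (g 1))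
      rw [mul_one, smul_outerTmul, op_one, hκ] at this
      rw [← hc] at this
      rw [← this]
      congr 2
      exact (one_smul (Env k A) (g 1))
    have e : a * c = b * c := by rw [key, key, hab]
    have := congrArg (· * v) e
    simpa [mul_assoc, hv] using this
  exact ⟨fun a b h => by rw [← hκτ a, h, hκτ], fun a => ⟨κ a, hκ0 _ _ (by rw [hκτ])⟩⟩

/-- The isomorphism `A^σ ⊗_A A^τ ≅ A` for `σ τ = 1`, given by `x ⊗ y ↦ x σ(y)`. -/
theorem tensor_iso_of_iso_twist {σ τ : A →ₐ[k] A} (hστ : ∀ a, σ (τ a) = a)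
    (α : M ≅ twist σ) (β : N ≅ twist τ) : Nonempty (tensor M N ≅ regular k A) := by
  let α' : M →+ A := (twistLin σ).symm.toLinearMap.toAddMonoidHom.comp α.hom.hom.toAddMonoidHom
  let β' : N →+ A := (twistLin τ).symm.toLinearMap.toAddMonoidHom.comp β.hom.hom.toAddMonoidHom
  have hα : ∀ (a b : A) m, α' ((a ⊗ₜ[k] op b : Env k A) • m) = a * α' m * σ b := fun a b m =>
    (twistLin σ).injective ((α.hom.hom.map_smul (a ⊗ₜ[k] op b : Env k A) m).trans
      (smul_twistLin σ a b (α' m)))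
  have hβ : ∀ (a b : A) n, β' ((a ⊗ₜ[k] op b : Env k A) • n) = a * β' n * τ b := fun a b n =>
    (twistLin τ).injective ((β.hom.hom.map_smul (a ⊗ₜ[k] op b : Env k A) n).trans
      (smul_twistLin τ a b (β' n)))
  have hαb : Function.Bijective α' := (twistLin σ).symm.bijective.comp
    ((ConcreteCategory.isIso_iff_bijective α.hom).1 inferInstance)
  have hβb : Function.Bijective β' := (twistLin τ).symm.bijective.comp
    ((ConcreteCategory.isIso_iff_bijective β.hom).1 inferInstance)
  have hαk : ∀ (c : k) m, α' (c • m) = c • α' m := fun c m => by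
    rw [← algebraMap_smul (Env k A) c m, Algebra.TensorProduct.algebraMap_apply, ← op_one, hα]
    simp [Algebra.smul_def]
  have hβk : ∀ (c : k) n, β' (c • n) = c • β' n := fun c n => by
    rw [← algebraMap_smul (Env k A) c n, Algebra.TensorProduct.algebraMap_apply, ← op_one, hβ]
    simp [Algebra.smul_def]
  let f₀ : OuterTensor M N →+ A := (TensorProduct.lift (LinearMap.mk₂ k
    (fun m n => α' m * σ (β' n))
    (fun m m' n => by rw [map_add, add_mul]) (fun c m n => by rw [hαk, smul_mul_assoc])
    (fun m n n' => by rw [map_add, map_add, mul_add])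
    (fun c m n => by rw [hβk, map_smul, mul_smul_comm]))).toAddMonoidHom
  have hf₀ : ∀ m n, f₀ (outerTmul M N m n) = α' m * σ (β' n) := fun _ _ => rfl
  let f : OuterTensor M N →ₗ[Env k A] twist (AlgHom.id k A) :=
    homToTwist (AlgHom.id k A) f₀ (fun a b x => by
      induction x using OuterTensor.induction_on with
      | zero => simp
      | add x y hx hy => rw [smul_add, map_add, hx, hy, map_add, mul_add, add_mul]
      | tmul m n =>
        rw [smul_outerTmul, hf₀, hf₀, ← op_one, hα, hβ]
        simp [mul_assoc, hστ])
  have hker : balancing M N ≤ LinearMap.ker f := by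
    intro x hx
    refine (congrArg (twistLin (AlgHom.id k A))
      (eq_zero_of_mem_balancing f₀ (fun m a n => ?_) hx)).trans (map_zero _)
    rw [hf₀, hf₀, ← op_one, hα, hβ]
    simp [mul_assoc]
  let F : tensor M N →ₗ[Env k A] twist (AlgHom.id k A) := (balancing M N).liftQ f hker
  have hF : ∀ x, F (toTensor M N x) = twistLin (AlgHom.id k A) (f₀ x) :=
    fun x => (balancing M N).liftQ_apply f x
  obtain ⟨n₁, hn₁⟩ := hβb.2 1
  let s : A →+ tensor M N :=
    ((toTensor M N).toAddMonoidHom.comp ((TensorProduct.mk k M N).flip n₁).toAddMonoidHom).comp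
      (AddEquiv.ofBijective α' hαb).symm.toAddMonoidHom
  have hs : ∀ z, s z = toTensor M N (outerTmul M N ((AddEquiv.ofBijective α' hαb).symm z) n₁) :=
    fun _ => rfl
  have hsF : ∀ x, s (f₀ x) = toTensor M N x := by
    intro x
    induction x using OuterTensor.induction_on with
    | zero => simp
    | add x y hx hy => rw [map_add, map_add, map_add, hx, hy]
    | tmul m n =>
      have e₁ : n = ((β' n ⊗ₜ[k] (1 : Aᵐᵒᵖ) : Env k A)) • n₁ := hβb.1 (by
        rw [← op_one, hβ, hn₁]; simp)
      have e₂ : (AddEquiv.ofBijective α' hαb).symm (α' m * σ (β' n)) =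
          ((1 : A) ⊗ₜ[k] op (β' n) : Env k A) • m := hαb.1 (by
        rw [hα, one_mul]
        exact (AddEquiv.ofBijective α' hαb).apply_symm_apply _)
      rw [hf₀, hs, e₂, toTensor_balanced, ← e₁]
  have hFb : Function.Bijective F := by
    refine ⟨fun x y hxy => ?_, fun z => ?_⟩
    · obtain ⟨x, rfl⟩ := toTensor_surjective x
      obtain ⟨y, rfl⟩ := toTensor_surjective y
      rw [hF, hF] at hxy
      rw [← hsF, ← hsF, (twistLin (AlgHom.id k A)).injective hxy]
    · obtain ⟨z, rfl⟩ := (twistLin (AlgHom.id k A)).surjective z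
      obtain ⟨m, rfl⟩ := hαb.2 z
      exact ⟨toTensor M N (outerTmul M N m n₁), by rw [hF, hf₀, hn₁, map_one, mul_one]⟩
  exact ⟨(LinearEquiv.ofBijective F hFb).toModuleIso⟩

/-- The bimodules isomorphic to `A^σ`, with `σ` an automorphism, are invertible. -/
theorem isInvertibleBimod_of_iso_twist (σ : A ≃ₐ[k] A) (α : M ≅ twist (σ : A →ₐ[k] A)) :
    IsInvertibleBimod M :=
  ⟨twist (σ.symm : A →ₐ[k] A),
    tensor_iso_of_iso_twist (fun a => σ.apply_symm_apply a) α (Iso.refl _),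
    tensor_iso_of_iso_twist (fun a => σ.symm_apply_apply a) (Iso.refl _) α⟩

end TensorBimodules

/-! ### Extensions of a compact module by free modules -/

section FreeCover

open Abelian
open scoped ModuleCat

variable {k H : Type u} [Field k] [Ring H] [Algebra k H]

/-- The free right module on a set. -/
def freeRight (H B : Type u) [Ring H] : ModuleCat.{u} Hᵐᵒᵖ := ModuleCat.of Hᵐᵒᵖ (B →₀ H)

/-- The inclusion of a summand of the free module. -/
def freeIncl {B : Type u} (b : B) : ModuleCat.of Hᵐᵒᵖ H ⟶ freeRight H B :=
  ModuleCat.ofHom (Y := freeRight H B) (Finsupp.lsingle b : H →ₗ[Hᵐᵒᵖ] B →₀ H)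

/-- The projection to a summand of the free module. -/
def freeProj {B : Type u} (b : B) : freeRight H B ⟶ ModuleCat.of Hᵐᵒᵖ H :=
  ModuleCat.ofHom (X := freeRight H B) (Finsupp.lapply b : (B →₀ H) →ₗ[Hᵐᵒᵖ] H)

lemma freeIncl_comp_freeProj {B : Type u} (b : B) :
    freeIncl b ≫ freeProj b = 𝟙 (ModuleCat.of Hᵐᵒᵖ H) :=
  ModuleCat.hom_ext (LinearMap.ext fun _ => Finsupp.single_eq_same)

lemma freeIncl_comp_freeProj_of_ne {B : Type u} {b c : B} (h : b ≠ c) :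
    freeIncl b ≫ freeProj c = (0 : ModuleCat.of Hᵐᵒᵖ H ⟶ ModuleCat.of Hᵐᵒᵖ H) :=
  ModuleCat.hom_ext (LinearMap.ext fun _ => Finsupp.single_eq_of_ne h.symm)

instance (B : Type u) : Projective (freeRight H B) := by
  let e : H ≃ₗ[Hᵐᵒᵖ] Hᵐᵒᵖ :=
    { opAddEquiv with
      map_smul' := fun a x => by
        obtain ⟨h, rfl⟩ := op_surjective a
        rfl }
  have : Module.Projective Hᵐᵒᵖ (B →₀ H) :=
    Module.Projective.of_equiv (Finsupp.mapRange.linearEquiv e.symm)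
  exact (IsProjective.iff_projective (R := Hᵐᵒᵖ) (B →₀ H)).1 this

lemma IsExtCompact.exists_eq_sum_freeIncl {T : ModuleCat.{u} Hᵐᵒᵖ} (hT : IsExtCompact T)
    {B : Type u} {n : ℕ} (x : Ext.{u} T (freeRight H B) n) :
    ∃ s : Finset B, x = ∑ b ∈ s,
      (x.comp (Ext.mk₀ (freeProj b)) (add_zero n)).comp (Ext.mk₀ (freeIncl b)) (add_zero n) :=
  hT.exists_eq_sum freeIncl freeProj freeIncl_comp_freeProj
    (fun _ _ h => freeIncl_comp_freeProj_of_ne h) (fun w => by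
      induction w using Finsupp.induction_linear with
      | zero => exact Submodule.zero_mem _
      | add f g hf hg => exact Submodule.add_mem _ hf hg
      | single b x => exact Submodule.mem_iSup_of_mem b ⟨x, rfl⟩) x

lemma IsExtCompact.ext_freeRight_eq_zero {T : ModuleCat.{u} Hᵐᵒᵖ} (hT : IsExtCompact T) {n : ℕ}
    (h : ∀ x : Ext.{u} T (ModuleCat.of Hᵐᵒᵖ H) n, x = 0) {B : Type u}
    (x : Ext.{u} T (freeRight H B) n) : x = 0 := by
  obtain ⟨s, hs⟩ := hT.exists_eq_sum_freeIncl x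
  rw [hs]
  exact Finset.sum_eq_zero fun b _ => by rw [h (x.comp _ _), Ext.zero_comp]

/-- The homomorphism `x ↦ n x` from `H` to a right module. -/
def orbit {N : ModuleCat.{u} Hᵐᵒᵖ} (n : N) : ModuleCat.of Hᵐᵒᵖ H ⟶ N :=
  ModuleCat.ofHom
    { toFun := fun x => op x • n
      map_add' := fun x y => by rw [MulOpposite.op_add, add_smul]
      map_smul' := fun a x => by
        obtain ⟨h, rfl⟩ := op_surjective a
        rw [op_smul_eq_mul, op_mul, mul_smul]
        rfl }

lemma orbit_apply {N : ModuleCat.{u} Hᵐᵒᵖ} (n : N) (x : H) : (orbit n).hom x = op x • n := rfl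

lemma orbit_comp {N N' : ModuleCat.{u} Hᵐᵒᵖ} (n : N) (g : N ⟶ N') :
    orbit n ≫ g = orbit (g.hom n) :=
  ModuleCat.hom_ext (LinearMap.ext fun x => g.hom.map_smul (op x) n)

/-- The canonical map from the free module on `N` onto `N`. -/
def coverMap (N : ModuleCat.{u} Hᵐᵒᵖ) : freeRight H N →ₗ[Hᵐᵒᵖ] N :=
  (Finsupp.lsum ℕ fun n => (orbit n).hom : (N →₀ H) →ₗ[Hᵐᵒᵖ] N)

/-- The element `x` in the summand of index `b`. -/
def freeSingle {B : Type u} (b : B) (x : H) : freeRight H B := (Finsupp.single b x : B →₀ H)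

lemma coverMap_single (N : ModuleCat.{u} Hᵐᵒᵖ) (n : N) (x : H) :
    coverMap N (freeSingle n x) = op x • n :=
  (Finsupp.lsum_single _ _ _ _).trans (orbit_apply n x)

lemma coverMap_surjective (N : ModuleCat.{u} Hᵐᵒᵖ) : Function.Surjective (coverMap N) := fun n =>
  ⟨freeSingle n 1, by rw [coverMap_single, op_one, one_smul]⟩

/-- The presentation `0 → ΩN → F → N → 0` with `F` free. -/
abbrev presentation (N : ModuleCat.{u} Hᵐᵒᵖ) : ShortComplex (ModuleCat.{u} Hᵐᵒᵖ) :=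
  (coverMap N).shortComplexKer

lemma presentation_shortExact (N : ModuleCat.{u} Hᵐᵒᵖ) : (presentation N).ShortExact :=
  LinearMap.shortExact_shortComplexKer (coverMap_surjective N)

/-- A compact module of finite projective dimension has projective dimension at most `d` as soon as
`Ext^j(T, H) = 0` for `j > d`. -/
lemma IsExtCompact.ext_eq_zero {T : ModuleCat.{u} Hᵐᵒᵖ} (hT : IsExtCompact T) {n d : ℕ}
    (hn : HasProjectiveDimensionLT T n)
    (h : ∀ j, d < j → ∀ x : Ext.{u} T (ModuleCat.of Hᵐᵒᵖ H) j, x = 0) (j : ℕ) (hj : d < j)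
    (N : ModuleCat.{u} Hᵐᵒᵖ) (x : Ext.{u} T N j) : x = 0 := by
  suffices ∀ m j, d < j → n ≤ j + m → ∀ (N : ModuleCat.{u} Hᵐᵒᵖ) (x : Ext.{u} T N j), x = 0 from
    this n j hj (by lia) N x
  intro m
  induction m with
  | zero => exact fun j _ hnj N x => x.eq_zero_of_hasProjectiveDimensionLT n hnj
  | succ m ih =>
    intro j hj hnj N x
    obtain ⟨y, rfl⟩ := Ext.covariant_sequence_exact₃ T (presentation_shortExact N) x rfl
      (ih (j + 1) (by lia) (by lia) _ _)
    rw [hT.ext_freeRight_eq_zero (h j hj) y, Ext.zero_comp]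

end FreeCover

/-! ### The pairing between a module and the top extension group -/

section Pairing

open Abelian
open scoped ModuleCat

variable (k : Type u) {H : Type u} [Field k] [Ring H] [Algebra k H] (T : ModuleCat.{u} Hᵐᵒᵖ) (d : ℕ)

lemma orbit_add {N : ModuleCat.{u} Hᵐᵒᵖ} (n n' : N) : orbit (n + n') = orbit n + orbit n' :=
  ModuleCat.hom_ext (LinearMap.ext fun x => smul_add (op x) n n')

variable {k} in
lemma orbit_smul {N : ModuleCat.{u} Hᵐᵒᵖ} (c : k) (n : N) : orbit (c • n) = c • orbit n :=
  ModuleCat.hom_ext (LinearMap.ext fun x => smul_comm (op x) c n)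

/-- The bilinear map `(n, e) ↦ n e` from `N × Ext^d(T, H)` to `Ext^d(T, N)`. -/
def extPairing (N : ModuleCat.{u} Hᵐᵒᵖ) :
    N →ₗ[k] Ext.{u} T (ModuleCat.of Hᵐᵒᵖ H) d →ₗ[k] Ext.{u} T N d :=
  LinearMap.mk₂ k (fun n e => e.comp (Ext.mk₀ (orbit n)) (add_zero d))
    (fun n n' e => by rw [orbit_add, Ext.mk₀_add, Ext.comp_add])
    (fun c n e => by rw [orbit_smul, Ext.mk₀_smul, Ext.comp_smul])
    (fun n e e' => by rw [Ext.add_comp]) (fun c n e => by rw [Ext.smul_comp])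

variable {T d}

lemma extPairing_apply {N : ModuleCat.{u} Hᵐᵒᵖ} (n : N) (e : Ext.{u} T (ModuleCat.of Hᵐᵒᵖ H) d) :
    extPairing k T d N n e = e.comp (Ext.mk₀ (orbit n)) (add_zero d) := rfl

lemma extPairing_comp {N N' : ModuleCat.{u} Hᵐᵒᵖ} (n : N)
    (e : Ext.{u} T (ModuleCat.of Hᵐᵒᵖ H) d) (g : N ⟶ N') :
    (extPairing k T d N n e).comp (Ext.mk₀ g) (add_zero d) = extPairing k T d N' (g.hom n) e := by
  rw [extPairing_apply, extPairing_apply, Ext.comp_assoc_of_third_deg_zero, Ext.mk₀_comp_mk₀,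
    orbit_comp]

lemma leftMul_comp_orbit {N : ModuleCat.{u} Hᵐᵒᵖ} (h : H) (n : N) :
    leftMul h ≫ orbit n = orbit (op h • n) := by
  refine ModuleCat.hom_ext (LinearMap.ext fun x => ?_)
  change op (h * x) • n = op x • op h • n
  rw [op_mul, mul_smul]

lemma extPairing_smul {N : ModuleCat.{u} Hᵐᵒᵖ} (h : H) (n : N)
    (e : Ext.{u} T (ModuleCat.of Hᵐᵒᵖ H) d) :
    extPairing k T d N (op h • n) e =
      extPairing k T d N n (e.comp (Ext.mk₀ (leftMul h)) (add_zero d)) := by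
  rw [extPairing_apply, extPairing_apply, Ext.comp_assoc_of_third_deg_zero, Ext.mk₀_comp_mk₀,
    leftMul_comp_orbit]

/-- The linear map `N ⊗ Ext^d(T, H) → Ext^d(T, N)`. -/
abbrev extPairingLift (N : ModuleCat.{u} Hᵐᵒᵖ) :
    N ⊗[k] Ext.{u} T (ModuleCat.of Hᵐᵒᵖ H) d →ₗ[k] Ext.{u} T N d :=
  TensorProduct.lift (extPairing k T d N)

lemma smul_freeSingle {B : Type u} (b : B) (h x : H) :
    op h • freeSingle b x = freeSingle b (x * h) :=
  Finsupp.smul_single _ _ _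

lemma freeIncl_eq_orbit {B : Type u} (b : B) :
    freeIncl b = orbit (freeSingle b (1 : H)) := by
  refine ModuleCat.hom_ext (LinearMap.ext fun x => ?_)
  change freeSingle b x = op x • freeSingle b (1 : H)
  rw [smul_freeSingle, one_mul]

lemma orbit_comp_freeProj {B : Type u} (f : freeRight H B) (b : B) :
    orbit f ≫ freeProj b = leftMul ((freeProj b).hom f) := by
  rw [orbit_comp]
  rfl

lemma extPairingLift_comp {N N' : ModuleCat.{u} Hᵐᵒᵖ} (g : N ⟶ N')
    (t : N ⊗[k] Ext.{u} T (ModuleCat.of Hᵐᵒᵖ H) d) :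
    (extPairingLift k N t).comp (Ext.mk₀ g) (add_zero d) =
      extPairingLift k N' ((g.hom.restrictScalars k).rTensor _ t) := by
  induction t with
  | zero => rw [map_zero, map_zero, map_zero, Ext.zero_comp]
  | add x y hx hy => rw [map_add, map_add, map_add, Ext.add_comp, hx, hy]
  | tmul n e => exact extPairing_comp k n e g

lemma extPairingLift_surjective (hT : IsExtCompact T)
    (hd : ∀ (N : ModuleCat.{u} Hᵐᵒᵖ) (x : Ext.{u} T N (d + 1)), x = 0) (N : ModuleCat.{u} Hᵐᵒᵖ) :
    Function.Surjective (extPairingLift k (T := T) (d := d) N) := by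
  intro x
  obtain ⟨y, rfl⟩ := Ext.covariant_sequence_exact₃ T (presentation_shortExact N) x rfl (hd _ _)
  obtain ⟨s, hs⟩ := hT.exists_eq_sum_freeIncl y
  refine ⟨∑ b ∈ s, b ⊗ₜ y.comp (Ext.mk₀ (freeProj b)) (add_zero d), ?_⟩
  conv_rhs => rw [hs, sum_comp_mk₀]
  rw [map_sum]
  refine Finset.sum_congr rfl fun b _ => ?_
  rw [lift.tmul, freeIncl_eq_orbit, ← extPairing_apply k (N := freeRight H N)]
  refine Eq.trans ?_ (extPairing_comp k _ _ _).symm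
  congr 2
  refine Eq.trans ?_ (coverMap_single N b 1).symm
  rw [op_one, one_smul]

/-- The relation between the coefficients of an element of the kernel of the pairing with a free
module. -/
lemma map_eq_zero_of_extPairingLift_free {X : Type*} [AddCommGroup X] [Module k X] {B : Type u}
    (φ : freeRight H B ⊗[k] Ext.{u} T (ModuleCat.of Hᵐᵒᵖ H) d →ₗ[k] X)
    (hφ : ∀ (h : H) (n : freeRight H B) (e : Ext.{u} T (ModuleCat.of Hᵐᵒᵖ H) d),
      φ ((op h • n) ⊗ₜ e) = φ (n ⊗ₜ e.comp (Ext.mk₀ (leftMul h)) (add_zero d)))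
    (t : freeRight H B ⊗[k] Ext.{u} T (ModuleCat.of Hᵐᵒᵖ H) d)
    (ht : extPairingLift k (T := T) (d := d) (freeRight H B) t = 0) : φ t = 0 := by
  classical
  suffices ∃ s : Finset B, ∀ s', s ⊆ s' → φ t = ∑ b ∈ s', φ (freeSingle b 1 ⊗ₜ
      (extPairingLift k (freeRight H B) t).comp (Ext.mk₀ (freeProj b)) (add_zero d)) by
    obtain ⟨s, hs⟩ := this
    rw [hs s subset_rfl]
    exact Finset.sum_eq_zero fun b _ => by rw [ht, Ext.zero_comp, tmul_zero, map_zero]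
  clear ht
  induction t with
  | zero => exact ⟨∅, fun s' _ => by simp⟩
  | add x y hx hy =>
    obtain ⟨s, hs⟩ := hx
    obtain ⟨s₂, hs₂⟩ := hy
    refine ⟨s ∪ s₂, fun s' h => ?_⟩
    rw [map_add, hs s' (Finset.union_subset_left h), hs₂ s' (Finset.union_subset_right h),
      ← Finset.sum_add_distrib]
    refine Finset.sum_congr rfl fun b _ => ?_
    rw [map_add, Ext.add_comp, TensorProduct.tmul_add, map_add]
  | tmul f e =>
    let f' : B →₀ H := f
    refine ⟨f'.support, fun s' h => ?_⟩
    have hf : f = ∑ b ∈ s', freeSingle b (f' b) := (Finsupp.sum_of_support_subset f' h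
      (fun b x => (Finsupp.single b x : B →₀ H)) (fun _ _ => Finsupp.single_zero _) ▸
        (Finsupp.sum_single f').symm)
    have e₁ : φ (f ⊗ₜ e) = ∑ b ∈ s', φ (freeSingle b (f' b) ⊗ₜ e) := by
      conv_lhs => rw [hf, TensorProduct.sum_tmul, map_sum]
    rw [e₁]
    refine Finset.sum_congr rfl fun b _ => ?_
    rw [lift.tmul, extPairing_apply, Ext.comp_assoc_of_third_deg_zero, Ext.mk₀_comp_mk₀,
      orbit_comp_freeProj, ← hφ, smul_freeSingle, one_mul]
    rfl

/-- The kernel of the pairing `N ⊗ Ext^d(T, H) → Ext^d(T, N)` is contained in the kernel of every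
balanced map. -/
lemma map_eq_zero_of_extPairingLift (hT : IsExtCompact T)
    (hd : ∀ (N : ModuleCat.{u} Hᵐᵒᵖ) (x : Ext.{u} T N (d + 1)), x = 0)
    {X : Type*} [AddCommGroup X] [Module k X] {N : ModuleCat.{u} Hᵐᵒᵖ}
    (φ : N ⊗[k] Ext.{u} T (ModuleCat.of Hᵐᵒᵖ H) d →ₗ[k] X)
    (hφ : ∀ (h : H) (n : N) (e : Ext.{u} T (ModuleCat.of Hᵐᵒᵖ H) d),
      φ ((op h • n) ⊗ₜ e) = φ (n ⊗ₜ e.comp (Ext.mk₀ (leftMul h)) (add_zero d)))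
    (t : N ⊗[k] Ext.{u} T (ModuleCat.of Hᵐᵒᵖ H) d)
    (ht : extPairingLift k (T := T) (d := d) N t = 0) : φ t = 0 := by
  let p : freeRight H N →ₗ[k] N := (coverMap N).restrictScalars k
  have hp : Function.Surjective p := coverMap_surjective N
  obtain ⟨t', rfl⟩ := LinearMap.rTensor_surjective
    (Ext.{u} T (ModuleCat.of Hᵐᵒᵖ H) d) hp t
  have e₁ : (extPairingLift k (freeRight H N) t').comp (Ext.mk₀ (presentation N).g)
      (add_zero d) = 0 := (extPairingLift_comp k (presentation N).g t').trans ht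
  obtain ⟨z, hz⟩ := Ext.covariant_sequence_exact₂ T (presentation_shortExact N) _ e₁
  obtain ⟨w, rfl⟩ := extPairingLift_surjective k hT hd (presentation N).X₁ z
  let i : (presentation N).X₁ →ₗ[k] freeRight H N := (presentation N).f.hom.restrictScalars k
  have e₂ : extPairingLift k (freeRight H N) (t' - i.rTensor _ w) = 0 := by
    rw [map_sub, sub_eq_zero, ← hz]
    exact extPairingLift_comp k (presentation N).f w
  have e₃ := map_eq_zero_of_extPairingLift_free k (φ ∘ₗ p.rTensor _) (fun h n e => by
    have : p (op h • n) = op h • p n := (coverMap N).map_smul (op h) n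
    simp only [LinearMap.comp_apply, LinearMap.rTensor_tmul, this, hφ]) _ e₂
  have e₄ : p ∘ₗ i = 0 := LinearMap.ext fun x => LinearMap.mem_ker.1 x.2
  rw [map_sub, sub_eq_zero, LinearMap.comp_apply, LinearMap.comp_apply,
    ← LinearMap.comp_apply (p.rTensor _) (i.rTensor _), ← LinearMap.rTensor_comp, e₄] at e₃
  rw [e₃]
  simp

end Pairing

/-! ### Serre duality -/

section Serre

open Abelian Coalgebra HopfAlgebra
open scoped ModuleCat

variable {k H : Type u} [Field k] [Ring H] [HopfAlgebra k H]

/-- The inverse of the antipode, as a homomorphism from the opposite algebra. -/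
def antipodeInv (hS : Function.Bijective (antipode k (A := H))) : Hᵐᵒᵖ →ₐ[k] H :=
  (AlgEquiv.opComm (AlgEquiv.ofBijective (antipodeOp k H)
    (hS.comp (opLinearEquiv k).symm.bijective)).symm).toAlgHom

variable (hS : Function.Bijective (antipode k (A := H)))

lemma antipode_antipodeInv (h : H) : antipode k (antipodeInv hS (op h)) = h :=
  (AlgEquiv.ofBijective (antipodeOp k H)
    (hS.comp (opLinearEquiv k).symm.bijective)).apply_symm_apply h

lemma antipodeInv_antipode (h : H) : antipodeInv hS (op (antipode k h)) = h :=
  hS.1 (antipode_antipodeInv hS _)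

lemma sum_mul_antipodeInv (h : H) : ∑ i ∈ (ℛ k h).index,
    (ℛ k h).right i * antipodeInv hS (op ((ℛ k h).left i)) = algebraMap k H (counit h) := by
  apply hS.1
  rw [map_sum, ← sum_mul_antipode_eq_algebraMap_counit (ℛ k h)]
  simp only [antipode_mul_antidistrib, antipode_antipodeInv]
  rw [sum_mul_antipode_eq_algebraMap_counit (ℛ k h), Algebra.algebraMap_eq_smul_one, map_smul,
    antipode_one]

lemma smul_id_hom {R : Type u} [Ring R] [Algebra k R] (c : k) (N : ModuleCat.{u} R) (n : N) :
    (c • 𝟙 N : N ⟶ N).hom n = algebraMap k R c • n := rfl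

variable (k) in
/-- The left action of `H` on `Ext^d(T, H)`. -/
def extLeft (T : ModuleCat.{u} Hᵐᵒᵖ) (d : ℕ) :
    H →ₐ[k] Module.End k (Ext.{u} T (ModuleCat.of Hᵐᵒᵖ H) d) where
  toFun h := (Ext.mk₀ (leftMul h)).postcompOfLinear k T (add_zero d)
  map_one' := LinearMap.ext fun x => by
    have : leftMul (1 : H) = 𝟙 _ := ModuleCat.hom_ext (LinearMap.ext fun x => one_mul x)
    change x.comp (Ext.mk₀ (leftMul (1 : H))) (add_zero d) = x
    rw [this, Ext.comp_mk₀_id]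
  map_mul' g h := LinearMap.ext fun x => by
    have : leftMul (g * h) = leftMul h ≫ leftMul g :=
      ModuleCat.hom_ext (LinearMap.ext fun x => mul_assoc g h x)
    change x.comp (Ext.mk₀ (leftMul (g * h))) (add_zero d) =
      (x.comp (Ext.mk₀ (leftMul h)) (add_zero d)).comp (Ext.mk₀ (leftMul g)) (add_zero d)
    rw [this, Ext.comp_assoc_of_third_deg_zero, Ext.mk₀_comp_mk₀]
  map_zero' := LinearMap.ext fun x => by
    have : leftMul (0 : H) = 0 := ModuleCat.hom_ext (LinearMap.ext fun x => zero_mul x)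
    change x.comp (Ext.mk₀ (leftMul (0 : H))) (add_zero d) = 0
    rw [this, Ext.mk₀_zero, Ext.comp_zero]
  map_add' g h := LinearMap.ext fun x => by
    have : leftMul (g + h) = leftMul g + leftMul h :=
      ModuleCat.hom_ext (LinearMap.ext fun x => add_mul g h x)
    change x.comp (Ext.mk₀ (leftMul (g + h))) (add_zero d) = _
    rw [this, Ext.mk₀_add, Ext.comp_add]
    rfl
  commutes' c := LinearMap.ext fun x => by
    change x.comp (Ext.mk₀ (leftMul (algebraMap k H c))) (add_zero d) = c • x
    rw [Ext.smul_eq_comp_mk₀]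
    congr 2
    refine ModuleCat.hom_ext (LinearMap.ext fun x => ?_)
    exact (Algebra.commutes (A := H) c x).trans (smul_id_hom c (ModuleCat.of Hᵐᵒᵖ H) x).symm

/-- The space `Ext^d(k, H)` as a right module, with action `e h = S⁻¹(h) e`. -/
def SerreSpace (_hS : Function.Bijective (antipode k (A := H))) (d : ℕ) : Type u :=
  Ext.{u} (trivialRight k H) (ModuleCat.of Hᵐᵒᵖ H) d

instance (d : ℕ) : AddCommGroup (SerreSpace hS d) :=
  inferInstanceAs (AddCommGroup (Ext.{u} (trivialRight k H) (ModuleCat.of Hᵐᵒᵖ H) d))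

instance (d : ℕ) : Module k (SerreSpace hS d) :=
  inferInstanceAs (Module k (Ext.{u} (trivialRight k H) (ModuleCat.of Hᵐᵒᵖ H) d))

/-- The right action of `H` on `SerreSpace`. -/
def serreAct (d : ℕ) : Hᵐᵒᵖ →ₐ[k] Module.End k (SerreSpace hS d) :=
  (extLeft k (trivialRight k H) d).comp (antipodeInv hS)

instance (d : ℕ) : Module Hᵐᵒᵖ (SerreSpace hS d) :=
  Module.compHom (SerreSpace hS d) (serreAct hS d).toRingHom

lemma serre_smul (d : ℕ) (a : Hᵐᵒᵖ) (v : SerreSpace hS d) :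
    a • v = extLeft k (trivialRight k H) d (antipodeInv hS a) v := rfl

instance (d : ℕ) : IsScalarTower k Hᵐᵒᵖ (SerreSpace hS d) where
  smul_assoc c a v := LinearMap.congr_fun (map_smul (serreAct hS d) c a) v

lemma antipode_smul (d : ℕ) (h : H) (v : SerreSpace hS d) :
    op (antipode k h) • v = extLeft k (trivialRight k H) d h v := by
  rw [serre_smul, antipodeInv_antipode]

lemma sum_extLeft_smul (d : ℕ) (h : H) (v : SerreSpace hS d) : ∑ i ∈ (ℛ k h).index,
    extLeft k (trivialRight k H) d ((ℛ k h).right i) (op ((ℛ k h).left i) • v) =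
      counit (R := k) h • (show Ext.{u} (trivialRight k H) (ModuleCat.of Hᵐᵒᵖ H) d from v) := by
  have e := LinearMap.congr_fun
    (congrArg (extLeft k (trivialRight k H) d) (sum_mul_antipodeInv hS h))
      (show Ext.{u} (trivialRight k H) (ModuleCat.of Hᵐᵒᵖ H) d from v)
  rw [map_sum, LinearMap.sum_apply, AlgHom.commutes] at e
  simp only [map_mul] at e
  exact e

/-- The pairing of a right module with `SerreSpace`. -/
def serrePairing (d : ℕ) (N : ModuleCat.{u} Hᵐᵒᵖ) :
    N ⊗[k] SerreSpace hS d →ₗ[k] Ext.{u} (trivialRight k H) N d :=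
  extPairingLift k N

lemma serrePairing_tensorAct (d : ℕ) (N : ModuleCat.{u} Hᵐᵒᵖ) (h : H)
    (t : N ⊗[k] SerreSpace hS d) :
    serrePairing hS d N (tensorAct k N (SerreSpace hS d) (op h) t) =
      counit (R := k) h • serrePairing hS d N t := by
  induction t with
  | zero => simp
  | add x y hx hy => simp only [map_add, hx, hy, smul_add]
  | tmul n v =>
    have e : ∀ (a : H) (w : SerreSpace hS d), serrePairing hS d N ((op a • n) ⊗ₜ w) =
        extPairing k _ d N n (extLeft k (trivialRight k H) d a w) :=
      fun a w => extPairing_smul k a n _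
    rw [tensorAct_tmul, map_sum]
    refine (Finset.sum_congr rfl fun i _ => e _ _).trans ?_
    rw [← map_sum]
    exact (congrArg (extPairing k _ d N n) (sum_extLeft_smul hS d h v)).trans
      (map_smul (extPairing k _ d N n) _ _)

/-- The linear forms on `Ext^d(k, N)` are the homomorphisms `N ⊗ Ext^d(k, H) → k`. -/
def serreMap (d : ℕ) (N : ModuleCat.{u} Hᵐᵒᵖ) : Module.Dual k (Ext.{u} (trivialRight k H) N d) →ₗ[k]
    ((rtensor k (SerreSpace hS d)).obj N ⟶ trivialRight k H) where
  toFun l := linToHom (isNaturalAction_tensorAct k (SerreSpace hS d))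
    ((trivialLin k H).toLinearMap ∘ₗ l ∘ₗ serrePairing hS d N) (fun a x => by
      obtain ⟨h, rfl⟩ := op_surjective a
      simp only [LinearMap.comp_apply, serrePairing_tensorAct, map_smul]
      exact (map_smul (trivialLin k H) (counit (R := k) h) _).symm)
  map_add' l l' := by
    refine ModuleCat.hom_ext (LinearMap.ext fun x => ?_)
    exact map_add (trivialLin k H) _ _
  map_smul' c l := by
    refine ModuleCat.hom_ext (LinearMap.ext fun x => ?_)
    exact map_smul (trivialLin k H) c _

lemma serreMap_apply (d : ℕ) (N : ModuleCat.{u} Hᵐᵒᵖ)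
    (l : Module.Dual k (Ext.{u} (trivialRight k H) N d)) (x : N ⊗[k] SerreSpace hS d) :
    homToLin (isNaturalAction_tensorAct k (SerreSpace hS d)) (serreMap hS d N l) x =
      trivialLin k H (l (serrePairing hS d N x)) := rfl

lemma serreMap_bijective (hT : IsExtCompact (trivialRight k H)) {d : ℕ}
    (hd : ∀ (N : ModuleCat.{u} Hᵐᵒᵖ) (x : Ext.{u} (trivialRight k H) N (d + 1)), x = 0)
    (N : ModuleCat.{u} Hᵐᵒᵖ) : Function.Bijective (serreMap hS d N) := by
  have hs : Function.Surjective (serrePairing hS d N) := extPairingLift_surjective k hT hd N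
  constructor
  · intro l l' h
    ext y
    obtain ⟨x, rfl⟩ := hs y
    apply (trivialLin k H).injective
    rw [← serreMap_apply, ← serreMap_apply, h]
  · intro f
    let φ : N ⊗[k] SerreSpace hS d →ₗ[k] k := (trivialLin k H).symm.toLinearMap ∘ₗ
      homToLin (isNaturalAction_tensorAct k (SerreSpace hS d)) f
    have hφ : ∀ (h : H) x, φ (tensorAct k N (SerreSpace hS d) (op h) x) =
        counit (R := k) h * φ x := by
      intro h x
      apply (trivialLin k H).injective
      rw [← smul_trivialLin]
      exact homToLin_apply (isNaturalAction_tensorAct k (SerreSpace hS d)) f (op h) x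
    have hb : ∀ (h : H) (n : N) (v : SerreSpace hS d),
        φ ((op h • n) ⊗ₜ v) = φ (n ⊗ₜ (op (antipode k h) • v)) := by
      intro h n v
      have e := LinearMap.congr_fun (sum_convOp_mul_antipode (actRight k N (SerreSpace hS d))
        (actLeft k N (SerreSpace hS d)) (commute_act k N (SerreSpace hS d)) h) (n ⊗ₜ v)
      rw [← actLeft_tmul, ← e, LinearMap.sum_apply, map_sum]
      conv_rhs => rw [← sum_smul_counit (ℛ k h)]
      simp only [map_sum, Finset.op_sum, Finset.sum_smul, TensorProduct.tmul_sum]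
      refine Finset.sum_congr rfl fun i _ => ?_
      refine (hφ _ _).trans ?_
      rw [actRight_tmul, map_smul, MulOpposite.op_smul, smul_assoc]
      exact ((congrArg φ (TensorProduct.tmul_smul (counit (R := k) ((ℛ k h).right i)) n _)).trans
        (map_smul φ _ _)).symm
    have hker : LinearMap.ker (serrePairing hS d N) ≤ LinearMap.ker φ := fun x hx =>
      map_eq_zero_of_extPairingLift k hT hd φ (fun h n e => (hb h n e).trans
        (congrArg (fun w => φ (n ⊗ₜ w)) (antipode_smul hS d h e))) x hx
    refine ⟨(LinearMap.ker (serrePairing hS d N)).liftQ φ hker ∘ₗ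
      ((serrePairing hS d N).quotKerEquivOfSurjective hs).symm.toLinearMap, ?_⟩
    apply homToLin_injective (isNaturalAction_tensorAct k (SerreSpace hS d))
    refine LinearMap.ext fun x => ?_
    rw [serreMap_apply]
    apply (trivialLin k H).symm.injective
    rw [LinearEquiv.symm_apply_apply, LinearMap.comp_apply]
    have : ((serrePairing hS d N).quotKerEquivOfSurjective hs).symm (serrePairing hS d N x) =
        (LinearMap.ker (serrePairing hS d N)).mkQ x := by
      rw [LinearEquiv.symm_apply_eq]
      rfl
    exact (congrArg ((LinearMap.ker (serrePairing hS d N)).liftQ φ hker) this).trans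
      ((LinearMap.ker (serrePairing hS d N)).liftQ_apply φ x)

end Serre

section SerreDuality

open Abelian Coalgebra HopfAlgebra
open scoped ModuleCat

variable {k H : Type u} [Field k] [Ring H] [HopfAlgebra k H]
  (hS : Function.Bijective (antipode k (A := H)))

lemma serrePairing_comp (d : ℕ) {N N' : ModuleCat.{u} Hᵐᵒᵖ} (g : N ⟶ N')
    (t : N ⊗[k] SerreSpace hS d) :
    (serrePairing hS d N t).comp (Ext.mk₀ g) (add_zero d) =
      serrePairing hS d N' ((g.hom.restrictScalars k).rTensor _ t) :=
  extPairingLift_comp k g t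

lemma serreMap_naturality (d : ℕ) {N N' : ModuleCat.{u} Hᵐᵒᵖ} (g : N ⟶ N')
    (l : Module.Dual k (Ext.{u} (trivialRight k H) N' d)) :
    (rtensor k (SerreSpace hS d)).map g ≫ serreMap hS d N' l =
      serreMap hS d N (l ∘ₗ (Ext.mk₀ g).postcompOfLinear k (trivialRight k H) (add_zero d)) := by
  apply homToLin_injective (isNaturalAction_tensorAct k (SerreSpace hS d))
  refine LinearMap.ext fun x => ?_
  exact congrArg (fun y => trivialLin k H (l y)) (serrePairing_comp hS d g x).symm

/-- The first step of the dimension shift in Serre duality. -/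
lemma serre_duality_one (hT : IsExtCompact (trivialRight k H)) {a : ℕ}
    (hd : ∀ (N : ModuleCat.{u} Hᵐᵒᵖ) (x : Ext.{u} (trivialRight k H) N (a + 1 + 1)), x = 0)
    (hv : ∀ x : Ext.{u} (trivialRight k H) (ModuleCat.of Hᵐᵒᵖ H) a, x = 0)
    (N : ModuleCat.{u} Hᵐᵒᵖ) :
    Nonempty (Module.Dual k (Ext.{u} (trivialRight k H) N a) ≃ₗ[k]
      Ext.{u} ((rtensor k (SerreSpace hS (a + 1))).obj N) (trivialRight k H) 1) := by
  let T := trivialRight k H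
  let L : ModuleCat.{u} Hᵐᵒᵖ ⥤ ModuleCat.{u} Hᵐᵒᵖ := rtensor k (SerreSpace hS (a + 1))
  have hP := presentation_shortExact N
  have hLP := hP.map_of_exact L
  let δ : Ext.{u} T N a →ₗ[k] Ext.{u} T (presentation N).X₁ (a + 1) :=
    hP.extClass.postcompOfLinear k T rfl
  let ι : Ext.{u} T (presentation N).X₁ (a + 1) →ₗ[k] Ext.{u} T (presentation N).X₂ (a + 1) :=
    (Ext.mk₀ (presentation N).f).postcompOfLinear k T (add_zero _)
  have hδ : Function.Injective δ := by
    rw [injective_iff_map_eq_zero]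
    intro x hx
    obtain ⟨y, rfl⟩ := Ext.covariant_sequence_exact₃ T hP x rfl hx
    rw [hT.ext_freeRight_eq_zero hv y, Ext.zero_comp]
  have hδι : LinearMap.range δ = LinearMap.ker ι := by
    ext x
    constructor
    · rintro ⟨y, rfl⟩
      change (y.comp hP.extClass rfl).comp (Ext.mk₀ (presentation N).f) (add_zero (a + 1)) = 0
      rw [Ext.comp_assoc_of_third_deg_zero, hP.extClass_comp, Ext.comp_zero]
    · intro hx
      exact Ext.covariant_sequence_exact₁ T hP x hx rfl
  let P := δ.dualMap
  have hPs : Function.Surjective P := LinearMap.dualMap_surjective_of_injective hδ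
  let Q : Module.Dual k (Ext.{u} T (presentation N).X₁ (a + 1)) →ₗ[k] Ext.{u} (L.obj N) T 1 :=
    (hLP.extClass.precompOfLinear k T (add_zero 1)) ∘ₗ
      (Ext.linearEquiv₀ (R := k)).symm.toLinearMap ∘ₗ serreMap hS (a + 1) (presentation N).X₁
  have hQ : ∀ l, Q l = hLP.extClass.comp
      (Ext.mk₀ (serreMap hS (a + 1) (presentation N).X₁ l)) (add_zero 1) := fun _ => rfl
  have hproj : Projective ((presentation N).map L).X₂ :=
    projective_rtensor k (SerreSpace hS (a + 1)) (freeRight H N)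
  -- the target is a quotient of the dual of `Ext^(a+1)` of the kernel of the presentation, and so
  -- is the dual of `Ext^a(k, N)`; it remains to compare the kernels
  have hQs : Function.Surjective Q := by
    intro x
    obtain ⟨y, rfl⟩ := Ext.contravariant_sequence_exact₃ hLP T x
      (Ext.eq_zero_of_projective _) (add_zero 1)
    obtain ⟨f, rfl⟩ := (Ext.mk₀_bijective _ _).2 y
    obtain ⟨l, rfl⟩ := (serreMap_bijective hS hT hd (presentation N).X₁).2 f
    exact ⟨l, rfl⟩
  have hker : LinearMap.ker P = LinearMap.ker Q := by
    ext l
    rw [LinearMap.mem_ker, LinearMap.mem_ker, hQ]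
    constructor
    · intro hl
      have : l ∈ LinearMap.range ι.dualMap := by
        rw [LinearMap.range_dualMap_eq_dualAnnihilator_ker, ← hδι, Submodule.mem_dualAnnihilator]
        rintro _ ⟨y, rfl⟩
        exact LinearMap.congr_fun hl y
      obtain ⟨μ, rfl⟩ := this
      have e := serreMap_naturality hS (a + 1) (presentation N).f μ
      refine (congrArg (fun f => hLP.extClass.comp (Ext.mk₀ f) (add_zero 1)) e.symm).trans ?_
      refine (congrArg (fun z => hLP.extClass.comp z (add_zero 1)) (Ext.mk₀_comp_mk₀
        (L.map (presentation N).f) (serreMap hS (a + 1) (presentation N).X₂ μ)).symm).trans ?_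
      refine (Ext.comp_assoc (a₁₂ := 1) hLP.extClass (Ext.mk₀ (L.map (presentation N).f))
        (Ext.mk₀ (serreMap hS (a + 1) (presentation N).X₂ μ))
        (by lia) (by lia) (by lia)).symm.trans ?_
      exact (congrArg (fun z => z.comp (Ext.mk₀ (serreMap hS (a + 1) (presentation N).X₂ μ))
        (add_zero 1)) hLP.extClass_comp).trans (Ext.zero_comp _ _ _ _ _)
    · intro hl
      obtain ⟨y, hy⟩ := Ext.contravariant_sequence_exact₁ hLP T _ (add_zero 1) hl
      obtain ⟨f, rfl⟩ := (Ext.mk₀_bijective _ _).2 y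
      obtain ⟨μ, rfl⟩ := (serreMap_bijective hS hT hd (presentation N).X₂).2 f
      have hy' : L.map (presentation N).f ≫ serreMap hS (a + 1) (presentation N).X₂ μ =
          serreMap hS (a + 1) (presentation N).X₁ l :=
        (Ext.mk₀_bijective _ _).1 ((Ext.mk₀_comp_mk₀ (L.map (presentation N).f)
          (serreMap hS (a + 1) (presentation N).X₂ μ)).symm.trans hy)
      have e := (serreMap_naturality hS (a + 1) (presentation N).f μ).symm.trans hy'
      rw [← (serreMap_bijective hS hT hd (presentation N).X₁).1 e]
      ext y
      have : ι (δ y) = 0 := LinearMap.mem_ker.1 (hδι ▸ ⟨y, rfl⟩)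
      exact (congrArg μ this).trans (map_zero μ)
  exact ⟨((P.quotKerEquivOfSurjective hPs).symm.trans (Submodule.quotEquivOfEq _ _ hker)).trans
    (Q.quotKerEquivOfSurjective hQs)⟩

/-- Serre duality: `Ext^a(k, N)` and `Ext^i(N ⊗ Ext^d(k, H), k)` are dual to each other when
`a + i = d`. -/
theorem serre_duality (hT : IsExtCompact (trivialRight k H)) {d : ℕ}
    (hd : ∀ (N : ModuleCat.{u} Hᵐᵒᵖ) (x : Ext.{u} (trivialRight k H) N (d + 1)), x = 0)
    (hv : ∀ j, j < d → ∀ x : Ext.{u} (trivialRight k H) (ModuleCat.of Hᵐᵒᵖ H) j, x = 0)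
    (i a : ℕ) (h : a + i = d) (N : ModuleCat.{u} Hᵐᵒᵖ) :
    Nonempty (Module.Dual k (Ext.{u} (trivialRight k H) N a) ≃ₗ[k]
      Ext.{u} ((rtensor k (SerreSpace hS d)).obj N) (trivialRight k H) i) := by
  induction i generalizing a N with
  | zero =>
    obtain rfl : a = d := h
    exact ⟨(LinearEquiv.ofBijective _ (serreMap_bijective hS hT hd N)).trans
      (Ext.linearEquiv₀ (R := k)).symm⟩
  | succ i ih =>
    rcases Nat.eq_zero_or_pos i with rfl | hi
    · subst h
      exact serre_duality_one hS hT hd (hv a (by lia)) N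
    · let T := trivialRight k H
      let L : ModuleCat.{u} Hᵐᵒᵖ ⥤ ModuleCat.{u} Hᵐᵒᵖ := rtensor k (SerreSpace hS d)
      have hP := presentation_shortExact N
      have hLP := hP.map_of_exact L
      have hproj : Projective ((presentation N).map L).X₂ :=
        projective_rtensor k (SerreSpace hS d) (freeRight H N)
      obtain ⟨e⟩ := ih (a + 1) (by lia) (presentation N).X₁
      let δ : Ext.{u} T N a →ₗ[k] Ext.{u} T (presentation N).X₁ (a + 1) :=
        hP.extClass.postcompOfLinear k T rfl
      -- both connecting maps are bijective, because `a + 1 < d` and `0 < i`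
      have hδ : Function.Bijective δ := by
        constructor
        · rw [injective_iff_map_eq_zero]
          intro x hx
          obtain ⟨y, rfl⟩ := Ext.covariant_sequence_exact₃ T hP x rfl hx
          rw [hT.ext_freeRight_eq_zero (hv a (by lia)) y, Ext.zero_comp]
        · intro x
          exact Ext.covariant_sequence_exact₁ T hP x
            (hT.ext_freeRight_eq_zero (hv (a + 1) (by lia)) _) rfl
      let ε : Ext.{u} (L.obj (presentation N).X₁) T i →ₗ[k] Ext.{u} (L.obj N) T (i + 1) :=
        hLP.extClass.precompOfLinear k T (add_comm 1 i)
      have hε : Function.Bijective ε := by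
        constructor
        · rw [injective_iff_map_eq_zero]
          intro x hx
          obtain ⟨y, rfl⟩ := Ext.contravariant_sequence_exact₁ hLP T x (add_comm 1 i) hx
          obtain ⟨i, rfl⟩ := Nat.exists_eq_succ_of_ne_zero hi.ne'
          rw [Ext.eq_zero_of_projective y, Ext.comp_zero]
          rfl
        · intro x
          exact Ext.contravariant_sequence_exact₃ hLP T x
            (Ext.eq_zero_of_projective _) (add_comm 1 i)
      exact ⟨((LinearEquiv.ofBijective δ hδ).dualMap.symm.trans e).trans
        (LinearEquiv.ofBijective ε hε)⟩

end SerreDuality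

/-! ### Coinduced modules -/

section Coinduced

open Abelian Coalgebra HopfAlgebra
open scoped ModuleCat

variable {k H : Type u} [Field k] [Ring H] [HopfAlgebra k H]

/-- The convolution `x ↦ R(x₁) F(x₂)` of an operator-valued and a vector-valued map. -/
def convAct {V : Type*} [AddCommGroup V] [Module k V] (R : H →ₗ[k] Module.End k V) :
    (H →ₗ[k] V) →ₗ[k] H →ₗ[k] V where
  toFun F := TensorProduct.lift R ∘ₗ F.lTensor H ∘ₗ comul
  map_add' F G := by rw [LinearMap.lTensor_add, LinearMap.add_comp, LinearMap.comp_add]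
  map_smul' c F := by
    rw [LinearMap.lTensor_smul, LinearMap.smul_comp, LinearMap.comp_smul, RingHom.id_apply]

lemma convAct_apply {V : Type*} [AddCommGroup V] [Module k V] (R : H →ₗ[k] Module.End k V)
    (F : H →ₗ[k] V) (h : H) :
    convAct R F h = TensorProduct.lift R (F.lTensor H (comul h)) := rfl

section ConvAct

variable {V : Type*} [AddCommGroup V] [Module k V] (R R' : H →ₗ[k] Module.End k V) (F : H →ₗ[k] V)

lemma convAct_apply_repr {h : H} {ι : Type*} (r : Repr k h ι) :
    convAct R F h = ∑ i ∈ r.index, R (r.left i) (F (r.right i)) := by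
  simp only [convAct_apply, ← r.eq, map_sum, LinearMap.lTensor_tmul, lift.tmul]

lemma convAct_convAct : convAct R (convAct R' F) = convAct (conv R R') F := by
  refine LinearMap.ext fun h => ?_
  have e : ∀ z : (H ⊗[k] H) ⊗[k] H,
      TensorProduct.lift R ((TensorProduct.lift R' ∘ₗ F.lTensor H).lTensor H
        (TensorProduct.assoc k H H H z)) =
      TensorProduct.lift (LinearMap.mul' k (Module.End k V) ∘ₗ TensorProduct.map R R')
        (F.lTensor (H ⊗[k] H) z) := by
    intro z
    refine LinearMap.congr_fun (f := TensorProduct.lift R ∘ₗ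
      (TensorProduct.lift R' ∘ₗ F.lTensor H).lTensor H ∘ₗ
        (TensorProduct.assoc k H H H).toLinearMap)
      (g := TensorProduct.lift (LinearMap.mul' k (Module.End k V) ∘ₗ TensorProduct.map R R') ∘ₗ
        F.lTensor (H ⊗[k] H)) ?_ z
    refine TensorProduct.ext_threefold fun a b c => ?_
    simp
  have e' : ∀ z : H ⊗[k] H, TensorProduct.lift (conv R R') (F.lTensor H z) =
      TensorProduct.lift (LinearMap.mul' k (Module.End k V) ∘ₗ TensorProduct.map R R')
        (F.lTensor (H ⊗[k] H) ((comul (R := k)).rTensor H z)) := by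
    intro z
    induction z with
    | zero => simp
    | add x y hx hy => simp only [map_add, hx, hy]
    | tmul a b => simp [conv_def]
  change TensorProduct.lift R ((TensorProduct.lift R' ∘ₗ F.lTensor H ∘ₗ comul).lTensor H (comul h))
    = TensorProduct.lift (conv R R') (F.lTensor H (comul h))
  rw [e', ← e, coassoc_apply, ← LinearMap.comp_assoc, LinearMap.lTensor_comp_apply]

lemma convUnit_convAct : convAct (convUnit k H (Module.End k V)) F = F := by
  refine LinearMap.ext fun h => ?_
  rw [convAct_apply_repr _ _ (ℛ k h)]
  simp only [convUnit_apply, Module.algebraMap_end_apply, ← map_smul, ← map_sum]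
  rw [sum_counit_smul]

end ConvAct

/-- Underlying space of the coinduced module. -/
def CoindSpace (k H V : Type u) [Field k] [Ring H] [HopfAlgebra k H] [AddCommGroup V]
    [Module k V] : Type u := H →ₗ[k] V

section Coind

variable (V : Type u) [AddCommGroup V] [Module k V]

instance : AddCommGroup (CoindSpace k H V) := inferInstanceAs (AddCommGroup (H →ₗ[k] V))

variable (k H) in
/-- The right action of `H` on `Hom(H, V)`. -/
def coindAct : Hᵐᵒᵖ →ₐ[k] Module.End k (H →ₗ[k] V) :=
  AlgHom.ofLinearMap
    ((LinearMap.llcomp k H H V).flip.comp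
      ((LinearMap.mul k H).comp (opLinearEquiv k).symm.toLinearMap))
    (by ext; simp) (fun x y => by ext; simp [mul_assoc])

lemma coindAct_apply (h : H) (F : H →ₗ[k] V) (x : H) : coindAct k H V (op h) F x = F (h * x) := rfl

instance : Module Hᵐᵒᵖ (CoindSpace k H V) :=
  Module.compHom (H →ₗ[k] V) (coindAct k H V).toRingHom

variable (k H) in
/-- The coinduced right module `Hom(H, V)`, with action `(F h)(x) = F(h x)`. -/
def coind : ModuleCat.{u} Hᵐᵒᵖ := ModuleCat.of Hᵐᵒᵖ (CoindSpace k H V)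

variable (k H) in
/-- The underlying space of a coinduced module. -/
def coindLin : (H →ₗ[k] V) ≃ₗ[k] coind k H V where
  toFun F := (show CoindSpace k H V from F)
  invFun F := (show CoindSpace k H V from F)
  map_add' _ _ := rfl
  map_smul' c F := by
    change c • F = coindAct k H V (algebraMap k Hᵐᵒᵖ c) F
    rw [AlgHom.commutes]
    rfl
  left_inv _ := rfl
  right_inv _ := rfl

variable {V}

lemma smul_coindLin (a : Hᵐᵒᵖ) (F : H →ₗ[k] V) :
    a • coindLin k H V F = coindLin k H V (coindAct k H V a F) := rfl

variable (k H) in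
/-- The endomorphism of a coinduced module given by an endomorphism of `V`. -/
def coindMap (φ : Module.End k V) : coind k H V ⟶ coind k H V :=
  ModuleCat.ofHom (X := CoindSpace k H V) (Y := CoindSpace k H V)
    { toFun := fun F => φ ∘ₗ (show H →ₗ[k] V from F)
      map_add' := fun _ _ => LinearMap.comp_add _ _ _
      map_smul' := fun _ _ => rfl }

variable (k H) in
/-- The homomorphisms `k → Hom(H, k)` are the multiples of the one that sends `1` to the counit. -/
lemma finrank_ext_coind :
    Module.finrank k (Ext.{u} (trivialRight k H) (coind k H k) 0) = 1 := by
  let η : trivialRight k H ⟶ coind k H k := ModuleCat.ofHom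
    { toFun := fun t => coindLin k H k ((trivialLin k H).symm t • counit)
      map_add' := fun s t =>
        (congrArg (coindLin k H k) (add_smul ((trivialLin k H).symm s) ((trivialLin k H).symm t)
          counit)).trans (map_add _ _ _)
      map_smul' := fun a t => by
        obtain ⟨h, rfl⟩ := op_surjective a
        obtain ⟨c, rfl⟩ := (trivialLin k H).surjective t
        refine congrArg (coindLin k H k) (LinearMap.ext fun x => ?_)
        change (counit (R := k) h * c) * counit x = c * counit (h * x)
        rw [Bialgebra.counit_mul]
        ring }
  have hη : ∀ c, η.hom (trivialLin k H c) = coindLin k H k (c • counit) := fun _ => rfl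
  refine finrank_eq_one (Ext.mk₀ η) ?_ fun x => ?_
  · intro h
    have h0 : η = 0 := (Ext.mk₀_bijective _ _).1 (h.trans (Ext.mk₀_zero _ _).symm)
    have e := hη 1
    rw [h0] at e
    have e' : (0 : H →ₗ[k] k) = (1 : k) • counit := (coindLin k H k).injective e
    have := LinearMap.congr_fun e' 1
    simp at this
  · obtain ⟨f, rfl⟩ := (Ext.mk₀_bijective _ _).2 x
    let g := (coindLin k H k).symm (f.hom (trivialLin k H 1))
    have hg : f.hom (trivialLin k H 1) = coindLin k H k g :=
      ((coindLin k H k).apply_symm_apply _).symm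
    have hm : ∀ h x, g (h * x) = counit h * g x := by
      intro h x
      have e : op h • coindLin k H k g = coindLin k H k (counit (R := k) h • g) := by
        rw [← hg, ← map_smul f.hom, smul_trivialLin, mul_one]
        have : trivialLin k H (counit h) = counit (R := k) h • trivialLin k H 1 := by
          rw [← map_smul, smul_eq_mul, mul_one]
        rw [this]
        refine (map_smul (f.hom.restrictScalars k) _ _).trans ?_
        rw [map_smul, ← hg]
        rfl
      exact LinearMap.congr_fun ((coindLin k H k).injective e) x
    refine ⟨g 1, ?_⟩
    rw [← Ext.mk₀_smul]
    congr 1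
    refine ModuleCat.hom_ext (LinearMap.ext fun t => ?_)
    obtain ⟨c, rfl⟩ := (trivialLin k H).surjective t
    have hc : trivialLin k H c = c • trivialLin k H 1 := by
      rw [← map_smul, smul_eq_mul, mul_one]
    have h1 : f.hom (trivialLin k H c) = coindLin k H k (c • g) := by
      rw [hc, map_smul (coindLin k H k), ← hg]
      exact map_smul (f.hom.restrictScalars k) c (trivialLin k H 1)
    refine Eq.trans (b := g 1 • η.hom (trivialLin k H c)) rfl ?_
    rw [hη, h1, ← map_smul]
    congr 1
    refine LinearMap.ext fun x => ?_
    have := hm x 1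
    rw [mul_one] at this
    simp only [LinearMap.smul_apply, smul_eq_mul, this]
    ring

end Coind

section CoindTensor

variable {V : Type u} [AddCommGroup V] [Module k V] [Module Hᵐᵒᵖ V] [IsScalarTower k Hᵐᵒᵖ V]

variable (k V) in
/-- The tensor product of `Hom(H, k)` and `V`, as a space of linear maps. -/
def dualTensor : (coind k H k) ⊗[k] V →ₗ[k] H →ₗ[k] V :=
  TensorProduct.lift (LinearMap.smulRightₗ ∘ₗ (coindLin k H k).symm.toLinearMap)

lemma dualTensor_tmul (f : H →ₗ[k] k) (v : V) (x : H) :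
    dualTensor k V (coindLin k H k f ⊗ₜ v) x = f x • v := rfl

lemma dualTensor_bijective [Module.Finite k V] :
    Function.Bijective (dualTensor k (H := H) V) := by
  let b := Module.finBasis k V
  have hs : ∀ F : H →ₗ[k] V,
      dualTensor k V (∑ i, coindLin k H k (b.coord i ∘ₗ F) ⊗ₜ b i) = F := by
    intro F
    refine LinearMap.ext fun x => ?_
    rw [map_sum, LinearMap.sum_apply]
    exact b.sum_repr (F x)
  refine Function.bijective_iff_has_inverse.2
    ⟨fun F => ∑ i, coindLin k H k (b.coord i ∘ₗ F) ⊗ₜ b i, fun t => ?_, hs⟩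
  induction t with
  | zero => simp
  | add x y hx hy =>
    refine Eq.trans ?_ (congrArg₂ (· + ·) hx hy)
    rw [← Finset.sum_add_distrib]
    refine Finset.sum_congr rfl fun i _ => ?_
    rw [← TensorProduct.add_tmul, map_add, LinearMap.comp_add, map_add]
  | tmul f v =>
    obtain ⟨f, rfl⟩ := (coindLin k H k).surjective f
    have : ∀ i, b.coord i ∘ₗ dualTensor k V (coindLin k H k f ⊗ₜ v) = b.repr v i • f := by
      intro i
      refine LinearMap.ext fun x => ?_
      simp [dualTensor_tmul, mul_comm]
    simp only [this, map_smul, TensorProduct.smul_tmul, ← TensorProduct.tmul_sum]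
    rw [b.sum_repr]

variable (k H V) in
/-- The right action of `H` on `V`, as a linear map. -/
def rightAct : H →ₗ[k] Module.End k V :=
  (Algebra.lsmul k k V).toLinearMap ∘ₗ (opLinearEquiv k).toLinearMap

lemma rightAct_apply (h : H) (v : V) : rightAct k H V h v = op h • v := rfl

variable (hS : Function.Bijective (antipode k (A := H)))

variable (V) in
/-- The map `h ↦ (v ↦ v S⁻¹(h))`. -/
def rightActInv : H →ₗ[k] Module.End k V :=
  rightAct k H V ∘ₗ (antipodeInv hS).toLinearMap ∘ₗ (opLinearEquiv k).toLinearMap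

lemma sum_antipodeInv_mul (h : H) : ∑ i ∈ (ℛ k h).index,
    antipodeInv hS (op ((ℛ k h).right i)) * (ℛ k h).left i = algebraMap k H (counit h) := by
  apply hS.1
  rw [map_sum, ← sum_antipode_mul_eq_algebraMap_counit (ℛ k h)]
  simp only [antipode_mul_antidistrib, antipode_antipodeInv]
  rw [sum_antipode_mul_eq_algebraMap_counit (ℛ k h), Algebra.algebraMap_eq_smul_one, map_smul,
    antipode_one]

lemma conv_rightActInv : conv (rightActInv V hS) (rightAct k H V) = convUnit k H _ := by
  refine LinearMap.ext fun h => ?_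
  rw [conv_apply]
  have := congrArg (rightAct k H V) (sum_mul_antipodeInv hS h)
  rw [map_sum] at this
  refine Eq.trans (Finset.sum_congr rfl fun i _ => ?_) (this.trans ?_)
  · refine LinearMap.ext fun v => ?_
    exact (mul_smul (op (antipodeInv hS (op ((ℛ k h).left i)))) (op ((ℛ k h).right i)) v).symm
  · refine LinearMap.ext fun v => ?_
    exact algebraMap_smul Hᵐᵒᵖ (counit (R := k) h) v

lemma conv_rightAct_inv : conv (rightAct k H V) (rightActInv V hS) = convUnit k H _ := by
  refine LinearMap.ext fun h => ?_
  rw [conv_apply]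
  have := congrArg (rightAct k H V) (sum_antipodeInv_mul hS h)
  rw [map_sum] at this
  refine Eq.trans (Finset.sum_congr rfl fun i _ => ?_) (this.trans ?_)
  · refine LinearMap.ext fun v => ?_
    exact (mul_smul (op ((ℛ k h).left i)) (op (antipodeInv hS (op ((ℛ k h).right i)))) v).symm
  · refine LinearMap.ext fun v => ?_
    exact algebraMap_smul Hᵐᵒᵖ (counit (R := k) h) v

lemma convAct_rightAct_bijective (hS : Function.Bijective (antipode k (A := H))) :
    Function.Bijective (convAct (rightAct k H V)) :=
  Function.bijective_iff_has_inverse.2 ⟨convAct (rightActInv V hS),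
    fun F => by rw [convAct_convAct, conv_rightActInv, convUnit_convAct],
    fun F => by rw [convAct_convAct, conv_rightAct_inv, convUnit_convAct]⟩

lemma convAct_dualTensor (h : H) (t : (coind k H k) ⊗[k] V) :
    convAct (rightAct k H V) (dualTensor k V (tensorAct k (coind k H k) V (op h) t)) =
      coindAct k H V (op h) (convAct (rightAct k H V) (dualTensor k V t)) := by
  induction t with
  | zero => simp
  | add x y hx hy => simp only [map_add, hx, hy]
  | tmul f v =>
    obtain ⟨f, rfl⟩ := (coindLin k H k).surjective f
    refine LinearMap.ext fun x => ?_
    let r := ℛ k h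
    let s := ℛ k x
    have hr : ∑ i ∈ r.index ×ˢ s.index,
        (r.left i.1 * s.left i.2) ⊗ₜ[k] (r.right i.1 * s.right i.2) = comul (h * x) := by
      rw [Bialgebra.comul_mul, ← r.eq, ← s.eq, Finset.sum_product, Finset.sum_mul]
      refine Finset.sum_congr rfl fun i _ => ?_
      rw [Finset.mul_sum]
      simp
    rw [coindAct_apply, convAct_apply_repr (h := h * x) _ _
      (⟨r.index ×ˢ s.index, fun i => r.left i.1 * s.left i.2,
        fun i => r.right i.1 * s.right i.2, hr⟩ : Repr k (h * x) ((H × H) × (H × H))),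
      tensorAct_tmul, map_sum, map_sum, LinearMap.sum_apply, Finset.sum_product]
    refine Finset.sum_congr rfl fun i _ => ?_
    rw [convAct_apply_repr _ _ s]
    refine Finset.sum_congr rfl fun j _ => ?_
    rw [smul_coindLin, dualTensor_tmul, dualTensor_tmul, coindAct_apply,
      (rightAct k H V (s.left j)).map_smul, LinearMap.map_smul,
      rightAct_apply, rightAct_apply, op_mul, mul_smul]

/-- If the antipode is bijective and `V` is finite-dimensional, then `Hom(H, k) ⊗ V` is coinduced
from the space underlying `V`. -/
lemma nonempty_coind_tensor_iso (hS : Function.Bijective (antipode k (A := H)))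
    [Module.Finite k V] :
    Nonempty ((rtensor k V).obj (coind k H k) ≅ coind k H V) := by
  let g : (coind k H k) ⊗[k] V →ₗ[k] coind k H V := (coindLin k H V).toLinearMap ∘ₗ
    convAct (rightAct k H V) ∘ₗ dualTensor k V
  have hg : ∀ t, g t = coindLin k H V (convAct (rightAct k H V) (dualTensor k V t)) := fun _ => rfl
  let f := linToHom (isNaturalAction_tensorAct k V) (M := coind k H k) g (fun a t => by
    obtain ⟨h, rfl⟩ := op_surjective a
    rw [hg, hg, convAct_dualTensor, smul_coindLin])
  have hf : Function.Bijective f :=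
    (coindLin k H V).bijective.comp ((convAct_rightAct_bijective hS).comp dualTensor_bijective)
  have : IsIso f := (ConcreteCategory.isIso_iff_bijective f).2 hf
  exact ⟨asIso f⟩

end CoindTensor

end Coinduced

/-! ### One-dimensionality of the right extension space -/

section OneDimensional

open Abelian Coalgebra HopfAlgebra
open scoped ModuleCat

variable {k H : Type u} [Field k] [Ring H] [HopfAlgebra k H]

/-- A ring that acts on the right of a one-dimensional space by linear maps has a character. -/
lemma exists_ringHom_of_finrank_eq_one {W B : Type*} [AddCommGroup W] [Module k W] [Ring B]
    (hW : Module.finrank k W = 1) (ψ : B →+ Module.End k W) (h1 : ψ 1 = 1)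
    (hmul : ∀ a b, ψ (a * b) = ψ b * ψ a) : Nonempty (B →+* k) := by
  obtain ⟨w, hw, hs⟩ := finrank_eq_one_iff'.1 hW
  choose c hc using fun b => hs (ψ b w)
  have hinj : ∀ x y : k, x • w = y • w → x = y := fun x y h => smul_left_injective k hw h
  refine ⟨⟨⟨⟨c, hinj _ _ ?_⟩, fun a b => hinj _ _ ?_⟩, hinj _ _ ?_, fun a b => hinj _ _ ?_⟩⟩
  · rw [hc, h1, one_smul, Module.End.one_apply]
  · rw [hc, hmul, Module.End.mul_apply, ← hc a, map_smul, ← hc b, smul_smul]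
  · change c 0 • w = _
    rw [hc, map_zero, zero_smul, LinearMap.zero_apply]
  · change c (a + b) • w = (c a + c b) • w
    rw [hc, map_add, add_smul, hc, hc, LinearMap.add_apply]

lemma coindMap_add {V : Type u} [AddCommGroup V] [Module k V] (φ ψ : Module.End k V) :
    coindMap k H (φ + ψ) = coindMap k H φ + coindMap k H ψ := rfl

lemma coindMap_mul {V : Type u} [AddCommGroup V] [Module k V] (φ ψ : Module.End k V) :
    coindMap k H (φ * ψ) = coindMap k H ψ ≫ coindMap k H φ := rfl

/-- The endomorphism ring of a finite-dimensional Serre space acts on a space dual to `Hom(k, H*)`,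
which is one-dimensional. -/
lemma finrank_serreSpace (hS : Function.Bijective (antipode k (A := H)))
    (hT : IsExtCompact (trivialRight k H)) {d : ℕ}
    (hd : ∀ (N : ModuleCat.{u} Hᵐᵒᵖ) (x : Ext.{u} (trivialRight k H) N (d + 1)), x = 0)
    (hv : ∀ j, j < d → ∀ x : Ext.{u} (trivialRight k H) (ModuleCat.of Hᵐᵒᵖ H) j, x = 0)
    (hfin : Module.Finite k (SerreSpace hS d)) :
    Module.finrank k (SerreSpace hS d) = 1 := by
  obtain ⟨e⟩ := serre_duality hS hT hd hv d 0 (zero_add d) (coind k H k)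
  obtain ⟨α⟩ := nonempty_coind_tensor_iso (V := SerreSpace hS d) hS
  let β : Ext.{u} (coind k H (SerreSpace hS d)) (trivialRight k H) d →ₗ[k]
      Ext.{u} ((rtensor k (SerreSpace hS d)).obj (coind k H k)) (trivialRight k H) d :=
    (Ext.mk₀ α.hom).precompOfLinear k _ (zero_add d)
  have hβ : Function.Bijective β := by
    refine Function.bijective_iff_has_inverse.2
      ⟨fun x => (Ext.mk₀ α.inv).comp x (zero_add d), fun x => ?_, fun x => ?_⟩
    · change (Ext.mk₀ α.inv).comp ((Ext.mk₀ α.hom).comp x (zero_add d)) (zero_add d) = x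
      rw [Ext.mk₀_comp_mk₀_assoc, α.inv_hom_id, Ext.mk₀_id_comp]
    · change (Ext.mk₀ α.hom).comp ((Ext.mk₀ α.inv).comp x (zero_add d)) (zero_add d) = x
      rw [Ext.mk₀_comp_mk₀_assoc, α.hom_inv_id, Ext.mk₀_id_comp]
  have hW : Module.finrank k
      (Ext.{u} (coind k H (SerreSpace hS d)) (trivialRight k H) d) = 1 := by
    rw [(LinearEquiv.ofBijective β hβ).finrank_eq, ← e.finrank_eq, Subspace.dual_finrank_eq,
      finrank_ext_coind]
  obtain ⟨χ⟩ := exists_ringHom_of_finrank_eq_one hW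
    (B := Module.End k (SerreSpace hS d))
    { toFun := fun φ => (Ext.mk₀ (coindMap k H φ)).precompOfLinear k _ (zero_add d)
      map_zero' := LinearMap.ext fun x => by
        change (Ext.mk₀ (0 : coind k H (SerreSpace hS d) ⟶ _)).comp x (zero_add d) = 0
        rw [Ext.mk₀_zero, Ext.zero_comp]
      map_add' := fun φ ψ => LinearMap.ext fun x => by
        change (Ext.mk₀ (coindMap k H (φ + ψ))).comp x (zero_add d) =
          (Ext.mk₀ (coindMap k H φ)).comp x (zero_add d) +
            (Ext.mk₀ (coindMap k H ψ)).comp x (zero_add d)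
        rw [coindMap_add, Ext.mk₀_add, Ext.add_comp] }
    (LinearMap.ext fun x => Ext.mk₀_id_comp x)
    (fun φ ψ => LinearMap.ext fun x => by
      change (Ext.mk₀ (coindMap k H (φ * ψ))).comp x (zero_add d) =
        (Ext.mk₀ (coindMap k H ψ)).comp ((Ext.mk₀ (coindMap k H φ)).comp x (zero_add d))
          (zero_add d)
      rw [coindMap_mul, Ext.mk₀_comp_mk₀_assoc])
  exact finrank_eq_one_of_end_hom χ

/-- The identity map between the two descriptions of `Ext^d(k, H)`. -/
def extRightEquiv (hS : Function.Bijective (antipode k (A := H))) (d : ℕ) :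
    ExtRight k H d ≃ₗ[k] SerreSpace hS d where
  toFun x := x
  invFun x := x
  map_add' _ _ := rfl
  map_smul' c x := LinearMap.congr_fun ((extLeft k (trivialRight k H) d).commutes c)
    (show Ext.{u} (trivialRight k H) (ModuleCat.of Hᵐᵒᵖ H) d from x)
  left_inv _ := rfl
  right_inv _ := rfl

/-- The projective dimension of `k` is at most `d` because `Ext^j(k, H) = 0` for `j > d`, so Serre
duality applies. -/
theorem HasFiniteRightExt.finrank_eq_one {d : ℕ} (h : HasFiniteRightExt k H d) :
    Module.finrank k (ExtRight k H d) = 1 := by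
  obtain ⟨hT, n, hn⟩ := isPerfect_iff.1 h.perfect
  have h0 : ∀ j, j ≠ d → ∀ x : Ext.{u} (trivialRight k H) (ModuleCat.of Hᵐᵒᵖ H) j, x = 0 :=
    fun j hj x => (h.vanish j hj).elim (x : ExtRight k H j) 0
  have := h.finite
  rw [(extRightEquiv h.bijective d).finrank_eq]
  exact finrank_serreSpace h.bijective hT
    (hT.ext_eq_zero hn (fun j hj => h0 j hj.ne') (d + 1) d.lt_succ_self)
    (fun j hj => h0 j hj.ne)
    (Module.Finite.equiv (extRightEquiv h.bijective d))

end OneDimensional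

/-! ### Winding maps -/

section Winding

open Coalgebra HopfAlgebra

variable {k H : Type u} [Field k] [Ring H] [HopfAlgebra k H]

lemma conv_inverse_unique {B : Type*} [Ring B] [Algebra k B] {x f y : H →ₗ[k] B}
    (hx : conv x f = convUnit k H B) (hy : conv f y = convUnit k H B) : x = y := by
  rw [← conv_convUnit x, ← hy, ← conv_assoc, hx, convUnit_conv]

/-- A linear form as a map to the scalars of `H`. -/
def scalarMap (f : H →ₗ[k] k) : H →ₗ[k] H := Algebra.linearMap k H ∘ₗ f

lemma scalarMap_conv (f g : H →ₗ[k] k) :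
    scalarMap (conv f g) = conv (scalarMap f) (scalarMap g) :=
  algHom_comp_conv (Algebra.ofId k H) f g

lemma scalarMap_convUnit : scalarMap (convUnit k H k) = convUnit k H H := rfl

lemma rightWinding_eq_conv (f : H →ₗ[k] k) : rightWinding f = conv LinearMap.id (scalarMap f) := by
  refine LinearMap.ext fun h => ?_
  simp only [rightWinding, conv_apply, LinearMap.comp_apply, LinearEquiv.coe_coe, scalarMap]
  rw [← (ℛ k h).eq]
  simp only [map_sum, LinearMap.lTensor_tmul, rid_tmul, LinearMap.id_apply,
    Algebra.linearMap_apply, Algebra.commutes, Algebra.smul_def]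

lemma rightWinding_apply (f : H →ₗ[k] k) (h : H) :
    rightWinding f h = ∑ i ∈ (ℛ k h).index, f ((ℛ k h).right i) • (ℛ k h).left i := by
  rw [rightWinding_eq_conv, conv_apply]
  refine Finset.sum_congr rfl fun i _ => ?_
  rw [Algebra.smul_def, Algebra.commutes]
  rfl

/-- The winding map `h ↦ π(h₁) h₂`. -/
def leftWinding (π : H →ₗ[k] k) : H →ₗ[k] H := conv (scalarMap π) LinearMap.id

lemma counit_rightWinding (f : H →ₗ[k] k) (h : H) : counit (R := k) (rightWinding f h) = f h := by
  rw [rightWinding_apply, map_sum]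
  simp only [map_smul, smul_eq_mul]
  conv_rhs => rw [← sum_counit_smul (ℛ k h), map_sum]
  refine Finset.sum_congr rfl fun i _ => ?_
  rw [map_smul, smul_eq_mul, mul_comm]

variable (π : H →ₐ[k] k)

/-- The right winding automorphism of a character. -/
def rightWindingHom : H →ₐ[k] H :=
  (Algebra.TensorProduct.rid k k H).toAlgHom.comp
    ((Algebra.TensorProduct.map (AlgHom.id k H) π).comp (Bialgebra.comulAlgHom k H))

lemma rightWindingHom_toLinearMap :
    (rightWindingHom π).toLinearMap = rightWinding π.toLinearMap := rfl

/-- The left winding automorphism of a character. -/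
def leftWindingHom : H →ₐ[k] H :=
  (Algebra.TensorProduct.lid k H).toAlgHom.comp
    ((Algebra.TensorProduct.map π (AlgHom.id k H)).comp (Bialgebra.comulAlgHom k H))

lemma leftWindingHom_toLinearMap :
    (leftWindingHom π).toLinearMap = leftWinding π.toLinearMap := by
  refine LinearMap.ext fun h => ?_
  change Algebra.TensorProduct.lid k H (Algebra.TensorProduct.map π (AlgHom.id k H)
    (comul (R := k) h)) = _
  rw [leftWinding, conv_apply, ← (ℛ k h).eq]
  simp only [map_sum, Algebra.TensorProduct.map_tmul, Algebra.TensorProduct.lid_tmul,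
    Algebra.smul_def]
  rfl

/-- The inverse of a character for the convolution product. -/
def characterInv : H →ₐ[k] k :=
  AlgHom.ofLinearMap (π.toLinearMap ∘ₗ antipode k) (by simp)
    (fun x y => by simp [antipode_mul_antidistrib, mul_comm])

lemma characterInv_toLinearMap :
    (characterInv π).toLinearMap = π.toLinearMap ∘ₗ antipode k := rfl

lemma characterInv_characterInv : characterInv (characterInv π) = π := by
  refine AlgHom.toLinearMap_injective ?_
  exact conv_inverse_unique (conv_antipode_id (characterInv π))
    (conv_antipode_id π)

lemma algHom_comp_scalarMap (φ : H →ₐ[k] H) (f : H →ₗ[k] k) :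
    φ.toLinearMap ∘ₗ scalarMap f = scalarMap f :=
  LinearMap.ext fun _ => φ.commutes _

lemma rightWinding_comp (f : H →ₗ[k] k) :
    rightWinding π.toLinearMap ∘ₗ rightWinding f = rightWinding (conv π.toLinearMap f) := by
  rw [rightWinding_eq_conv f, ← rightWindingHom_toLinearMap, algHom_comp_conv,
    algHom_comp_scalarMap, LinearMap.comp_id, rightWindingHom_toLinearMap, rightWinding_eq_conv,
    rightWinding_eq_conv, scalarMap_conv, conv_assoc]

lemma rightWinding_convUnit : rightWinding (convUnit k H k) = LinearMap.id := by
  rw [rightWinding_eq_conv, scalarMap_convUnit, conv_convUnit]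

lemma rightWinding_characterInv (h : H) :
    rightWinding π.toLinearMap (rightWinding (π.toLinearMap ∘ₗ antipode k) h) = h := by
  have := LinearMap.congr_fun (rightWinding_comp π (π.toLinearMap ∘ₗ antipode k)) h
  rw [conv_id_antipode, rightWinding_convUnit] at this
  exact this

lemma characterInv_rightWinding (h : H) :
    rightWinding (π.toLinearMap ∘ₗ antipode k) (rightWinding π.toLinearMap h) = h := by
  have := LinearMap.congr_fun (rightWinding_comp (characterInv π) π.toLinearMap) h
  rw [characterInv_toLinearMap, conv_antipode_id, rightWinding_convUnit] at this
  exact this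

lemma rightWinding_bijective : Function.Bijective (rightWinding π.toLinearMap) :=
  Function.bijective_iff_has_inverse.2 ⟨_, characterInv_rightWinding π, rightWinding_characterInv π⟩

/-- Both sides are the convolution inverse of `h ↦ h₁ π(h₂)`. -/
lemma rightWinding_comp_antipode :
    rightWinding π.toLinearMap ∘ₗ antipode k =
      antipode k ∘ₗ leftWinding (π.toLinearMap ∘ₗ antipode k) := by
  refine conv_inverse_unique (f := rightWinding π.toLinearMap)
    (conv_antipode_id (rightWindingHom π)) ?_
  have e : antipode k ∘ₗ leftWinding (π.toLinearMap ∘ₗ antipode k) =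
      conv (scalarMap (π.toLinearMap ∘ₗ antipode k)) (antipode k) := by
    refine LinearMap.ext fun h => ?_
    rw [LinearMap.comp_apply, leftWinding, conv_apply, conv_apply, map_sum]
    refine Finset.sum_congr rfl fun i _ => ?_
    simp only [scalarMap, LinearMap.comp_apply, Algebra.linearMap_apply, ← Algebra.smul_def,
      map_smul]
    rfl
  rw [e, rightWinding_eq_conv, conv_assoc, ← conv_assoc (scalarMap _), ← scalarMap_conv,
    conv_id_antipode, scalarMap_convUnit, convUnit_conv]
  exact conv_id_antipode (AlgHom.id k H)

/-- Both sides are the convolution inverse of `h ↦ π(h₁) h₂`. -/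
lemma leftWinding_comp_antipode :
    leftWinding π.toLinearMap ∘ₗ antipode k =
      antipode k ∘ₗ rightWinding (π.toLinearMap ∘ₗ antipode k) := by
  rw [← leftWindingHom_toLinearMap]
  refine conv_inverse_unique (f := (leftWindingHom π).toLinearMap)
    (conv_antipode_id (leftWindingHom π)) ?_
  have e : antipode k ∘ₗ rightWinding (π.toLinearMap ∘ₗ antipode k) =
      conv (antipode k) (scalarMap (π.toLinearMap ∘ₗ antipode k)) := by
    refine LinearMap.ext fun h => ?_
    rw [LinearMap.comp_apply, rightWinding_eq_conv, conv_apply, conv_apply, map_sum]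
    refine Finset.sum_congr rfl fun i _ => ?_
    simp only [scalarMap, LinearMap.comp_apply, Algebra.linearMap_apply, ← Algebra.commutes,
      ← Algebra.smul_def, map_smul]
    rfl
  have e' : conv LinearMap.id (antipode k) = convUnit k H H := conv_id_antipode (AlgHom.id k H)
  rw [e, leftWindingHom_toLinearMap, leftWinding, conv_assoc, ← conv_assoc LinearMap.id, e',
    convUnit_conv, ← scalarMap_conv, conv_id_antipode, scalarMap_convUnit]

/-- The winding automorphisms commute with the square of the antipode. -/
lemma rightWinding_antipode_antipode (h : H) :
    rightWinding π.toLinearMap (antipode k (antipode k h)) =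
      antipode k (antipode k (rightWinding π.toLinearMap h)) := by
  refine (LinearMap.congr_fun (rightWinding_comp_antipode π) (antipode k h)).trans ?_
  refine (congrArg (antipode k)
    (LinearMap.congr_fun (leftWinding_comp_antipode (characterInv π)) h)).trans ?_
  change antipode k (antipode k (rightWinding (characterInv (characterInv π)).toLinearMap h)) = _
  rw [characterInv_characterInv]

/-- The homomorphism `S² ∘ Ξ_π`. -/
def twistedWinding : H →ₐ[k] H :=
  (AlgHom.ofLinearMap (antipode k ∘ₗ antipode k) (by simp)
    (fun x y => by simp [antipode_mul_antidistrib]) : H →ₐ[k] H).comp (rightWindingHom π)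

lemma twistedWinding_apply (h : H) :
    twistedWinding π h = antipode k (antipode k (rightWinding π.toLinearMap h)) := rfl

/-- Bijectivity of `S² ∘ Ξ_π` is that of `S²`, since winding maps are bijective. -/
lemma twistedWinding_bijective_iff :
    Function.Bijective (twistedWinding π) ↔ Function.Bijective (antipode k (A := H)) := by
  have e : (twistedWinding π : H → H) =
      (antipode k ∘ antipode k) ∘ rightWinding π.toLinearMap := rfl
  rw [e, Function.Bijective.of_comp_iff _ (rightWinding_bijective π)]
  exact ⟨fun h => ⟨h.1.of_comp, h.2.of_comp⟩, fun h => h.comp h⟩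

lemma counit_twistedWinding (h : H) : counit (R := k) (twistedWinding π h) = π h := by
  rw [twistedWinding_apply, counit_antipode, counit_antipode, counit_rightWinding]
  rfl

lemma twistedWinding_counit (h : H) :
    twistedWinding (Bialgebra.counitAlgHom k H) h = antipode k (antipode k h) := by
  rw [twistedWinding_apply]
  exact congrArg (fun f : H →ₗ[k] H => antipode k (antipode k (f h))) rightWinding_convUnit

end Winding

/-! ### Bimodules free of rank one on the right -/

section RankOne

open scoped ModuleCat

variable {k A : Type u} [Field k] [Ring A] [Algebra k A] {M : Bimod k A}

/-- If `M` is `A` with left action twisted by `τ`, the isomorphisms from `M` to `A^σ` are the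
additive bijections that intertwine the two actions. -/
lemma nonempty_iso_twist_iff {τ : A → A} (g : A ≃ₗ[k] M)
    (hg : ∀ a b v : A, (a ⊗ₜ[k] op b : Env k A) • g v = g (τ a * v * b)) (σ : A →ₐ[k] A) :
    Nonempty (M ≅ twist σ) ↔ ∃ β : A ≃+ A, ∀ a b v, β (τ a * v * b) = a * β v * σ b := by
  constructor
  · rintro ⟨α⟩
    let α' : M ≃ₗ[Env k A] twist σ := α.toLinearEquiv
    refine ⟨(g.toAddEquiv.trans α'.toAddEquiv).trans (twistLin σ).symm.toAddEquiv,
      fun a b v => ?_⟩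
    apply (twistLin σ).injective
    refine ((twistLin σ).apply_symm_apply (α' (g (τ a * v * b)))).trans ?_
    rw [← hg]
    refine (α'.map_smul _ _).trans ?_
    rw [← (twistLin σ).apply_symm_apply (α' (g v))]
    exact smul_twistLin σ a b _
  · rintro ⟨β, hβ⟩
    let f := homToTwist (X := M) σ (β.toAddMonoidHom.comp g.symm.toAddEquiv.toAddMonoidHom)
      (fun a b x => by
        obtain ⟨v, rfl⟩ := g.surjective x
        rw [hg]
        change β (g.symm (g _)) = a * β (g.symm (g v)) * σ b
        rw [g.symm_apply_apply, g.symm_apply_apply, hβ])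
    have hf : Function.Bijective f :=
      (twistLin σ).bijective.comp (β.bijective.comp g.symm.bijective)
    exact ⟨(LinearEquiv.ofBijective f hf).toModuleIso⟩

end RankOne

/-! ### Comparison of the duality conditions -/

section Duality

open Coalgebra HopfAlgebra
open scoped ModuleCat

variable {k H : Type u} [Field k] [Ring H] [HopfAlgebra k H]

/-- The common part of the duality conditions, in terms of the trivial module. -/
lemma isSmoothConcentrated_iff {d : ℕ} : IsSmoothConcentrated k H d ↔
    IsPerfect (trivialRight k H) ∧ ∀ i, i ≠ d → Subsingleton (ExtRight k H i) := by
  constructor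
  · rintro ⟨h, hv⟩
    have hp := hasFiniteResolution_regular_iff.1 h
    exact ⟨hp, fun i hi => (subsingleton_dual_iff k (isPerfect_iff.1 hp).1 i).1 (hv i hi)⟩
  · rintro ⟨hp, hv⟩
    exact ⟨hasFiniteResolution_regular_iff.2 hp,
      fun i hi => (subsingleton_dual_iff k (isPerfect_iff.1 hp).1 i).2 (hv i hi)⟩

/-- On a one-dimensional space `H` acts by a character. -/
lemma exists_character {V : Type*} [AddCommGroup V] [Module k V] [Module H V]
    [IsScalarTower k H V] (hV : Module.finrank k V = 1) :
    ∃ π : H →ₐ[k] k, ∀ (h : H) (v : V), h • v = π h • v := by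
  obtain ⟨w, hw, hs⟩ := finrank_eq_one_iff'.1 hV
  have hcomm : ∀ (h : H) (c : k) (v : V), h • c • v = c • h • v := fun h c v => by
    rw [← algebraMap_smul H c v, ← mul_smul, ← Algebra.commutes, mul_smul, algebraMap_smul]
  choose c hc using fun h : H => hs (h • w)
  have hinj : ∀ x y : k, x • w = y • w → x = y := fun x y h => smul_left_injective k hw h
  refine ⟨AlgHom.ofLinearMap ⟨⟨c, fun x y => hinj _ _ ?_⟩, fun a x => hinj _ _ ?_⟩
    (hinj _ _ ?_) (fun x y => hinj _ _ ?_), fun h v => ?_⟩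
  · rw [add_smul, hc, hc, hc, add_smul]
  · rw [RingHom.id_apply, smul_assoc, hc, hc, smul_assoc]
  · change c 1 • w = _
    rw [hc, one_smul, one_smul]
  · change c (x * y) • w = (c x * c y) • w
    rw [hc, mul_smul, ← hc y, hcomm, ← hc x, smul_smul, mul_comm]
  · obtain ⟨b, rfl⟩ := hs v
    change h • b • w = c h • b • w
    rw [hcomm, ← hc, smul_comm]

/-- If `Ext^d(k, H)` is one-dimensional, with `H` acting by the character `π`, then
`Ext^d_{H^e}(H, H^e)` is `H` with left action twisted by `S² ∘ Ξ_π`. -/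
lemma exists_dual_equiv (hT : IsExtCompact (trivialRight k H)) {d : ℕ}
    (hd : Module.finrank k (ExtRight k H d) = 1) {π : H →ₐ[k] k}
    (hπ : ∀ (h : H) (e : ExtRight k H d), h • e = π h • e) :
    ∃ g : H ≃ₗ[k] dual k H d, ∀ a b v : H,
      (a ⊗ₜ[k] op b : Env k H) • g v = g (twistedWinding π a * v * b) := by
  have : Module.Finite k (ExtRight k H d) :=
    Module.finite_of_finrank_pos (by rw [hd]; exact one_pos)
  let e : k ≃ₗ[k] ExtRight k H d :=
    (LinearEquiv.ofFinrankEq (R := k) _ _ (by rw [hd, Module.finrank_self]))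
  let g : H ≃ₗ[k] dual k H d := (TensorProduct.lid k H).symm.trans
    ((TensorProduct.congr e (LinearEquiv.refl k H)).trans (dualEquiv k H hT d))
  have hg : ∀ v, g v = dualEquiv k H hT d (e 1 ⊗ₜ v) := fun _ => rfl
  refine ⟨g, fun a b v => ?_⟩
  rw [hg, smul_dualEquiv, hg, twistedWinding_apply, rightWinding_apply, ← map_sum]
  congr 1
  simp only [map_sum, map_smul, Finset.sum_mul, TensorProduct.tmul_sum, smul_mul_assoc]
  refine Finset.sum_congr rfl fun i _ => ?_
  rw [hπ, TensorProduct.smul_tmul]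
  rfl

lemma HasVanDenBerghDuality.hasFiniteRightExt {d : ℕ} (h : HasVanDenBerghDuality k H d) :
    HasFiniteRightExt k H d := by
  obtain ⟨hs, N, ⟨θ⟩, ⟨θ'⟩⟩ := h
  obtain ⟨hp, hv⟩ := isSmoothConcentrated_iff.1 hs
  have hT := (isPerfect_iff.1 hp).1
  have hd : Module.finrank k (ExtRight k H d) = 1 := by
    refine finrank_eq_one_of_tensor_iso θ (dualEquiv k H hT d) (fun e v b => ?_)
      (Bialgebra.counitAlgHom k H : H →+* k)
    exact op_smul_dualFun k d e v b
  obtain ⟨π, hπ⟩ := exists_character (H := H) hd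
  obtain ⟨g, hg⟩ := exists_dual_equiv hT hd hπ
  have hb := bijective_of_invertible θ (τ := (twistedWinding π : H →+* H)) g hg θ'
  exact ⟨hp, (twistedWinding_bijective_iff π).1 hb,
    Module.finite_of_finrank_pos (by rw [hd]; exact one_pos), hv⟩

/-- The inverse of `S² ∘ Ξ_π` is a Nakayama automorphism. -/
lemma exists_isNakayamaAutomorphism {d : ℕ} (h : HasFiniteRightExt k H d) {π : H →ₐ[k] k}
    (hπ : ∀ (h : H) (e : ExtRight k H d), h • e = π h • e) :
    ∃ σ : H ≃ₐ[k] H, (∀ x, σ.symm x = twistedWinding π x) ∧ IsNakayamaAutomorphism d σ := by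
  let θ : H ≃ₐ[k] H :=
    AlgEquiv.ofBijective (twistedWinding π) ((twistedWinding_bijective_iff π).2 h.bijective)
  obtain ⟨g, hg⟩ := exists_dual_equiv (isPerfect_iff.1 h.perfect).1 h.finrank_eq_one hπ
  refine ⟨θ.symm, fun _ => rfl, isSmoothConcentrated_iff.2 ⟨h.perfect, h.vanish⟩,
    (nonempty_iso_twist_iff g hg _).2 ⟨θ.symm.toAddEquiv, fun a b v => ?_⟩⟩
  change θ.symm (θ a * v * b) = a * θ.symm v * θ.symm b
  rw [map_mul, map_mul, θ.symm_apply_apply]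

lemma HasFiniteRightExt.exists_character {d : ℕ} (h : HasFiniteRightExt k H d) :
    ∃ π : H →ₐ[k] k, ∀ (h : H) (e : ExtRight k H d), h • e = π h • e :=
  HopfDuality.exists_character h.finrank_eq_one

lemma HasFiniteRightExt.isSkewCalabiYau {d : ℕ} (h : HasFiniteRightExt k H d) :
    IsSkewCalabiYau k H d := by
  obtain ⟨π, hπ⟩ := h.exists_character
  obtain ⟨σ, -, hσ⟩ := exists_isNakayamaAutomorphism h hπ
  exact ⟨σ, hσ⟩

lemma IsSkewCalabiYau.hasVanDenBerghDuality {d : ℕ} (h : IsSkewCalabiYau k H d) :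
    HasVanDenBerghDuality k H d := by
  obtain ⟨σ, hs, ⟨α⟩⟩ := h
  exact ⟨hs, isInvertibleBimod_of_iso_twist σ α⟩

lemma HasFiniteRightExt.isRightArtinSchelter {d : ℕ} (h : HasFiniteRightExt k H d) :
    IsRightArtinSchelter k H d := by
  intro i
  split_ifs with hi
  · subst hi
    have := h.finite
    rw [← Module.finrank_eq_rank, h.finrank_eq_one, Nat.cast_one]
  · have := h.vanish i hi
    exact rank_subsingleton' k _

lemma IsRightArtinSchelter.finrank_eq_one {d : ℕ} (h : IsRightArtinSchelter k H d) :
    Module.finrank k (ExtRight k H d) = 1 :=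
  Module.finrank_eq_of_rank_eq (((h d).trans (if_pos rfl)).trans Nat.cast_one.symm)

lemma IsRightArtinSchelter.subsingleton {d : ℕ} (h : IsRightArtinSchelter k H d) {i : ℕ}
    (hi : i ≠ d) : Subsingleton (ExtRight k H i) :=
  rank_zero_iff.1 ((h i).trans (if_neg hi))

lemma HasFiniteRightExt.degree_unique {d d' : ℕ} (h : HasFiniteRightExt k H d)
    (h' : HasFiniteRightExt k H d') : d = d' := by
  by_contra hne
  have := h'.vanish d hne
  have e := h.finrank_eq_one
  rw [Module.finrank_zero_of_subsingleton] at e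
  exact zero_ne_one e

lemma IsRightHomologicalIntegral.unique {d : ℕ} {π π' : H →ₐ[k] k}
    (h : IsRightHomologicalIntegral d π) (h' : IsRightHomologicalIntegral d π') : π = π' := by
  obtain ⟨w, hw, -⟩ := finrank_eq_one_iff'.1 h.1.finrank_eq_one
  exact AlgHom.ext fun x => smul_left_injective k hw ((h.2 x w).symm.trans (h'.2 x w))

/-- A Nakayama automorphism is related to `S² ∘ Ξ_π` by conjugation by a unit. -/
lemma IsNakayamaAutomorphism.exists_unit {d : ℕ} (h : HasFiniteRightExt k H d) {π : H →ₐ[k] k}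
    (hπ : ∀ (h : H) (e : ExtRight k H d), h • e = π h • e) {μ : H ≃ₐ[k] H}
    (hμ : IsNakayamaAutomorphism d μ) : ∃ u : Hˣ, ∀ a, a * u = u * μ (twistedWinding π a) := by
  obtain ⟨g, hg⟩ := exists_dual_equiv (isPerfect_iff.1 h.perfect).1 h.finrank_eq_one hπ
  obtain ⟨β, hβ⟩ := (nonempty_iso_twist_iff g hg _).1 hμ.2
  have h₁ : ∀ b, β b = β 1 * μ b := fun b => by simpa using hβ 1 b 1
  have h₂ : ∀ a, β (twistedWinding π a) = a * β 1 := fun a => by simpa using hβ a 1 1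
  obtain ⟨b, hb⟩ := β.surjective 1
  obtain ⟨a, rfl⟩ := ((twistedWinding_bijective_iff π).2 h.bijective).2 b
  have hr : β 1 * μ (twistedWinding π a) = 1 := by rw [← h₁, hb]
  have hl : a * β 1 = 1 := by rw [← h₂, hb]
  have e : a = μ (twistedWinding π a) := left_inv_eq_right_inv hl hr
  exact ⟨⟨β 1, a, e ▸ hr, hl⟩, fun x => (h₂ x).symm.trans (h₁ _)⟩

/-- Up to conjugation by a unit, `μ⁻¹` is `S² ∘ Ξ_π`, and `ε ∘ S² ∘ Ξ_π = π`. -/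
lemma IsNakayamaAutomorphism.integral_eq {d : ℕ} (h : HasFiniteRightExt k H d) {π : H →ₐ[k] k}
    (hπ : ∀ (h : H) (e : ExtRight k H d), h • e = π h • e) {μ : H ≃ₐ[k] H}
    (hμ : IsNakayamaAutomorphism d μ) (x : H) : π x = counit (R := k) (μ.symm x) := by
  obtain ⟨u, hu⟩ := hμ.exists_unit h hπ
  -- conjugation by a unit does not change the value of the character `ε ∘ μ⁻¹`
  let χ : H →ₐ[k] k := (Bialgebra.counitAlgHom k H).comp (μ.symm : H →ₐ[k] H)
  have hχ : ∀ y, χ y = counit (R := k) (μ.symm y) := fun _ => rfl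
  have e := congrArg χ (hu x)
  rw [map_mul, map_mul, mul_comm] at e
  have e' := mul_left_cancel₀ ((u.isUnit.map χ).ne_zero) e
  rw [hχ, hχ, μ.symm_apply_apply, counit_twistedWinding] at e'
  exact e'.symm

/-- The bimodules `A^σ` and `A` are isomorphic exactly when `σ` is inner, and trivial integrals make
`S²` the inverse of a Nakayama automorphism. -/
theorem isCalabiYau_iff {d : ℕ} : IsCalabiYau k H d ↔
    IsPerfect (trivialRight k H) ∧ IsAntipodeSqInner k H ∧
      IsRightHomologicalIntegral d (Bialgebra.counitAlgHom k H) := by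
  constructor
  · intro h
    have hN : IsNakayamaAutomorphism d (AlgEquiv.refl : H ≃ₐ[k] H) := h
    have hF := (IsSkewCalabiYau.hasVanDenBerghDuality ⟨_, hN⟩).hasFiniteRightExt
    obtain ⟨π, hπ⟩ := hF.exists_character
    obtain rfl : π = Bialgebra.counitAlgHom k H :=
      AlgHom.ext fun x => hN.integral_eq hF hπ x
    obtain ⟨u, hu⟩ := hN.exists_unit hF hπ
    refine ⟨hF.perfect, ⟨u⁻¹, fun x => ?_⟩, hF.isRightArtinSchelter, hπ⟩
    have : x * u = u * twistedWinding (Bialgebra.counitAlgHom k H) x := hu x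
    rw [twistedWinding_counit] at this
    rw [inv_inv, mul_assoc, this, Units.inv_mul_cancel_left]
  · rintro ⟨hp, ⟨u, hu⟩, hAS, hπ⟩
    have hT := (isPerfect_iff.1 hp).1
    obtain ⟨g, hg⟩ := exists_dual_equiv hT hAS.finrank_eq_one hπ
    refine ⟨isSmoothConcentrated_iff.2 ⟨hp, fun i hi => hAS.subsingleton hi⟩,
      (nonempty_iso_twist_iff g hg (AlgHom.id k H)).2
        ⟨{ u⁻¹.mulLeft with map_add' := fun x y => mul_add _ x y }, fun a b v => ?_⟩⟩
    change (↑u⁻¹ : H) * (twistedWinding (Bialgebra.counitAlgHom k H) a * v * b) =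
      a * (↑u⁻¹ * v) * b
    rw [twistedWinding_counit, hu]
    simp only [mul_assoc, Units.inv_mul_cancel_left]

end Duality

end

end HopfDuality

theorem theorem2 {k H : Type u} [Field k] [Ring H] [HopfAlgebra k H] :
    -- the three conditions are equivalent
    [∃ d : ℕ, HasVanDenBerghDuality k H d,
      ∃ d : ℕ, HasFiniteRightExt k H d,
      ∃ d : ℕ, IsSkewCalabiYau k H d].TFAE ∧
    -- the dimensions involved in them coincide
    (∀ d₁ d₂ d₃ : ℕ, HasVanDenBerghDuality k H d₁ → HasFiniteRightExt k H d₂ →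
      IsSkewCalabiYau k H d₃ → d₁ = d₂ ∧ d₂ = d₃) ∧
    -- under these conditions there is a right homological integral, which determines and is
    -- determined by the Nakayama automorphisms
    (∀ d : ℕ, HasVanDenBerghDuality k H d →
      (∃! π : H →ₐ[k] k, IsRightHomologicalIntegral d π) ∧
      ∀ π : H →ₐ[k] k, IsRightHomologicalIntegral d π →
        (∃ (S : H ≃ₗ[k] H) (σ : H ≃ₐ[k] H),
          S.toLinearMap = HopfAlgebra.antipode k ∧
          (∀ h, σ h =
            S.symm (S.symm (rightWinding (π.toLinearMap ∘ₗ HopfAlgebra.antipode k) h))) ∧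
          (∀ h, σ.symm h = S (S (rightWinding π.toLinearMap h))) ∧
          IsNakayamaAutomorphism d σ) ∧
        ∀ μ : H ≃ₐ[k] H, IsNakayamaAutomorphism d μ →
          ∀ h, π h = Coalgebra.counit (R := k) (μ.symm h)) ∧
    -- characterisation of the Calabi-Yau property
    (∀ d : ℕ, IsCalabiYau k H d ↔
      IsPerfect (trivialRight k H) ∧ IsAntipodeSqInner k H ∧
        IsRightHomologicalIntegral d (Bialgebra.counitAlgHom k H)) := by
  have h₁ : ∀ d, HasVanDenBerghDuality k H d → HasFiniteRightExt k H d :=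
    fun _ h => h.hasFiniteRightExt
  have h₂ : ∀ d, HasFiniteRightExt k H d → IsSkewCalabiYau k H d := fun _ h => h.isSkewCalabiYau
  have h₃ : ∀ d, IsSkewCalabiYau k H d → HasVanDenBerghDuality k H d :=
    fun _ h => h.hasVanDenBerghDuality
  refine ⟨?_, ?_, ?_, fun d => isCalabiYau_iff⟩
  · tfae_have 1 → 2 := fun ⟨d, h⟩ => ⟨d, h₁ d h⟩
    tfae_have 2 → 3 := fun ⟨d, h⟩ => ⟨d, h₂ d h⟩
    tfae_have 3 → 1 := fun ⟨d, h⟩ => ⟨d, h₃ d h⟩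
    tfae_finish
  · exact fun d₁ d₂ d₃ hd₁ hd₂ hd₃ =>
      ⟨(h₁ d₁ hd₁).degree_unique hd₂, hd₂.degree_unique (h₁ d₃ (h₃ d₃ hd₃))⟩
  · intro d hd
    have h := h₁ d hd
    obtain ⟨π₀, hπ₀⟩ := h.exists_character
    refine ⟨⟨π₀, ⟨h.isRightArtinSchelter, hπ₀⟩,
      fun π hπ => hπ.unique ⟨h.isRightArtinSchelter, hπ₀⟩⟩, fun π hπ => ⟨?_, ?_⟩⟩
    · obtain ⟨σ, hσ, hN⟩ := exists_isNakayamaAutomorphism h hπ.2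
      let S : H ≃ₗ[k] H := LinearEquiv.ofBijective (HopfAlgebra.antipode k) h.bijective
      have hS : ∀ x, HopfAlgebra.antipode k (S.symm x) = x := S.apply_symm_apply
      refine ⟨S, σ, rfl, fun x => ?_, hσ, hN⟩
      apply σ.symm.injective
      rw [σ.symm_apply_apply, hσ, twistedWinding_apply, ← rightWinding_antipode_antipode, hS, hS,
        rightWinding_characterInv]
    · exact fun μ hμ => hμ.integral_eq h hπ.2
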